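/- **Definitions.** A *conjunctive formula* over variables $x_1,\dots,x_r$ is a finite set of pins ($x_i=0$ or $x_i=1$) and of clauses, each of positive arity, where either all clauses are ORs or all clauses are NANDs (negated conjunctions). A relation $R\subseteq\{0,1\}^r$ is *OR-conj* (respectively *NAND-conj*) if it is the set of satisfying assignments of such a formula with OR (respectively NAND) clauses. The formula is *normalized* if no pinned variable appears in a clause, the arguments of each clause are distinct, each clause has at least two arguments, and no clause's arguments are a subset of another's. Its *width* is the greatest number of arguments of a clause ($0$ if there are no clauses). Let $R_{\mathrm{zero}}=\{0\}$ and $R_{\mathrm{one}}=\{1\}$ (unary relations). For a finite set $\Gamma$ of named Boolean relations, an instance of $\#\mathrm{CSP}_d(\Gamma)$ is a finite set $V$ of variables and a set of constraints $S(v_1,\dots,v_s)$ with $S\in\Gamma$ of arity $s$ and $v_1,\dots,v_s\in V$ (not necessarily distinct), such that each variable appears at most $d$ times, counted with repetition, in the constraints; its value is the number of assignments $V\to\{0,1\}$ that satisfy all constraints. An instance of $\#w\text{-}\mathrm{HIS}_d$ is a finite hypergraph (a finite set $V$ of vertices and a set of non-empty hyper-edges $e\subseteq V$) whose largest hyper-edge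 has exactly $w$ elements ($w=0$ if there are no hyper-edges) and in which every vertex lies in at most $d$ hyper-edges; its value is the number of independent sets, i.e. sets of vertices that contain no hyper-edge. Variables and vertices are listed explicitly in the encoding of an instance as a string, and $|x|$ is the length of the encoding of $x$. A *randomized approximation scheme* for a counting problem $f$ produces, from an instance $x$ and an error bound $\varepsilon\in(0,1)$, a random natural number $Y$ with $\Pr(e^{-\varepsilon}f(x)\le Y\le e^{\varepsilon}f(x))\ge 3/4$; error bounds are presented as $\varepsilon=1/m$ with an integer $m\ge 2$, written in unary. A counting problem $f$ is *AP-reducible* to a counting problem $g$, written $f\le_{\mathrm{AP}}g$, if there is a probabilistic oracle Turing machine $M$ with input $(x,\varepsilon)$, $x$ an instance of $f$, such that (i) every oracle call of $M$ is of the form $(y,\delta)$ with $y$ an instance of $g$, $0<\delta<1$ and $\delta^{-1}\le\mathrm{poly}(|x|,\varepsilon^{-1})$; (ii) $M$ is a randomized approximation scheme for $f$ whenever the oracle is one for $g$; (iii) the running time of $M$ is at most $\mathrm{poly}(|x|,\varepsilon^{-1})$. **Proposition.** Let $R$ be an OR-conj (respectively NAND-conj) relation. Then $R$ is defined by a normalized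 formula with OR (respectively NAND) clauses. Moreover, let $\varphi$ be any such normalized formula defining $R$, let $w$ be its width, and let $k$ be the greatest number of times that any variable appears in $\varphi$ (pins included; $k=0$ if there are no variables). Then, for every $d\ge 2$, $$\#\mathrm{CSP}_d(\{R\}\cup\{R_{\mathrm{zero}},R_{\mathrm{one}}\})\;\le_{\mathrm{AP}}\;\#w\text{-}\mathrm{HIS}_{kd}.$$ -/

import Mathlib

open scoped ENNReal

namespace BoundedCSP

/-! ## Counting problems, as functions on strings over a two-letter alphabet -/

/-- A counting problem: a type of (presentations of) instances, an unambiguous encoding of them as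
binary strings, and the number attached to each instance. -/
structure CountingProblem where
  Inst : Type
  enc : Inst → List Bool
  enc_injective : Function.Injective enc
  count : Inst → ℕ

/-- The string that lists natural numbers in unary, each closed by a separator. -/
def unary (l : List ℕ) : List Bool :=
  l.flatMap fun n => List.replicate n true ++ [false]

theorem unary_cons (n : ℕ) (l : List ℕ) :
    unary (n :: l) = List.replicate n true ++ false :: unary l := by
  simp [unary]

theorem unary_injective : Function.Injective unary := by
  have aux : ∀ (m n : ℕ) (s t : List Bool),
      List.replicate m true ++ false :: s = List.replicate n true ++ false :: t →
        m = n ∧ s = t := by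
    intro m
    induction m with
    | zero =>
      intro n s t h
      cases n with
      | zero => simpa using h
      | succ n => simp [List.replicate_succ] at h
    | succ m ih =>
      intro n s t h
      cases n with
      | zero => simp [List.replicate_succ] at h
      | succ n =>
        have h' := ih n s t (by simpa [List.replicate_succ] using h)
        exact ⟨by rw [h'.1], h'.2⟩
  intro l
  induction l with
  | nil =>
    intro l' h
    cases l' with
    | nil => rfl
    | cons n l' => rw [unary_cons] at h; simp [unary] at h
  | cons m l ih =>
    intro l' h
    cases l' with
    | nil => rw [unary_cons] at h; simp [unary] at h
    | cons n l' =>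
      rw [unary_cons, unary_cons] at h
      obtain ⟨h1, h2⟩ := aux _ _ _ _ h
      rw [h1, ih h2]

/-- The number written in binary by a string, least significant bit first. -/
def decodeBits (l : List Bool) : ℕ := l.foldr Nat.bit 0

/-! ## Randomized approximation schemes

An error bound `ε ∈ (0,1)` is presented as `ε = 1 / m` with an integer `m ≥ 2`. -/

/-- A function that sends a string and an error parameter `m` to a random natural number. -/
abbrev Approximator := List Bool → ℕ → PMF ℕ

/-- `Y` approximates `z` with relative error at most `e ^ ε`, where `ε = 1 / m`. For `z = 0` this
means `Y = 0`. -/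
def Approximates (m z Y : ℕ) : Prop :=
  Real.exp (-(1 / (m : ℝ))) * z ≤ Y ∧ (Y : ℝ) ≤ Real.exp (1 / (m : ℝ)) * z

/-- `A` is a randomized approximation scheme for the counting problem `f`: with probability at
least `3 / 4` its value is a good approximation. -/
def IsRAS (A : Approximator) (f : CountingProblem) : Prop :=
  ∀ (x : f.Inst) (m : ℕ), 2 ≤ m →
    (3 / 4 : ℝ≥0∞) ≤ (A (f.enc x) m).toOuterMeasure {Y | Approximates m (f.count x) Y}

/-! ## Probabilistic oracle Turing machines -/

/-- The stacks through which a machine communicates: its input string, its error parameter (in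
unary), the string and the error parameter (in unary) of the next oracle call, the answer to the
last oracle call (in binary) and its output (in binary). -/
inductive Port
  | input
  | error
  | query
  | queryError
  | answer
  | output
  deriving DecidableEq

/-- The ports carry bits; the work stacks, indexed by `W`, carry letters from `A`. -/
abbrev Alphabet (W A : Type) : Port ⊕ W → Type := Sum.elim (fun _ => Bool) (fun _ => A)

/-- A probabilistic oracle Turing machine, in the multi-stack presentation. All of the index
sets are finite. In each step a fair coin decides which of the two programs is used; at the
label `ask` the machine calls the oracle instead, and goes on from the label `resume`. -/
structure ProbOracleTM where
  W : Type
  A : Type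
  Label : Type
  State : Type
  decW : DecidableEq W
  finW : Finite W
  finA : Finite A
  finLabel : Finite Label
  finState : Finite State
  main : Label
  ask : Label
  resume : Label
  start : State
  prog : Bool → Label → Turing.TM2.Stmt (Alphabet W A) Label State

namespace ProbOracleTM

/-- Configurations: current label (`none` when the machine has halted), internal state, stacks. -/
abbrev Cfg (M : ProbOracleTM) : Type :=
  Turing.TM2.Cfg (Alphabet M.W M.A) M.Label M.State

/-- Contents of a port. -/
def port (M : ProbOracleTM) (c : M.Cfg) (p : Port) : List Bool := c.stk (Sum.inl p)

/-- The initial configuration on input `x` with error parameter `m`. -/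
def initial (M : ProbOracleTM) (x : List Bool) (m : ℕ) : M.Cfg where
  l := some M.main
  var := M.start
  stk := fun
    | .inl .input => x
    | .inl .error => List.replicate m true
    | .inl _ => []
    | .inr _ => []

/-- The configuration after the oracle has answered `y`: the two query stacks have been emptied,
and the answer stack holds the binary digits of `y`, the least significant one on top. -/
def answered (M : ProbOracleTM) (c : M.Cfg) (y : ℕ) : M.Cfg where
  l := some M.resume
  var := c.var
  stk := fun
    | .inl .query => []
    | .inl .queryError => []
    | .inl .answer => y.bits
    | .inl p => c.stk (.inl p)
    | .inr w => c.stk (.inr w)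

open Classical in
/-- One step of the machine with oracle `O`, as a random configuration. An oracle call counts as
one step, and different calls are answered independently. A halted configuration does not
change. -/
noncomputable def step (M : ProbOracleTM) (O : Approximator) (c : M.Cfg) : PMF M.Cfg :=
  haveI := M.decW
  match c.l with
  | none => PMF.pure c
  | some q =>
    if q = M.ask then
      (O (M.port c .query) (M.port c .queryError).length).map (M.answered c)
    else
      (PMF.uniformOfFintype Bool).map fun b => Turing.TM2.stepAux (M.prog b q) c.var c.stk

/-- The random configuration after `t` steps on input `x` with error parameter `m`. -/
noncomputable def run (M : ProbOracleTM) (O : Approximator) (x : List Bool) (m : ℕ) :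
    ℕ → PMF M.Cfg
  | 0 => PMF.pure (M.initial x m)
  | t + 1 => (M.run O x m t).bind (M.step O)

/-- The random number on the output stack after `t` steps. -/
noncomputable def outputAfter (M : ProbOracleTM) (O : Approximator) (x : List Bool) (m t : ℕ) :
    PMF ℕ :=
  (M.run O x m t).map fun c => decodeBits (M.port c .output)

end ProbOracleTM

/-! ## Approximation-preserving reductions -/

/-- `f` is AP-reducible to `g`: there are a probabilistic oracle Turing machine `M` and a
polynomial `p` such that on every instance `x` of `f` and every `ε = 1 / m`, whatever the oracle
answers and whatever the coins are,
* `M` halts within `p (|x| + 1 / ε)` steps,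
* every oracle call is a pair of an instance of `g` and an error bound `0 < δ < 1` with
  `1 / δ ≤ p (|x| + 1 / ε)`,

and `M` is a randomized approximation scheme for `f` whenever the oracle is one for `g`. -/
def APReducible (f g : CountingProblem) : Prop :=
  ∃ (M : ProbOracleTM) (p : Polynomial ℕ),
    (∀ (O : Approximator) (x : f.Inst) (m : ℕ), 2 ≤ m →
      (∀ c ∈ (M.run O (f.enc x) m (p.eval ((f.enc x).length + m))).support, c.l = none) ∧
      (∀ (t : ℕ), ∀ c ∈ (M.run O (f.enc x) m t).support, c.l = some M.ask →
        (∃ y : g.Inst, M.port c .query = g.enc y) ∧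
        2 ≤ (M.port c .queryError).length ∧
        (M.port c .queryError).length ≤ p.eval ((f.enc x).length + m))) ∧
    ∀ O : Approximator, IsRAS O g →
      IsRAS (fun x m => M.outputAfter O x m (p.eval (x.length + m))) f

/-! ## Boolean constraint satisfaction -/

/-- A Boolean relation with its arity. -/
structure BoolRel where
  arity : ℕ
  rel : Set (Fin arity → Bool)

/-- The relation `{0}`. -/
def relZero : BoolRel := ⟨1, {fun _ => false}⟩

/-- The relation `{1}`. -/
def relOne : BoolRel := ⟨1, {fun _ => true}⟩

/-- A finite constraint language; the name of a relation is its position in the list. -/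
abbrev ConstraintLanguage := List BoolRel

/-- The language that consists of the two pins. -/
def pinLanguage : ConstraintLanguage := [relZero, relOne]

/-- A constraint over `Γ` with variables in `V`: the name of a relation, and a scope whose entries
need not be distinct. -/
abbrev Constraint (Γ : ConstraintLanguage) (V : Type) : Type :=
  Σ i : Fin Γ.length, (Fin (Γ.get i).arity → V)

/-- An instance of CSP over `Γ` with variable set `V`. -/
structure CSPInstance (Γ : ConstraintLanguage) (V : Type) where
  constraints : Finset (Constraint Γ V)

namespace CSPInstance

variable {Γ : ConstraintLanguage} {V : Type}

/-- The assignment `a` satisfies every constraint. -/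
def Satisfies (I : CSPInstance Γ V) (a : V → Bool) : Prop :=
  ∀ c ∈ I.constraints, (fun j => a (c.2 j)) ∈ (Γ.get c.1).rel

/-- The number of satisfying assignments. -/
noncomputable def Z (I : CSPInstance Γ V) : ℕ := {a : V → Bool | I.Satisfies a}.ncard

/-- The number of times the variable `v` appears in the scopes of the constraints. -/
def varDegree [DecidableEq V] (I : CSPInstance Γ V) (v : V) : ℕ :=
  ∑ c ∈ I.constraints, (Finset.univ.filter fun j => c.2 j = v).card

/-- The greatest number of times that any variable appears. -/
def degree [Fintype V] [DecidableEq V] (I : CSPInstance Γ V) : ℕ := Finset.univ.sup I.varDegree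

end CSPInstance

/-- A presentation of a CSP instance: the variables are `0, …, n - 1`, and the set of constraints
is listed, in any order and possibly with repetitions. -/
structure CSPCode (Γ : ConstraintLanguage) where
  n : ℕ
  constraints : List (Constraint Γ (Fin n))

namespace CSPCode

variable {Γ : ConstraintLanguage}

/-- The instance that is presented. -/
def toInstance (C : CSPCode Γ) : CSPInstance Γ (Fin C.n) := ⟨C.constraints.toFinset⟩

/-- A constraint is written as the name of its relation followed by its scope. -/
def constraintNumbers {n : ℕ} (c : Constraint Γ (Fin n)) : List ℕ :=
  (c.1 : ℕ) :: List.ofFn fun j => (c.2 j : ℕ)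

/-- The encoding; as the variables are listed explicitly, all numbers are written in unary. -/
def enc (C : CSPCode Γ) : List Bool := unary (C.n :: C.constraints.flatMap constraintNumbers)

theorem constraintNumbers_append_inj {n : ℕ} (c c' : Constraint Γ (Fin n)) (s t : List ℕ)
    (h : constraintNumbers c ++ s = constraintNumbers c' ++ t) : c = c' ∧ s = t := by
  obtain ⟨i, v⟩ := c
  obtain ⟨i', v'⟩ := c'
  simp only [constraintNumbers, List.cons_append, List.cons.injEq] at h
  obtain ⟨h1, h2⟩ := h
  obtain rfl : i = i' := Fin.ext h1
  obtain ⟨h3, h4⟩ := List.append_inj h2 (by simp)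
  refine ⟨?_, h4⟩
  have h5 : v = v' := by
    funext j
    exact Fin.ext (congrFun (List.ofFn_injective h3) j)
  rw [h5]

theorem enc_injective : Function.Injective (enc (Γ := Γ)) := by
  intro C C' h
  obtain ⟨n, l⟩ := C
  obtain ⟨n', l'⟩ := C'
  have h' := unary_injective h
  simp only [List.cons.injEq] at h'
  obtain ⟨rfl, h2⟩ := h'
  congr 1
  clear h
  induction l generalizing l' with
  | nil =>
    cases l' with
    | nil => rfl
    | cons c l' => simp [constraintNumbers] at h2
  | cons c l ih =>
    cases l' with
    | nil => simp [constraintNumbers] at h2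
    | cons c' l' =>
      rw [List.flatMap_cons, List.flatMap_cons] at h2
      obtain ⟨h3, h4⟩ := constraintNumbers_append_inj _ _ _ _ h2
      rw [h3, ih _ h4]

end CSPCode

/-- The problem of counting the satisfying assignments of the CSP instances over `Γ` of degree at
most `d`. -/
noncomputable def sharpCSP (Γ : ConstraintLanguage) (d : ℕ) : CountingProblem where
  Inst := {C : CSPCode Γ // C.toInstance.degree ≤ d}
  enc C := C.1.enc
  enc_injective := CSPCode.enc_injective.comp Subtype.val_injective
  count C := C.1.toInstance.Z

/-! ## Hypergraphs -/

/-- A hypergraph on the vertex set `V`: a set of non-empty hyper-edges. -/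
structure Hypergraph (V : Type) where
  edges : Finset (Finset V)
  nonempty_of_mem : ∀ e ∈ edges, e.Nonempty

namespace Hypergraph

variable {V : Type}

/-- The number of hyper-edges that contain `v`. -/
def vertexDegree [DecidableEq V] (H : Hypergraph V) (v : V) : ℕ :=
  (H.edges.filter fun e => v ∈ e).card

/-- The maximum degree of a vertex. -/
def degree [Fintype V] [DecidableEq V] (H : Hypergraph V) : ℕ := Finset.univ.sup H.vertexDegree

/-- The maximum size of a hyper-edge (`0` if there are none). -/
def width (H : Hypergraph V) : ℕ := H.edges.sup Finset.card

/-- A set of vertices is independent if it contains no hyper-edge. -/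
def IsIndependent (H : Hypergraph V) (S : Finset V) : Prop := ∀ e ∈ H.edges, ¬ e ⊆ S

/-- The number of independent sets. -/
noncomputable def numIndependent (H : Hypergraph V) : ℕ :=
  {S : Finset V | H.IsIndependent S}.ncard

end Hypergraph

/-- A presentation of a hypergraph: the vertices are `0, …, n - 1`, and the set of hyper-edges, as
well as the elements of each of them, are listed, in any order and possibly with repetitions. -/
structure HypergraphCode where
  n : ℕ
  edges : List (List (Fin n))
  ne_nil_of_mem : ∀ e ∈ edges, e ≠ []

namespace HypergraphCode

/-- The hypergraph that is presented. -/
def toHypergraph (C : HypergraphCode) : Hypergraph (Fin C.n) where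
  edges := (C.edges.map List.toFinset).toFinset
  nonempty_of_mem := by
    intro e he
    simp only [List.mem_toFinset, List.mem_map] at he
    obtain ⟨l, hl, rfl⟩ := he
    exact List.toFinset_nonempty_iff l |>.2 (C.ne_nil_of_mem l hl)

/-- A hyper-edge is written as the length of its list followed by the list. -/
def edgeNumbers {n : ℕ} (e : List (Fin n)) : List ℕ := e.length :: e.map Fin.val

/-- The encoding; as the vertices are listed explicitly, all numbers are written in unary. -/
def enc (C : HypergraphCode) : List Bool := unary (C.n :: C.edges.flatMap edgeNumbers)

theorem enc_injective : Function.Injective enc := by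
  intro C C' h
  obtain ⟨n, l, hl⟩ := C
  obtain ⟨n', l', hl'⟩ := C'
  have h' := unary_injective h
  simp only [List.cons.injEq] at h'
  obtain ⟨rfl, h2⟩ := h'
  congr 1
  clear h hl hl'
  induction l generalizing l' with
  | nil =>
    cases l' with
    | nil => rfl
    | cons c l' => simp [edgeNumbers] at h2
  | cons c l ih =>
    cases l' with
    | nil => simp [edgeNumbers] at h2
    | cons c' l' =>
      simp only [List.flatMap_cons, edgeNumbers, List.cons_append, List.cons.injEq] at h2
      obtain ⟨h3, h4⟩ := h2
      obtain ⟨h5, h6⟩ := List.append_inj h4 (by simpa using h3)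
      rw [List.map_injective_iff.2 Fin.val_injective h5, ih _ h6]

end HypergraphCode

/-- The problem of counting the independent sets in hypergraphs of width `w` and of degree at
most `d`. -/
noncomputable def sharpHIS (w d : ℕ) : CountingProblem where
  Inst := {C : HypergraphCode // C.toHypergraph.width = w ∧ C.toHypergraph.degree ≤ d}
  enc C := C.1.enc
  enc_injective := HypergraphCode.enc_injective.comp Subtype.val_injective
  count C := C.1.toHypergraph.numIndependent

/-! ## OR-conj and NAND-conj relations -/

/-- The two kinds of clauses. -/
inductive Connective
  | or
  | nand

/-- The value of an OR, respectively NAND, of the listed variables under the assignment `a`. -/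
def Connective.Holds {r : ℕ} : Connective → (Fin r → Bool) → List (Fin r) → Prop
  | .or, a, l => ∃ i ∈ l, a i = true
  | .nand, a, l => ∃ i ∈ l, a i = false

/-- A conjunction of pins (`(i, b)` stands for `xᵢ = b`) and of ORs or NANDs, each of them given
by the non-empty list of its arguments. -/
structure ConjFormula (r : ℕ) where
  pins : Finset (Fin r × Bool)
  clauses : Finset (List (Fin r))
  ne_nil_of_mem : ∀ l ∈ clauses, l ≠ []

namespace ConjFormula

variable {r : ℕ}

/-- The relation that the formula defines when its clauses are read as ORs, respectively NANDs. -/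
def rel (φ : ConjFormula r) (κ : Connective) : Set (Fin r → Bool) :=
  {a | (∀ p ∈ φ.pins, a p.1 = p.2) ∧ ∀ l ∈ φ.clauses, κ.Holds a l}

/-- No pinned variable appears in a clause, the arguments of each clause are distinct, every
clause has at least two arguments, and no clause's arguments are a subset of any other's. -/
structure IsNormalized (φ : ConjFormula r) : Prop where
  pinned_not_mem : ∀ p ∈ φ.pins, ∀ l ∈ φ.clauses, p.1 ∉ l
  nodup : ∀ l ∈ φ.clauses, l.Nodup
  two_le_length : ∀ l ∈ φ.clauses, 2 ≤ l.length
  not_subset : ∀ l ∈ φ.clauses, ∀ l' ∈ φ.clauses, l ≠ l' → ¬ l ⊆ l'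

/-- The greatest number of arguments of a clause (`0` if there are no clauses). -/
def width (φ : ConjFormula r) : ℕ := φ.clauses.sup List.length

/-- The number of times that the variable `i` appears in the formula, pins included. -/
def occurrences (φ : ConjFormula r) (i : Fin r) : ℕ :=
  (φ.pins.filter fun p => p.1 = i).card + ∑ l ∈ φ.clauses, l.count i

/-- The greatest number of times that any variable appears in the formula. -/
def maxOccurrences (φ : ConjFormula r) : ℕ := Finset.univ.sup φ.occurrences

end ConjFormula

/-- `R` is an OR-conj relation (for `κ = or`) or a NAND-conj relation (for `κ = nand`). -/
def IsConj (κ : Connective) (R : BoolRel) : Prop :=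
  ∃ φ : ConjFormula R.arity, φ.rel κ = R.rel

end BoundedCSP

namespace BoundedCSP

/-! The reduction makes at most one oracle call and preserves the count exactly. Each relation of
the language is a conjunction of pins and of clauses of one kind: `R` through the given formula `φ`,
the relations {0} and {1} through a single pin. Substituting the scopes turns an instance into one
large conjunction over its variables (`satisfies_iff`). Let β be the value that satisfies a clause:
1 for OR, 0 for NAND. Describe an assignment by the set of variables of value ¬β. A clause is
violated exactly when this set contains all its arguments, so a clause acts as a hyper-edge, and a
pin to β as a hyper-edge with one element. A variable pinned to ¬β is deleted from all clauses, and
a hyper-edge with one element keeps its vertex out of independent sets, so that it is not counted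
twice. If some variable is pinned both ways, or some clause loses all its arguments, there are no
solutions and the machine outputs 0 without a call. Otherwise solutions correspond to independent
sets (`numIndependent_reductionHypergraph`).

The width has to be exactly w, although the instance need not contain a clause with w remaining
arguments. For w > 0 this is repaired by w fresh vertices, each forced out by a one-element
hyper-edge, and the hyper-edge of all of them. This multiplies the count by 1 and creates vertices
of degree at most 2 ≤ kd; here d ≥ 2 is needed, and k ≥ 1 because some variable occurs in a clause.
At the vertex of a variable, each of its at most d occurrences in scopes accounts for at most k
hyper-edges (`degree_reductionHypergraph`). For w = 0 there are no clauses and no hyper-edges are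
allowed; pinned variables are left out, and the count is a power of two (`Z_eq_two_pow`).

The running time is established on an explicit machine, compiled from structured programs. It reads
the instance twice: once to collect the pins of every variable, once to write the hypergraph. The
error parameter is passed on unchanged. A good answer has at most n + w + 1 bits, so copying at most
n + w + 2 bits bounds the time for every oracle and does not damage good answers
(`apReducible_of_reduction`).

For the existence of a normalized formula, a nonempty relation is described by all pins it implies
together with all inclusion-minimal implied clauses whose arguments are not constant on it
(`rel_normalForm`). The empty relation is given by two contradictory pins. -/

/-! ## Structured programs on stacks -/

/-- Structured programs on stacks indexed by `K`, with internal state in `σ`. -/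
inductive Prog {K : Type} (Γ : K → Type) (σ : Type)
  | skip : Prog Γ σ
  | push (k : K) (f : σ → Γ k) : Prog Γ σ
  | pop (k : K) (f : σ → Option (Γ k) → σ) : Prog Γ σ
  | load (f : σ → σ) : Prog Γ σ
  | seq (p q : Prog Γ σ) : Prog Γ σ
  | ite (b : σ → Bool) (p q : Prog Γ σ) : Prog Γ σ
  | loop (b : σ → Bool) (p : Prog Γ σ) : Prog Γ σ

namespace Prog

open Turing

variable {K : Type} {Γ : K → Type} {σ Λ : Type}

/-- The labels needed for a program: one for each loop. -/
def Loops : Prog Γ σ → Type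
  | seq p q => p.Loops ⊕ q.Loops
  | ite _ p q => p.Loops ⊕ q.Loops
  | loop _ p => Option p.Loops
  | _ => Empty

theorem finite_loops : ∀ p : Prog Γ σ, Finite p.Loops
  | skip => inferInstanceAs (Finite Empty)
  | push _ _ => inferInstanceAs (Finite Empty)
  | pop _ _ => inferInstanceAs (Finite Empty)
  | load _ => inferInstanceAs (Finite Empty)
  | seq p q =>
    haveI := finite_loops p
    haveI := finite_loops q
    inferInstanceAs (Finite (p.Loops ⊕ q.Loops))
  | ite _ p q =>
    haveI := finite_loops p
    haveI := finite_loops q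
    inferInstanceAs (Finite (p.Loops ⊕ q.Loops))
  | loop _ p =>
    haveI := finite_loops p
    inferInstanceAs (Finite (Option p.Loops))

/-- The statement that starts the program and goes on with `s`. -/
def stmt : (p : Prog Γ σ) → (p.Loops → Λ) → TM2.Stmt Γ Λ σ → TM2.Stmt Γ Λ σ
  | skip, _, s => s
  | push k f, _, s => .push k f s
  | pop k f, _, s => .pop k f s
  | load f, _, s => .load f s
  | seq p q, emb, s => p.stmt (fun l => emb (.inl l)) (q.stmt (fun l => emb (.inr l)) s)
  | ite b p q, emb, s =>
    .branch b (p.stmt (fun l => emb (.inl l)) s) (q.stmt (fun l => emb (.inr l)) s)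
  | loop _ _, emb, _ => .goto fun _ => emb none

/-- The statements at the labels of the program, when the program goes on with `s`. -/
def code : (p : Prog Γ σ) → (p.Loops → Λ) → TM2.Stmt Γ Λ σ → p.Loops → TM2.Stmt Γ Λ σ
  | seq p q, emb, s => Sum.elim
      (p.code (fun l => emb (.inl l)) (q.stmt (fun l => emb (.inr l)) s))
      (q.code (fun l => emb (.inr l)) s)
  | ite _ p q, emb, s => Sum.elim
      (p.code (fun l => emb (.inl l)) s) (q.code (fun l => emb (.inr l)) s)
  | loop b p, emb, s => fun l => Option.casesOn l
      (.branch b (p.stmt (fun l => emb (some l)) (.goto fun _ => emb none)) s)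
      (p.code (fun l => emb (some l)) (.goto fun _ => emb none))
  | _, _, s => fun _ => s

theorem code_loop_none (b : σ → Bool) (p : Prog Γ σ) (emb : Option p.Loops → Λ)
    (s : TM2.Stmt Γ Λ σ) : (loop b p).code emb s (none : Option p.Loops) =
      .branch b (p.stmt (fun l => emb (some l)) (.goto fun _ => emb none)) s := rfl

variable [DecidableEq K]

/-- One step of a deterministic stack machine; a halted configuration does not change. -/
def machineStep (M : Λ → TM2.Stmt Γ Λ σ) (c : TM2.Cfg Γ Λ σ) : TM2.Cfg Γ Λ σ :=
  match c.l with
  | none => c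
  | some l => TM2.stepAux (M l) c.var c.stk

/-- Started with `c`, the program terminates within `B` steps with `c'`, in every machine of which
it is a part. -/
def Runs (p : Prog Γ σ) (c : σ × (∀ k, List (Γ k))) (B : ℕ) (c' : σ × (∀ k, List (Γ k))) : Prop :=
  ∀ (Λ : Type) (M : Λ → TM2.Stmt Γ Λ σ) (emb : p.Loops → Λ) (s : TM2.Stmt Γ Λ σ),
    (∀ l, M (emb l) = p.code emb s l) →
    ∃ t ≤ B, (machineStep M)^[t] (TM2.stepAux (p.stmt emb s) c.1 c.2) = TM2.stepAux s c'.1 c'.2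

variable {c c₁ c₂ : σ × (∀ k, List (Γ k))} {B B' : ℕ} {p q : Prog Γ σ} {b : σ → Bool}

theorem Runs.mono (h : Runs p c B c₁) (hB : B ≤ B') : Runs p c B' c₁ := by
  intro Λ M emb s hM
  obtain ⟨t, ht, h⟩ := h Λ M emb s hM
  exact ⟨t, ht.trans hB, h⟩

theorem runs_skip : Runs skip c 0 c := fun _ _ _ _ _ => ⟨0, Nat.le_refl 0, Eq.refl _⟩

theorem runs_push (k : K) (f : σ → Γ k) :
    Runs (push k f) c 0 (c.1, Function.update c.2 k (f c.1 :: c.2 k)) :=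
  fun _ _ _ _ _ => ⟨0, Nat.le_refl 0, Eq.refl _⟩

theorem runs_pop (k : K) (f : σ → Option (Γ k) → σ) :
    Runs (pop k f) c 0 (f c.1 (c.2 k).head?, Function.update c.2 k (c.2 k).tail) :=
  fun _ _ _ _ _ => ⟨0, Nat.le_refl 0, Eq.refl _⟩

theorem runs_load (f : σ → σ) : Runs (load f) c 0 (f c.1, c.2) :=
  fun _ _ _ _ _ => ⟨0, Nat.le_refl 0, Eq.refl _⟩

/-- Since `Runs` quantifies over the continuation and over the surrounding machine, `p` can be run
with the statement of `q` as its continuation; no relabelling is needed. -/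
theorem Runs.seq (hp : Runs p c B c₁) (hq : Runs q c₁ B' c₂) :
    Runs (seq p q) c (B + B') c₂ := by
  intro Λ M emb s hM
  obtain ⟨t, ht, h⟩ := hp Λ M (fun l => emb (.inl l)) (q.stmt (fun l => emb (.inr l)) s)
    fun l => hM (.inl l)
  obtain ⟨t', ht', h'⟩ := hq Λ M (fun l => emb (.inr l)) s fun l => hM (.inr l)
  refine ⟨t' + t, by omega, ?_⟩
  rw [Function.iterate_add_apply]
  exact (congrArg _ h).trans h'

theorem runs_ite_true (hb : b c.1 = true) (hp : Runs p c B c₁) : Runs (ite b p q) c B c₁ := by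
  intro Λ M emb s hM
  obtain ⟨t, ht, h⟩ := hp Λ M (fun l => emb (.inl l)) s fun l => hM (.inl l)
  refine ⟨t, ht, ?_⟩
  simpa [stmt, hb] using h

theorem runs_ite_false (hb : b c.1 = false) (hq : Runs q c B c₁) : Runs (ite b p q) c B c₁ := by
  intro Λ M emb s hM
  obtain ⟨t, ht, h⟩ := hq Λ M (fun l => emb (.inr l)) s fun l => hM (.inr l)
  refine ⟨t, ht, ?_⟩
  simpa [stmt, hb] using h

theorem runs_loop_false (hb : b c.1 = false) : Runs (loop b p) c 1 c := by
  intro Λ M emb s hM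
  refine ⟨1, le_rfl, ?_⟩
  have h := (hM (none : Option p.Loops)).trans (code_loop_none b p emb s)
  change machineStep M ⟨some (emb (none : Option p.Loops)), c.1, c.2⟩ = _
  rw [machineStep]
  simp only [h, TM2.stepAux, hb, cond_false]

/-- A machine step executes a whole statement up to the next jump. Only the jump to a loop label
therefore costs a step, and this is the summand 1 for each evaluation of the test. -/
theorem runs_loop_true (hb : b c.1 = true) (hp : Runs p c B c₁) (hl : Runs (loop b p) c₁ B' c₂) :
    Runs (loop b p) c (B + B' + 1) c₂ := by
  intro Λ M emb s hM
  obtain ⟨t, ht, h⟩ := hp Λ M (fun l => emb (some l)) (.goto fun _ => emb none)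
    fun l => hM (some l)
  obtain ⟨t', ht', h'⟩ := hl Λ M emb s hM
  refine ⟨t' + (t + 1), by omega, ?_⟩
  have h0 := (hM (none : Option p.Loops)).trans (code_loop_none b p emb s)
  rw [Function.iterate_add_apply, Function.iterate_succ_apply]
  have h1 : machineStep M (TM2.stepAux ((loop b p).stmt emb s) c.1 c.2) =
      TM2.stepAux (p.stmt (fun l => emb (some l)) (.goto fun _ => emb none)) c.1 c.2 := by
    change machineStep M ⟨some (emb (none : Option p.Loops)), c.1, c.2⟩ = _
    rw [machineStep]
    simp only [h0, TM2.stepAux, hb, cond_true]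
  rw [h1]
  exact (congrArg _ h).trans h'

/-- Execute the programs `f x` for the `x` in the list. -/
def forEach {α : Type} (f : α → Prog Γ σ) : List α → Prog Γ σ
  | [] => skip
  | x :: l => seq (f x) (forEach f l)

/-- Execute the programs `f x` for the `x` in the list, from the last to the first. -/
def forEachRev {α : Type} (f : α → Prog Γ σ) : List α → Prog Γ σ
  | [] => skip
  | x :: l => seq (forEachRev f l) (f x)

/-- `F l` is the state once the items of `l` have been processed. The hypothesis is asked only at
splittings of `l₀`, so that for a duplicate-free list a round may use that its item is new. -/
theorem runs_forEach {α : Type} (f : α → Prog Γ σ) (B : ℕ)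
    (F : List α → σ × (∀ k, List (Γ k))) (l₀ : List α)
    (h : ∀ l x l', l₀ = l ++ x :: l' → Runs (f x) (F l) B (F (l ++ [x]))) :
    ∀ l l', l₀ = l ++ l' → Runs (forEach f l') (F l) (l'.length * B) (F l₀) := by
  intro l l'
  induction l' generalizing l with
  | nil => intro hl; simp only [List.append_nil] at hl; subst hl; simpa [forEach] using runs_skip
  | cons x l' ih =>
    intro hl
    have := (h l x l' hl).seq (ih (l ++ [x]) (by simp [hl]))
    exact this.mono (by simp [Nat.succ_mul, Nat.add_comm])

theorem runs_forEachRev {α : Type} (f : α → Prog Γ σ) (B : ℕ)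
    (F : List α → σ × (∀ k, List (Γ k))) (l₀ : List α)
    (h : ∀ x ∈ l₀, ∀ l, Runs (f x) (F l) B (F (x :: l))) :
    Runs (forEachRev f l₀) (F []) (l₀.length * B) (F l₀) := by
  induction l₀ with
  | nil => simpa [forEachRev] using runs_skip
  | cons x l ih =>
    have := (ih fun y hy => h y (List.mem_cons_of_mem _ hy)).seq (h x List.mem_cons_self l)
    exact this.mono (by simp [Nat.succ_mul])

end Prog

/-! ## From structured programs to oracle machines -/

namespace ProbOracleTM

/-- Labels of the machine that runs one program, calls the oracle, and runs another program. -/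
inductive OneCallLabel (α β : Type)
  | main
  | ask
  | resume
  | before (l : α)
  | after (l : β)

theorem finite_oneCallLabel (α β : Type) [Finite α] [Finite β] : Finite (OneCallLabel α β) := by
  let f : OneCallLabel α β → Fin 3 ⊕ (α ⊕ β)
    | .main => .inl 0
    | .ask => .inl 1
    | .resume => .inl 2
    | .before l => .inr (.inl l)
    | .after l => .inr (.inr l)
  refine Finite.of_injective f ?_
  intro x y h
  cases x <;> cases y <;> simp_all [f]

open Turing Prog

variable {W A σ : Type}

/-- The code of the machine that runs `p`, halts if `final` holds, and otherwise calls the oracle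
and runs `q`. -/
def oneCallCode (p q : Prog (Alphabet W A) σ) (final : σ → Bool) :
    OneCallLabel p.Loops q.Loops →
      TM2.Stmt (Alphabet W A) (OneCallLabel p.Loops q.Loops) σ
  | .main => p.stmt .before (.branch final .halt (.goto fun _ => .ask))
  | .ask => .goto fun _ => .ask
  | .resume => q.stmt .after .halt
  | .before l => p.code .before (.branch final .halt (.goto fun _ => .ask)) l
  | .after l => q.code .after .halt l

/-- The machine that runs `p`, halts if `final` holds, and otherwise calls the oracle
and runs `q`. -/
def oneCall [DecidableEq W] [Finite W] [Finite A] [Finite σ] (start : σ)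
    (p q : Prog (Alphabet W A) σ) (final : σ → Bool) : ProbOracleTM where
  W := W
  A := A
  Label := OneCallLabel p.Loops q.Loops
  State := σ
  decW := inferInstance
  finW := inferInstance
  finA := inferInstance
  finLabel :=
    haveI := finite_loops p
    haveI := finite_loops q
    finite_oneCallLabel _ _
  finState := inferInstance
  main := .main
  ask := .ask
  resume := .resume
  start := start
  prog := fun _ => oneCallCode p q final

/-- The step of a machine when the coin shows `true` and the oracle is not called. -/
def detStep (M : ProbOracleTM) (c : M.Cfg) : M.Cfg :=
  haveI := M.decW
  machineStep (M.prog true) c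

theorem step_eq_pure_detStep {M : ProbOracleTM} (hM : ∀ b l, M.prog b l = M.prog true l)
    (O : Approximator) (c : M.Cfg) (h : c.l ≠ some M.ask) :
    M.step O c = PMF.pure (M.detStep c) := by
  obtain ⟨l, v, S⟩ := c
  cases l with
  | none => rfl
  | some l =>
    have h1 : l ≠ M.ask := fun h' => h (by rw [h'])
    simp only [step, h1, if_false, hM _ l]
    exact PMF.map_const (PMF.uniformOfFintype Bool) _

theorem detStep_of_none {M : ProbOracleTM} (c : M.Cfg) (h : c.l = none) : M.detStep c = c := by
  obtain ⟨l, v, S⟩ := c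
  cases h
  rfl

/-- As long as no call occurs, a machine that ignores its coins is deterministic, so the only
randomness is that already present at time `s`. -/
theorem run_add {M : ProbOracleTM} (hM : ∀ b l, M.prog b l = M.prog true l)
    (O : Approximator) (x : List Bool) (m s t : ℕ)
    (h : ∀ c ∈ (M.run O x m s).support, ∀ t' < t, (M.detStep^[t'] c).l ≠ some M.ask) :
    M.run O x m (s + t) = (M.run O x m s).map M.detStep^[t] := by
  induction t with
  | zero => exact (PMF.map_id _).symm
  | succ t ih =>
    have h1 : M.run O x m (s + (t + 1)) = (M.run O x m (s + t)).bind (M.step O) := rfl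
    rw [h1, ih fun c hc t' ht' => h c hc t' (by omega), PMF.bind_map, PMF.map,
      Function.iterate_succ']
    ext y
    simp only [PMF.bind_apply]
    refine tsum_congr fun c => ?_
    -- The two kernels need to agree only on the support; elsewhere the weight is zero.
    by_cases hc : c ∈ (M.run O x m s).support
    · rw [Function.comp_apply, step_eq_pure_detStep hM _ _ (h c hc t (by omega))]
      rfl
    · rw [PMF.mem_support_iff, not_not] at hc
      rw [hc, zero_mul, zero_mul]

end ProbOracleTM

/-! ### Loops that consume a stack -/

namespace Prog

variable {K : Type} {Γ : K → Type} {σ : Type} [DecidableEq K]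

/-- Execute `p` and then, as long as `b` holds, `q` and `p`. -/
def drain (p : Prog Γ σ) (b : σ → Bool) (q : Prog Γ σ) : Prog Γ σ := seq p (loop b (seq q p))

/-- The invariant `S l l'` has the processed items in `l`, latest first, and the remaining ones in
`l'`; `T l x l'` is the moment after `x` has been popped. The pop `p` is free, so a round costs `B`
and one step for the test, and the last test costs one more. -/
theorem runs_drain {α : Type} {p q : Prog Γ σ} {b : σ → Bool} (B : ℕ) (l₀ : List α)
    (S : List α → List α → σ × (∀ k, List (Γ k)))
    (T : List α → α → List α → σ × (∀ k, List (Γ k)))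
    (e : σ × (∀ k, List (Γ k)))
    (hp : ∀ l x l', l₀ = l.reverse ++ x :: l' → Runs p (S l (x :: l')) 0 (T l x l'))
    (hb : ∀ l x l', l₀ = l.reverse ++ x :: l' → b (T l x l').1 = true)
    (hq : ∀ l x l', l₀ = l.reverse ++ x :: l' → Runs q (T l x l') B (S (x :: l) l'))
    (hpe : Runs p (S l₀.reverse []) 0 e) (hbe : b e.1 = false) :
    Runs (drain p b q) (S [] l₀) (l₀.length * (B + 1) + 1) e := by
  have key : ∀ l' l, l₀ = l.reverse ++ l' → ∃ c, Runs p (S l l') 0 c ∧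
      Runs (loop b (seq q p)) c (l'.length * (B + 1) + 1) e := by
    intro l'
    induction l' with
    | nil =>
      intro l hl
      have : l = l₀.reverse := by simp [hl]
      subst this
      exact ⟨e, hpe, (runs_loop_false hbe).mono (by omega)⟩
    | cons x l' ih =>
      intro l hl
      obtain ⟨c, hc, hc'⟩ := ih (x :: l) (by simp [hl])
      refine ⟨_, hp l x l' hl, ?_⟩
      refine (runs_loop_true (hb l x l' hl) ((hq l x l' hl).seq hc) hc').mono ?_
      simp only [List.length_cons, Nat.succ_mul]
      omega
  obtain ⟨c, hc, hc'⟩ := key l₀ [] (by simp)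
  exact (hc.seq hc').mono (by omega)

end Prog

/-! ## The memory of the reduction machine -/

/-- The pins on a variable: `cell b` says that it is pinned to `b`. -/
abbrev Cell := Bool → Bool

/-- The cell that holds the same bit twice. -/
abbrev Cell.const (b : Bool) : Cell := fun _ => b

/-- The internal state: the letters popped last from a port and from a work stack, a cell for each
argument position, and a flag. -/
structure Reg (P : Type) where
  last : Option Bool
  cell : Option Cell
  stat : P → Cell
  fail : Bool

/-- The work stacks: an array of cells, two auxiliary stacks, and a stack for each argument
position. -/
inductive WorkStack (P : Type)
  | arr
  | tmp
  | copy
  | arg (p : P)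
  deriving DecidableEq

/-- The internal state and the contents of all stacks. -/
structure Conf (P : Type) where
  last : Option Bool
  cell : Option Cell
  stat : P → Cell
  fail : Bool
  input : List Bool
  error : List Bool
  query : List Bool
  queryError : List Bool
  answer : List Bool
  output : List Bool
  arr : List Cell
  tmp : List Cell
  copy : List Cell
  arg : P → List Cell

/-- Programs of the reduction machine. -/
abbrev RProg (P : Type) := Prog (Alphabet (WorkStack P) Cell) (Reg P)

section

variable {P : Type}

theorem finite_workStack [Finite P] : Finite (WorkStack P) := by
  let f : WorkStack P → Fin 3 ⊕ P
    | .arr => .inl 0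
    | .tmp => .inl 1
    | .copy => .inl 2
    | .arg p => .inr p
  refine Finite.of_injective f ?_
  intro x y h
  cases x <;> cases y <;> simp_all [f]

theorem finite_reg [Finite P] : Finite (Reg P) :=
  Finite.of_injective (fun r : Reg P => (r.last, r.cell, r.stat, r.fail)) (by
    rintro ⟨⟩ ⟨⟩ h
    simpa using h)

namespace Conf

/-- The internal state. -/
def reg (c : Conf P) : Reg P := ⟨c.last, c.cell, c.stat, c.fail⟩

/-- The contents of the stacks. -/
def stk (c : Conf P) : ∀ k : Port ⊕ WorkStack P, List (Alphabet (WorkStack P) Cell k)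
  | .inl .input => c.input
  | .inl .error => c.error
  | .inl .query => c.query
  | .inl .queryError => c.queryError
  | .inl .answer => c.answer
  | .inl .output => c.output
  | .inr .arr => c.arr
  | .inr .tmp => c.tmp
  | .inr .copy => c.copy
  | .inr (.arg p) => c.arg p

/-- The internal state and the contents of the stacks. -/
def pair (c : Conf P) : Reg P × (∀ k, List (Alphabet (WorkStack P) Cell k)) := (c.reg, c.stk)

end Conf

variable [DecidableEq P]

/-- Started with `c`, the program terminates within `B` steps with `c'`. -/
def Exec (p : RProg P) (c : Conf P) (B : ℕ) (c' : Conf P) : Prop := Prog.Runs p c.pair B c'.pair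

section

variable {p q : RProg P} {b : Reg P → Bool} {c c₁ c₂ : Conf P} {B B' : ℕ}

theorem Exec.congr (h : Exec p c B c₁) (hc : c₁ = c₂) : Exec p c B c₂ := hc ▸ h

theorem Exec.congr_left (h : Exec p c B c₂) (hc : c₁ = c) : Exec p c₁ B c₂ := hc ▸ h

theorem Exec.mono (h : Exec p c B c₁) (hB : B ≤ B') : Exec p c B' c₁ := Prog.Runs.mono h hB

theorem exec_skip : Exec .skip c 0 c := Prog.runs_skip

theorem Exec.seq (hp : Exec p c B c₁) (hq : Exec q c₁ B' c₂) : Exec (.seq p q) c (B + B') c₂ :=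
  Prog.Runs.seq hp hq

theorem Exec.seq' (hp : Exec p c 0 c₁) (hq : Exec q c₁ B c₂) : Exec (.seq p q) c B c₂ :=
  (hp.seq hq).mono (by omega)

theorem exec_ite_true (hb : b c.reg = true) (hp : Exec p c B c₁) : Exec (.ite b p q) c B c₁ :=
  Prog.runs_ite_true hb hp

theorem exec_ite_false (hb : b c.reg = false) (hq : Exec q c B c₁) : Exec (.ite b p q) c B c₁ :=
  Prog.runs_ite_false hb hq

theorem exec_forEach {α : Type} (f : α → RProg P) (B : ℕ) (F : List α → Conf P) (l₀ : List α)
    (h : ∀ l x l', l₀ = l ++ x :: l' → Exec (f x) (F l) B (F (l ++ [x]))) :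
    Exec (.forEach f l₀) (F []) (l₀.length * B) (F l₀) :=
  Prog.runs_forEach f B (fun l => (F l).pair) l₀ h [] l₀ rfl

theorem exec_forEachRev {α : Type} (f : α → RProg P) (B : ℕ) (F : List α → Conf P) (l₀ : List α)
    (h : ∀ x ∈ l₀, ∀ l, Exec (f x) (F l) B (F (x :: l))) :
    Exec (.forEachRev f l₀) (F []) (l₀.length * B) (F l₀) :=
  Prog.runs_forEachRev f B (fun l => (F l).pair) l₀ h

end

/-- Translates the update of a dependent family of stacks into a change of one field of the record
`Conf`, so that each concrete instruction is settled by a case check over the stacks. -/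
theorem exec_push (k : Port ⊕ WorkStack P) (f : Reg P → Alphabet (WorkStack P) Cell k)
    (c c' : Conf P) (hr : c'.reg = c.reg) (hk : c'.stk k = f c.reg :: c.stk k)
    (h : ∀ k' ≠ k, c'.stk k' = c.stk k') : Exec (.push k f) c 0 c' := by
  have : c'.pair = (c.reg, Function.update c.stk k (f c.reg :: c.stk k)) := by
    refine Prod.ext hr ?_
    funext k'
    by_cases hk' : k' = k
    · subst hk'
      simpa [Conf.pair] using hk
    · simpa [Conf.pair, hk'] using h k' hk'
  rw [Exec, this]
  exact Prog.runs_push k f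

theorem exec_pop (k : Port ⊕ WorkStack P)
    (f : Reg P → Option (Alphabet (WorkStack P) Cell k) → Reg P)
    (c c' : Conf P) (hr : c'.reg = f c.reg (c.stk k).head?) (hk : c'.stk k = (c.stk k).tail)
    (h : ∀ k' ≠ k, c'.stk k' = c.stk k') : Exec (.pop k f) c 0 c' := by
  have : c'.pair = (f c.reg (c.stk k).head?, Function.update c.stk k (c.stk k).tail) := by
    refine Prod.ext hr ?_
    funext k'
    by_cases hk' : k' = k
    · subst hk'
      simpa [Conf.pair] using hk
    · simpa [Conf.pair, hk'] using h k' hk'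
  rw [Exec, this]
  exact Prog.runs_pop k f

theorem exec_load (f : Reg P → Reg P) (c c' : Conf P) (hr : c'.reg = f c.reg)
    (h : c'.stk = c.stk) : Exec (.load f) c 0 c' := by
  have : c'.pair = (f c.reg, c.stk) := Prod.ext hr h
  rw [Exec, this]
  exact Prog.runs_load f

/-- Pop from a port. -/
def popPort (k : Port) : RProg P := .pop (.inl k) fun v (x : Option Bool) => { v with last := x }

/-- Pop from a work stack. -/
def popWork (k : WorkStack P) : RProg P :=
  .pop (.inr k) fun v (x : Option Cell) => { v with cell := x }

/-- Push to a port. -/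
def pushPort (k : Port) (f : Reg P → Bool) : RProg P := .push (.inl k) f

/-- Push to a work stack. -/
def pushWork (k : WorkStack P) (f : Reg P → Cell) : RProg P := .push (.inr k) f

variable {c : Conf P}

theorem exec_popInput_cons {b : Bool} {l : List Bool} (h : c.input = b :: l) :
    Exec (popPort .input) c 0 { c with last := some b, input := l } := by
  refine exec_pop _ _ _ _ (by simp [Conf.reg, Conf.stk, h]) (by simp [Conf.stk, h]) ?_
  rintro (_ | _) hk <;> rename_i k <;> cases k <;> first | rfl | exact absurd rfl hk

theorem exec_popInput_nil (h : c.input = []) :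
    Exec (popPort .input) c 0 { c with last := none } := by
  refine exec_pop _ _ _ _ (by simp [Conf.reg, Conf.stk, h]) (by simp [Conf.stk, h]) ?_
  rintro (_ | _) hk <;> rename_i k <;> cases k <;> rfl

theorem exec_popError_cons {b : Bool} {l : List Bool} (h : c.error = b :: l) :
    Exec (popPort .error) c 0 { c with last := some b, error := l } := by
  refine exec_pop _ _ _ _ (by simp [Conf.reg, Conf.stk, h]) (by simp [Conf.stk, h]) ?_
  rintro (_ | _) hk <;> rename_i k <;> cases k <;> first | rfl | exact absurd rfl hk

theorem exec_popError_nil (h : c.error = []) :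
    Exec (popPort .error) c 0 { c with last := none } := by
  refine exec_pop _ _ _ _ (by simp [Conf.reg, Conf.stk, h]) (by simp [Conf.stk, h]) ?_
  rintro (_ | _) hk <;> rename_i k <;> cases k <;> rfl

theorem exec_popAnswer :
    Exec (popPort .answer) c 0 { c with last := c.answer.head?, answer := c.answer.tail } := by
  refine exec_pop _ _ _ _ rfl rfl ?_
  rintro (_ | _) hk <;> rename_i k <;> cases k <;> first | rfl | exact absurd rfl hk

theorem exec_popArr_cons {x : Cell} {l : List Cell} (h : c.arr = x :: l) :
    Exec (popWork .arr) c 0 { c with cell := some x, arr := l } := by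
  refine exec_pop _ _ _ _ (by simp [Conf.reg, Conf.stk, h]) (by simp [Conf.stk, h]) ?_
  rintro (_ | _) hk <;> rename_i k <;> cases k <;> first | rfl | exact absurd rfl hk

theorem exec_popArr_nil (h : c.arr = []) :
    Exec (popWork .arr) c 0 { c with cell := none } := by
  refine exec_pop _ _ _ _ (by simp [Conf.reg, Conf.stk, h]) (by simp [Conf.stk, h]) ?_
  rintro (_ | _) hk <;> rename_i k <;> cases k <;> rfl

theorem exec_popTmp_cons {x : Cell} {l : List Cell} (h : c.tmp = x :: l) :
    Exec (popWork .tmp) c 0 { c with cell := some x, tmp := l } := by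
  refine exec_pop _ _ _ _ (by simp [Conf.reg, Conf.stk, h]) (by simp [Conf.stk, h]) ?_
  rintro (_ | _) hk <;> rename_i k <;> cases k <;> first | rfl | exact absurd rfl hk

theorem exec_popTmp_nil (h : c.tmp = []) :
    Exec (popWork .tmp) c 0 { c with cell := none } := by
  refine exec_pop _ _ _ _ (by simp [Conf.reg, Conf.stk, h]) (by simp [Conf.stk, h]) ?_
  rintro (_ | _) hk <;> rename_i k <;> cases k <;> rfl

theorem exec_popCopy_cons {x : Cell} {l : List Cell} (h : c.copy = x :: l) :
    Exec (popWork .copy) c 0 { c with cell := some x, copy := l } := by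
  refine exec_pop _ _ _ _ (by simp [Conf.reg, Conf.stk, h]) (by simp [Conf.stk, h]) ?_
  rintro (_ | _) hk <;> rename_i k <;> cases k <;> first | rfl | exact absurd rfl hk

theorem exec_popCopy_nil (h : c.copy = []) :
    Exec (popWork .copy) c 0 { c with cell := none } := by
  refine exec_pop _ _ _ _ (by simp [Conf.reg, Conf.stk, h]) (by simp [Conf.stk, h]) ?_
  rintro (_ | _) hk <;> rename_i k <;> cases k <;> rfl

theorem exec_popArg_cons {p : P} {x : Cell} {l : List Cell} (h : c.arg p = x :: l) :
    Exec (popWork (.arg p)) c 0 { c with cell := some x, arg := Function.update c.arg p l } := by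
  refine exec_pop _ _ _ _ (by simp [Conf.reg, Conf.stk, h]) (by simp [Conf.stk, h]) ?_
  rintro (_ | _) hk <;> rename_i k <;> cases k <;> try rfl
  rename_i p'
  have : p' ≠ p := fun h' => hk (by rw [h'])
  simp [Conf.stk, this]

theorem exec_popArg_nil {p : P} (h : c.arg p = []) :
    Exec (popWork (.arg p)) c 0 { c with cell := none } := by
  refine exec_pop _ _ _ _ (by simp [Conf.reg, Conf.stk, h]) (by simp [Conf.stk, h]) ?_
  rintro (_ | _) hk <;> rename_i k <;> cases k <;> rfl

theorem exec_pushInput (f : Reg P → Bool) :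
    Exec (pushPort .input f) c 0 { c with input := f c.reg :: c.input } := by
  refine exec_push _ _ _ _ rfl rfl ?_
  rintro (_ | _) hk <;> rename_i k <;> cases k <;> first | rfl | exact absurd rfl hk

theorem exec_pushQuery (f : Reg P → Bool) :
    Exec (pushPort .query f) c 0 { c with query := f c.reg :: c.query } := by
  refine exec_push _ _ _ _ rfl rfl ?_
  rintro (_ | _) hk <;> rename_i k <;> cases k <;> first | rfl | exact absurd rfl hk

theorem exec_pushQueryError (f : Reg P → Bool) :
    Exec (pushPort .queryError f) c 0 { c with queryError := f c.reg :: c.queryError } := by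
  refine exec_push _ _ _ _ rfl rfl ?_
  rintro (_ | _) hk <;> rename_i k <;> cases k <;> first | rfl | exact absurd rfl hk

theorem exec_pushOutput (f : Reg P → Bool) :
    Exec (pushPort .output f) c 0 { c with output := f c.reg :: c.output } := by
  refine exec_push _ _ _ _ rfl rfl ?_
  rintro (_ | _) hk <;> rename_i k <;> cases k <;> first | rfl | exact absurd rfl hk

theorem exec_pushArr (f : Reg P → Cell) :
    Exec (pushWork .arr f) c 0 { c with arr := f c.reg :: c.arr } := by
  refine exec_push _ _ _ _ rfl rfl ?_
  rintro (_ | _) hk <;> rename_i k <;> cases k <;> first | rfl | exact absurd rfl hk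

theorem exec_pushTmp (f : Reg P → Cell) :
    Exec (pushWork .tmp f) c 0 { c with tmp := f c.reg :: c.tmp } := by
  refine exec_push _ _ _ _ rfl rfl ?_
  rintro (_ | _) hk <;> rename_i k <;> cases k <;> first | rfl | exact absurd rfl hk

theorem exec_pushCopy (f : Reg P → Cell) :
    Exec (pushWork .copy f) c 0 { c with copy := f c.reg :: c.copy } := by
  refine exec_push _ _ _ _ rfl rfl ?_
  rintro (_ | _) hk <;> rename_i k <;> cases k <;> first | rfl | exact absurd rfl hk

theorem exec_pushArg (p : P) (f : Reg P → Cell) :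
    Exec (pushWork (.arg p) f) c 0
      { c with arg := Function.update c.arg p (f c.reg :: c.arg p) } := by
  refine exec_push _ _ _ _ rfl (by simp [Conf.stk]) ?_
  rintro (_ | _) hk <;> rename_i k <;> cases k <;> try rfl
  rename_i p'
  have : p' ≠ p := fun h' => hk (by rw [h'])
  simp [Conf.stk, this]

/-! ## Subroutines -/

theorem exec_drain {α : Type} {p q : RProg P} {b : Reg P → Bool} (B : ℕ) (l₀ : List α)
    (S : List α → List α → Conf P) (T : List α → α → List α → Conf P) (e : Conf P)
    (hc : c = S [] l₀)
    (hp : ∀ l x l', l₀ = l.reverse ++ x :: l' → Exec p (S l (x :: l')) 0 (T l x l'))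
    (hb : ∀ l x l', l₀ = l.reverse ++ x :: l' → b (T l x l').reg = true)
    (hq : ∀ l x l', l₀ = l.reverse ++ x :: l' → Exec q (T l x l') B (S (x :: l) l'))
    (hpe : Exec p (S l₀.reverse []) 0 e) (hbe : b e.reg = false) :
    Exec (.drain p b q) c (l₀.length * (B + 1) + 1) e := by
  subst hc
  exact Prog.runs_drain B l₀ (fun l l' => (S l l').pair) (fun l x l' => (T l x l').pair) e.pair
    hp hb hq hpe hbe

/-- The loop condition that the last pop from a port was successful. -/
def gotBit (v : Reg P) : Bool := v.last.isSome

/-- The loop condition that the last pop from a port gave `true`. -/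
def gotTrue (v : Reg P) : Bool := v.last.getD false

/-- The loop condition that the last pop from a work stack was successful. -/
def gotCell (v : Reg P) : Bool := v.cell.isSome

/-- The cell popped last. -/
def lastCell (v : Reg P) : Cell := v.cell.getD (Cell.const false)

/-- Push a string to the query stack. -/
def pushString (s : List Bool) : RProg P := .forEachRev (fun b => pushPort .query fun _ => b) s

theorem exec_pushString (s : List Bool) (c : Conf P) :
    Exec (pushString s) c 0 { c with query := s ++ c.query } :=
  (exec_forEachRev (fun b => (pushPort .query fun _ => b : RProg P)) 0
    (fun l => { c with query := l ++ c.query }) s fun x _ l => exec_pushQuery _).mono (by simp)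

/-- Read a unary number from the input, and push as many empty cells to the array. -/
def readCount : RProg P :=
  .drain (popPort .input) gotTrue (pushWork .arr fun _ => Cell.const false)

theorem exec_readCount (n : ℕ) (s : List Bool) (c : Conf P)
    (h : c.input = List.replicate n true ++ false :: s) :
    Exec readCount c (n + 1)
      { c with
        last := some false
        input := s
        arr := List.replicate n (Cell.const false) ++ c.arr } := by
  -- Processed items come latest first, so `l.head?` reflects the letter popped last; before the
  -- first round the register still has its old content, which explains the `or c.last`. The same
  -- pattern recurs in the loops below.
  have := exec_drain (c := c) (p := popPort .input) (b := gotTrue)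
    (q := pushWork .arr fun _ => Cell.const false) 0 (List.replicate n ())
    (fun l l' =>
      { c with
        last := (l.head?.map fun _ => true).or c.last
        input := l'.map (fun _ => true) ++ false :: s
        arr := l.map (fun _ => Cell.const false) ++ c.arr })
    (fun l x l' =>
      { c with
        last := some true
        input := l'.map (fun _ => true) ++ false :: s
        arr := l.map (fun _ => Cell.const false) ++ c.arr })
    { c with
        last := some false
        input := s
        arr := List.replicate n (Cell.const false) ++ c.arr }
    (by simp [← h])
    (fun l x l' _ => exec_popInput_cons rfl) (fun _ _ _ _ => rfl)
    (fun l x l' _ => exec_pushArr _)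
    ((exec_popInput_cons rfl).congr (by simp)) rfl
  exact this.mono (by simp)

/-- Pop a bit from the input and remember it on the copy stack. -/
def readBit : RProg P :=
  .seq (popPort .input) (.ite gotBit (pushWork .copy fun v => Cell.const (gotTrue v)) .skip)

theorem exec_readBit_cons {b : Bool} {l : List Bool} (h : c.input = b :: l) :
    Exec readBit c 0 { c with last := some b, input := l, copy := Cell.const b :: c.copy } :=
  (exec_popInput_cons h).seq' (exec_ite_true rfl (exec_pushCopy _))

theorem exec_readBit_nil (h : c.input = []) : Exec readBit c 0 { c with last := none } :=
  (exec_popInput_nil h).seq' (exec_ite_false rfl exec_skip)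

/-- Read a unary number from the input to the stack of the argument position `p`. -/
def readArg (p : P) : RProg P :=
  .drain readBit gotTrue (pushWork (.arg p) fun _ => Cell.const false)

theorem exec_readArg (p : P) (n : ℕ) (s : List Bool) (c : Conf P)
    (h : c.input = List.replicate n true ++ false :: s) :
    Exec (readArg p) c (n + 1)
      { c with
        last := some false
        input := s
        copy := ((List.replicate n true ++ [false]).map Cell.const).reverse ++ c.copy
        arg := Function.update c.arg p (List.replicate n (Cell.const false) ++ c.arg p) } := by
  have := exec_drain (c := c) (p := readBit) (b := gotTrue)
    (q := pushWork (.arg p) fun _ => Cell.const false) 0 (List.replicate n ())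
    (fun l l' =>
      { c with
        last := (l.head?.map fun _ => true).or c.last
        input := l'.map (fun _ => true) ++ false :: s
        copy := l.map (fun _ => Cell.const true) ++ c.copy
        arg := Function.update c.arg p (l.map (fun _ => Cell.const false) ++ c.arg p) })
    (fun l x l' =>
      { c with
        last := some true
        input := l'.map (fun _ => true) ++ false :: s
        copy := Cell.const true :: l.map (fun _ => Cell.const true) ++ c.copy
        arg := Function.update c.arg p (l.map (fun _ => Cell.const false) ++ c.arg p) })
    { c with
        last := some false
        input := s
        copy := ((List.replicate n true ++ [false]).map Cell.const).reverse ++ c.copy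
        arg := Function.update c.arg p (List.replicate n (Cell.const false) ++ c.arg p) }
    (by simp [← h])
    (fun l x l' _ => exec_readBit_cons rfl) (fun _ _ _ _ => rfl)
    (fun l x l' _ => (exec_pushArg _ _).congr (by simp))
    ((exec_readBit_cons rfl).congr (by simp)) rfl
  exact this.mono (by simp)

/-- Empty the stack of the argument position `p`. -/
def clearArg (p : P) : RProg P := .drain (popWork (.arg p)) gotCell .skip

theorem exec_clearArg (p : P) (c : Conf P) :
    Exec (clearArg p) c ((c.arg p).length + 1)
      { c with cell := none, arg := Function.update c.arg p [] } := by
  have := exec_drain (c := c) (p := popWork (.arg p)) (b := gotCell)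
    (q := .skip) 0 (c.arg p)
    (fun l l' => { c with cell := l.head?.or c.cell, arg := Function.update c.arg p l' })
    (fun l x l' => { c with cell := some x, arg := Function.update c.arg p l' })
    { c with cell := none, arg := Function.update c.arg p [] }
    (by simp)
    (fun l x l' _ => (exec_popArg_cons (x := x) (l := l') (by simp)).congr (by simp))
    (fun _ _ _ _ => rfl)
    (fun l x l' _ => exec_skip)
    (exec_popArg_nil (by simp)) rfl
  exact this.mono (by simp)

/-- Move the bits on the copy stack back to the input. -/
def restore : RProg P :=
  .drain (popWork .copy) gotCell (pushPort .input fun v => lastCell v true)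

theorem exec_restore (s : List Bool) (c : Conf P) (h : c.copy = s.map Cell.const) :
    Exec restore c (s.length + 1)
      { c with cell := none, input := s.reverse ++ c.input, copy := [] } := by
  have := exec_drain (c := c) (p := popWork .copy) (b := gotCell)
    (q := pushPort .input fun v => lastCell v true) 0 s
    (fun l l' => { c with
      cell := (l.head?.map Cell.const).or c.cell
      input := l ++ c.input
      copy := l'.map Cell.const })
    (fun l x l' => { c with
      cell := some (Cell.const x)
      input := l ++ c.input
      copy := l'.map Cell.const })
    { c with cell := none, input := s.reverse ++ c.input, copy := [] }
    (by simp [← h])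
    (fun l x l' _ => exec_popCopy_cons rfl)
    (fun _ _ _ _ => rfl)
    (fun l x l' _ => exec_pushInput _)
    (exec_popCopy_nil rfl) rfl
  exact this.mono (by simp)

/-- Move the bits on the copy stack to the output. -/
def copyToOutput : RProg P :=
  .drain (popWork .copy) gotCell (pushPort .output fun v => lastCell v true)

theorem exec_copyToOutput (s : List Bool) (c : Conf P) (h : c.copy = s.map Cell.const) :
    Exec copyToOutput c (s.length + 1)
      { c with cell := none, output := s.reverse ++ c.output, copy := [] } := by
  have := exec_drain (c := c) (p := popWork .copy) (b := gotCell)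
    (q := pushPort .output fun v => lastCell v true) 0 s
    (fun l l' => { c with
      cell := (l.head?.map Cell.const).or c.cell
      output := l ++ c.output
      copy := l'.map Cell.const })
    (fun l x l' => { c with
      cell := some (Cell.const x)
      output := l ++ c.output
      copy := l'.map Cell.const })
    { c with cell := none, output := s.reverse ++ c.output, copy := [] }
    (by simp [← h])
    (fun l x l' _ => exec_popCopy_cons rfl)
    (fun _ _ _ _ => rfl)
    (fun l x l' _ => exec_pushOutput _)
    (exec_popCopy_nil rfl) rfl
  exact this.mono (by simp)

/-- Move the error parameter to the next oracle call. -/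
def passError : RProg P :=
  .drain (popPort .error) gotBit (pushPort .queryError fun _ => true)

theorem exec_passError (c : Conf P) :
    Exec passError c (c.error.length + 1)
      { c with
        last := none
        error := []
        queryError := List.replicate c.error.length true ++ c.queryError } := by
  have := exec_drain (c := c) (p := popPort .error) (b := gotBit)
    (q := pushPort .queryError fun _ => true) 0 c.error
    (fun l l' => { c with
      last := l.head?.or c.last
      error := l'
      queryError := l.map (fun _ => true) ++ c.queryError })
    (fun l x l' => { c with
      last := some x
      error := l'
      queryError := l.map (fun _ => true) ++ c.queryError })
    { c with
        last := none
        error := []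
        queryError := List.replicate c.error.length true ++ c.queryError }
    (by simp)
    (fun l x l' _ => exec_popError_cons rfl)
    (fun _ _ _ _ => rfl)
    (fun l x l' _ => exec_pushQueryError _)
    ((exec_popError_nil rfl).congr (by simp)) rfl
  exact this.mono (by simp)

/-- Move cells from the array to the auxiliary stack, as many as the argument at position `p`
says. -/
def seek (p : P) : RProg P :=
  .drain (popWork (.arg p)) gotCell (.seq (popWork .arr) (pushWork .tmp lastCell))

theorem exec_seek (p : P) (l₁ l₂ : List Cell) (c : Conf P)
    (ha : c.arg p = List.replicate l₁.length (Cell.const false)) (h : c.arr = l₁ ++ l₂) :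
    Exec (seek p) c (l₁.length + 1)
      { c with
        cell := none
        arr := l₂
        tmp := l₁.reverse ++ c.tmp
        arg := Function.update c.arg p [] } := by
  have := exec_drain (c := c) (p := popWork (.arg p)) (b := gotCell)
    (q := .seq (popWork .arr) (pushWork .tmp lastCell)) 0 l₁
    (fun l l' => { c with
      cell := l.head?.or c.cell
      arr := l' ++ l₂
      tmp := l ++ c.tmp
      arg := Function.update c.arg p (l'.map fun _ => Cell.const false) })
    (fun l x l' => { c with
      cell := some (Cell.const false)
      arr := x :: l' ++ l₂
      tmp := l ++ c.tmp
      arg := Function.update c.arg p (l'.map fun _ => Cell.const false) })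
    { c with
        cell := none
        arr := l₂
        tmp := l₁.reverse ++ c.tmp
        arg := Function.update c.arg p [] }
    (by simp [← h, ← ha])
    (fun l x l' _ => (exec_popArg_cons (x := Cell.const false)
      (l := l'.map fun _ => Cell.const false) (by simp)).congr (by simp))
    (fun _ _ _ _ => rfl)
    (fun l x l' _ => (exec_popArr_cons rfl).seq' (exec_pushTmp _))
    ((exec_popArg_nil (by simp)).congr (by simp)) rfl
  exact this.mono (by simp)

/-- Move all cells from the auxiliary stack to the array, and their number to the stack of the
argument position `p`. -/
def unseek (p : P) : RProg P :=
  .drain (popWork .tmp) gotCell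
    (.seq (pushWork .arr lastCell) (pushWork (.arg p) fun _ => Cell.const false))

theorem exec_unseek (p : P) (c : Conf P) :
    Exec (unseek p) c (c.tmp.length + 1)
      { c with
        cell := none
        arr := c.tmp.reverse ++ c.arr
        tmp := []
        arg := Function.update c.arg p
          (List.replicate c.tmp.length (Cell.const false) ++ c.arg p) } := by
  have := exec_drain (c := c) (p := popWork .tmp) (b := gotCell)
    (q := .seq (pushWork .arr lastCell) (pushWork (.arg p) fun _ => Cell.const false)) 0 c.tmp
    (fun l l' => { c with
      cell := l.head?.or c.cell
      arr := l ++ c.arr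
      tmp := l'
      arg := Function.update c.arg p ((l.map fun _ => Cell.const false) ++ c.arg p) })
    (fun l x l' => { c with
      cell := some x
      arr := l ++ c.arr
      tmp := l'
      arg := Function.update c.arg p ((l.map fun _ => Cell.const false) ++ c.arg p) })
    { c with
        cell := none
        arr := c.tmp.reverse ++ c.arr
        tmp := []
        arg := Function.update c.arg p
          (List.replicate c.tmp.length (Cell.const false) ++ c.arg p) }
    (by simp)
    (fun l x l' _ => exec_popTmp_cons rfl)
    (fun _ _ _ _ => rfl)
    (fun l x l' _ => ((exec_pushArr _).seq' (exec_pushArg _ _)).congr (by simp; rfl))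
    ((exec_popTmp_nil rfl).congr (by simp)) rfl
  exact this.mono (by simp)

/-- Execute `q` while the array cell that the argument at position `p` points to is on top of the
array, and also popped. -/
def access (p : P) (q : RProg P) : RProg P :=
  .seq (.seq (seek p) (popWork .arr)) (.seq q (unseek p))

/-- Apply `f` to the array cell that the argument at position `p` points to. -/
def modifyCell (p : P) (f : Cell → Cell) : RProg P :=
  access p (pushWork .arr fun v => f (lastCell v))

/-- Seeking uses up the argument as a counter, but leaves exactly that many cells on the auxiliary
stack. Moving these back restores both the array and the argument, provided that the auxiliary stack
was empty. Each direction takes n + 1 steps. -/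
theorem exec_modifyCell (p : P) (f : Cell → Cell) (n : ℕ) (c : Conf P)
    (ha : c.arg p = List.replicate n (Cell.const false)) (hn : n < c.arr.length)
    (ht : c.tmp = []) :
    Exec (modifyCell p f) c (2 * (n + 1)) { c with cell := none, arr := c.arr.modify n f } := by
  have h1 : (c.arr.take n).length = n := by simp; omega
  have h2 : c.arr = c.arr.take n ++ c.arr[n] :: c.arr.drop (n + 1) := by simp
  have := ((exec_seek p _ _ c (by rw [h1]; exact ha) h2).seq (exec_popArr_cons rfl)).seq
    ((exec_pushArr fun v => f (lastCell v)).seq (exec_unseek p _))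
  refine (this.congr ?_).mono ?_
  · simp only [ht, h1, List.append_nil, List.reverse_reverse, List.length_reverse,
      Function.update_self, Function.update_idem, ← ha, Function.update_eq_self,
      List.modify_eq_take_cons_drop hn]
    rfl
  · simp [ht]; omega

/-- Record the cell popped last in the internal state. -/
def recordCell (p : P) : RProg P :=
  .load fun v => { v with stat := Function.update v.stat p (lastCell v) }

theorem exec_recordCell (p : P) : Exec (recordCell p) c 0
    { c with stat := Function.update c.stat p (lastCell c.reg) } :=
  exec_load _ _ _ rfl rfl

/-- Record the array cell that the argument at position `p` points to in the internal state. -/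
def lookup (p : P) : RProg P :=
  access p (.seq (recordCell p) (pushWork .arr lastCell))

theorem exec_lookup (p : P) (n : ℕ) (c : Conf P)
    (ha : c.arg p = List.replicate n (Cell.const false)) (hn : n < c.arr.length)
    (ht : c.tmp = []) :
    Exec (lookup p) c (2 * (n + 1))
      { c with cell := none, stat := Function.update c.stat p c.arr[n] } := by
  have h1 : (c.arr.take n).length = n := by simp; omega
  have h2 : c.arr = c.arr.take n ++ c.arr[n] :: c.arr.drop (n + 1) := by simp
  have := ((exec_seek p _ _ c (by rw [h1]; exact ha) h2).seq (exec_popArr_cons rfl)).seq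
    (((exec_recordCell p).seq (exec_pushArr lastCell)).seq (exec_unseek p _))
  refine (this.congr ?_).mono ?_
  · simp only [ht, h1, List.append_nil, List.reverse_reverse, List.length_reverse,
      Function.update_self, Function.update_idem, ← ha, Function.update_eq_self]
    simp [lastCell, Conf.reg]
  · simp [ht]; omega

theorem replicate_append_replicate_append {α : Type} (m n : ℕ) (x : α) (l : List α) :
    List.replicate m x ++ (List.replicate n x ++ l) = List.replicate (n + m) x ++ l := by
  rw [← List.append_assoc, List.replicate_append_replicate, Nat.add_comm]

/-- Push the argument at position `p`, increased by `w`, to the query stack, in unary. -/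
def emitArg (w : ℕ) (p : P) : RProg P :=
  .seq (pushPort .query fun _ => false)
    (.seq (.drain (popWork (.arg p)) gotCell
        (.seq (pushWork .tmp lastCell) (pushPort .query fun _ => true)))
      (.seq (.drain (popWork .tmp) gotCell (pushWork (.arg p) lastCell))
        (pushString (List.replicate w true))))

/-- Text is pushed from its end, so the separator goes first. The argument is emptied onto the
auxiliary stack and then moved back, which costs n + 1 steps each way; the shift by `w` is a
constant string and is free. -/
theorem exec_emitArg (w : ℕ) (p : P) (n : ℕ) (c : Conf P)
    (ha : c.arg p = List.replicate n (Cell.const false)) (ht : c.tmp = []) :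
    Exec (emitArg w p) c (2 * (n + 1))
      { c with cell := none, query := unary [n + w] ++ c.query } := by
  have h1 := exec_drain (c := { c with query := false :: c.query }) (p := popWork (.arg p))
    (b := gotCell)
    (q := .seq (pushWork .tmp lastCell) (pushPort .query fun _ => true)) 0 (c.arg p)
    (fun l l' => { c with
      cell := l.head?.or c.cell
      query := l.map (fun _ => true) ++ false :: c.query
      tmp := l
      arg := Function.update c.arg p l' })
    (fun l x l' => { c with
      cell := some x
      query := l.map (fun _ => true) ++ false :: c.query
      tmp := l
      arg := Function.update c.arg p l' })
    { c with
      cell := none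
      query := (c.arg p).reverse.map (fun _ => true) ++ false :: c.query
      tmp := (c.arg p).reverse
      arg := Function.update c.arg p [] }
    (by simp [ht])
    (fun l x l' _ => (exec_popArg_cons (x := x) (l := l') (by simp)).congr (by simp))
    (fun _ _ _ _ => rfl)
    (fun l x l' _ => (exec_pushTmp _).seq' (exec_pushQuery _))
    (exec_popArg_nil (by simp)) rfl
  have h2 := exec_drain (c := { c with
      cell := none
      query := (c.arg p).reverse.map (fun _ => true) ++ false :: c.query
      tmp := (c.arg p).reverse
      arg := Function.update c.arg p [] }) (p := popWork .tmp)
    (b := gotCell) (q := pushWork (.arg p) lastCell) 0 (c.arg p).reverse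
    (fun l l' => { c with
      cell := l.head?
      query := (c.arg p).reverse.map (fun _ => true) ++ false :: c.query
      tmp := l'
      arg := Function.update c.arg p l })
    (fun l x l' => { c with
      cell := some x
      query := (c.arg p).reverse.map (fun _ => true) ++ false :: c.query
      tmp := l'
      arg := Function.update c.arg p l })
    { c with
      cell := none
      query := (c.arg p).reverse.map (fun _ => true) ++ false :: c.query
      tmp := []
      arg := Function.update c.arg p (c.arg p) }
    (by simp)
    (fun l x l' _ => exec_popTmp_cons rfl)
    (fun _ _ _ _ => rfl)
    (fun l x l' _ => (exec_pushArg _ _).congr (by simp; rfl))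
    ((exec_popTmp_nil rfl).congr (by simp)) rfl
  have := (exec_pushQuery fun _ => false).seq (h1.seq (h2.seq (exec_pushString
    (List.replicate w true) _)))
  refine (this.congr ?_).mono ?_
  · simp [ha, unary, ← ht, replicate_append_replicate_append]
  · simp [ha]; omega

/-- Count the array cells that satisfy `f`, add `w`, and push the result to the query stack, in
unary. The array is moved to the auxiliary stack. -/
def emitCount (w : ℕ) (f : Cell → Bool) : RProg P :=
  .seq (pushString (List.replicate w true ++ [false]))
    (.drain (popWork .arr) gotCell
      (.seq (.ite (fun v => f (lastCell v)) (pushPort .query fun _ => true) .skip)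
        (pushWork .tmp lastCell)))

theorem exec_emitCount (w : ℕ) (f : Cell → Bool) (c : Conf P) :
    Exec (emitCount w f) c (c.arr.length + 1)
      { c with
        cell := none
        query := unary [c.arr.countP f + w] ++ c.query
        arr := []
        tmp := c.arr.reverse ++ c.tmp } := by
  have h1 := exec_drain (c := { c with query := (List.replicate w true ++ [false]) ++ c.query })
    (p := popWork .arr) (b := gotCell)
    (q := .seq (.ite (fun v => f (lastCell v)) (pushPort .query fun _ => true) .skip)
        (pushWork .tmp lastCell)) 0 c.arr
    (fun l l' => { c with
      cell := l.head?.or c.cell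
      query := List.replicate (l.countP f) true ++ (List.replicate w true ++ [false]) ++ c.query
      arr := l'
      tmp := l ++ c.tmp })
    (fun l x l' => { c with
      cell := some x
      query := List.replicate (l.countP f) true ++ (List.replicate w true ++ [false]) ++ c.query
      arr := l'
      tmp := l ++ c.tmp })
    { c with
      cell := none
      query := unary [c.arr.countP f + w] ++ c.query
      arr := []
      tmp := c.arr.reverse ++ c.tmp }
    (by simp)
    (fun l x l' _ => exec_popArr_cons rfl)
    (fun _ _ _ _ => rfl)
    (fun l x l' _ => by
      by_cases hx : f x = true
      · exact ((exec_ite_true (by simpa [lastCell, Conf.reg] using hx)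
          (exec_pushQuery fun _ => true)).seq' (exec_pushTmp _)).congr
          (by simp [hx, List.replicate_succ, lastCell, Conf.reg])
      · exact ((exec_ite_false (by simpa [lastCell, Conf.reg] using hx)
          exec_skip).seq' (exec_pushTmp _)).congr
          (by simp [hx, lastCell, Conf.reg]))
    ((exec_popArr_nil rfl).congr (by simp [unary, replicate_append_replicate_append, Nat.add_comm])) rfl
  exact ((exec_pushString _ _).seq h1).mono (by simp)

/-- Move bits from the answer to the copy stack, at most as many as there are cells on the
auxiliary stack. -/
def takeAnswer : RProg P :=
  .drain (popWork .tmp) gotCell (.seq (popPort .answer)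
    (.ite gotBit (pushWork .copy fun v => Cell.const (gotTrue v)) .skip))

/-- The auxiliary stack serves as a clock: the running time depends on its height and not on the
answer, which an arbitrary oracle may make as long as it likes. -/
theorem exec_takeAnswer (c : Conf P) (h : c.copy = []) :
    Exec takeAnswer c (c.tmp.length + 1)
      { c with
        last := if c.tmp = [] then c.last else c.answer[c.tmp.length - 1]?
        cell := none
        answer := c.answer.drop c.tmp.length
        tmp := []
        copy := ((c.answer.take c.tmp.length).map Cell.const).reverse } := by
  have h1 := exec_drain (c := c) (p := popWork .tmp) (b := gotCell)
    (q := .seq (popPort .answer)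
      (.ite gotBit (pushWork .copy fun v => Cell.const (gotTrue v)) .skip)) 0 c.tmp
    (fun l l' => { c with
      last := if l = [] then c.last else c.answer[l.length - 1]?
      cell := l.head?.or c.cell
      answer := c.answer.drop l.length
      tmp := l'
      copy := ((c.answer.take l.length).map Cell.const).reverse })
    (fun l x l' => { c with
      last := if l = [] then c.last else c.answer[l.length - 1]?
      cell := some x
      answer := c.answer.drop l.length
      tmp := l'
      copy := ((c.answer.take l.length).map Cell.const).reverse })
    { c with
      last := if c.tmp = [] then c.last else c.answer[c.tmp.length - 1]?
      cell := none
      answer := c.answer.drop c.tmp.length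
      tmp := []
      copy := ((c.answer.take c.tmp.length).map Cell.const).reverse }
    (by obtain ⟨⟩ := c; simp at h; simp [h])
    (fun l x l' _ => exec_popTmp_cons rfl)
    (fun _ _ _ _ => rfl)
    (fun l x l' _ => by
      refine Exec.seq' exec_popAnswer ?_
      -- If the answer is exhausted, the remaining rounds pop nothing and the copied prefix is
      -- already the whole answer.
      cases hl : c.answer[l.length]? with
      | none =>
        refine Exec.congr (exec_ite_false ?_ exec_skip) ?_
        · simpa [gotBit, Conf.reg] using hl
        · rw [List.getElem?_eq_none_iff] at hl
          simp [List.take_of_length_le hl,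
            List.take_of_length_le (show c.answer.length ≤ l.length + 1 by omega)]
      | some b =>
        refine Exec.congr (exec_ite_true ?_ (exec_pushCopy _)) ?_
        · simp [gotBit, Conf.reg, hl]
        · simp [Conf.reg, gotTrue, hl, List.take_add_one])
    ((exec_popTmp_nil rfl).congr (by simp)) rfl
  exact h1.mono (by simp)

end

/-! ## Parsing CSP instances -/

section

/-- The positions in the scopes of the relations of a language. -/
abbrev Pos (Γ : ConstraintLanguage) : Type := Σ i : Fin Γ.length, Fin (Γ.get i).arity

/-- The part of the memory that is changed while a constraint is processed. -/
structure Core (P : Type) where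
  stat : P → Cell
  fail : Bool
  query : List Bool
  arr : List Cell

/-- Replace the part of the memory that is changed while a constraint is processed. -/
def Conf.withCore {P : Type} (c : Conf P) (k : Core P) : Conf P :=
  { c with stat := k.stat, fail := k.fail, query := k.query, arr := k.arr }

variable {P : Type} [DecidableEq P]

/-- Select a program by the unary number on top of the input, when its first bit has been read. -/
def dispatch : List (RProg P) → RProg P
  | [] => .skip
  | p :: l => .ite gotTrue (.seq readBit (dispatch l)) p

/-- The first bit of the name has already been read because the same read also tests for the end of
the input. Every further bit moves one place along the list of programs. No loop is involved, hence
no cost beyond that of the selected program. -/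
theorem exec_dispatch (l : List (RProg P)) (i : ℕ) (hi : i < l.length) (s : List Bool) (B : ℕ)
    (c c' : Conf P)
    (h : Exec l[i] { c with
      last := some false
      input := s
      copy := ((List.replicate i true ++ [false]).map Cell.const).reverse ++ c.copy } B c') :
    Exec (dispatch l) { c with
      last := (List.replicate i true ++ false :: s).head?
      input := (List.replicate i true ++ false :: s).tail
      copy := Cell.const ((List.replicate i true ++ false :: s).headD false) :: c.copy } B c' := by
  induction l generalizing i c with
  | nil => simp at hi
  | cons p l ih =>
    cases i with
    | zero => exact exec_ite_false rfl (h.congr rfl)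
    | succ i =>
      refine exec_ite_true rfl (Exec.seq' ?_ (ih i (by simpa using hi)
        { c with copy := Cell.const true :: c.copy } ?_))
      · cases i with
        | zero => exact exec_readBit_cons rfl
        | succ i => exact exec_readBit_cons rfl
      · refine Exec.congr_left h ?_
        congr 1
        rw [List.replicate_succ, List.cons_append, List.map_cons, List.reverse_cons]
        simp

/-- Reverse induction looks at the last write: either it is at `e j`, and then injectivity gives the
value, or it leaves that place alone. -/
theorem foldl_update_of_mem {α β γ : Type} [DecidableEq β] (e : α → β)
    (he : Function.Injective e) (g : α → γ) (l : List α) (a : β → γ) (j : α) (hj : j ∈ l) :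
    l.foldl (fun a j => Function.update a (e j) (g j)) a (e j) = g j := by
  induction l using List.reverseRecOn with
  | nil => simp at hj
  | append_singleton l x ih =>
    rw [List.foldl_append]
    by_cases hx : e j = e x
    · simp [he hx]
    · have : j ∈ l := by
        rcases List.mem_append.1 hj with h | h
        · exact h
        · exact absurd (by rw [List.mem_singleton.1 h]) hx
      simp [Function.update_of_ne hx, ih this]

theorem foldl_update_of_forall_ne {α β γ : Type} [DecidableEq β] (e : α → β) (g : α → γ)
    (l : List α) (a : β → γ) (b : β) (hb : ∀ j ∈ l, b ≠ e j) :
    l.foldl (fun a j => Function.update a (e j) (g j)) a b = a b := by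
  induction l generalizing a with
  | nil => rfl
  | cons x l ih =>
    rw [List.foldl_cons, ih _ fun j hj => hb j (List.mem_cons_of_mem _ hj),
      Function.update_of_ne (hb x List.mem_cons_self)]

variable {Γ : ConstraintLanguage}

theorem sigma_mk_injective' (i : Fin Γ.length) :
    Function.Injective fun j : Fin (Γ.get i).arity => (⟨i, j⟩ : Pos Γ) :=
  fun _ _ h => eq_of_heq (Sigma.mk.inj h).2

/-- Read the scope of a constraint with relation name `i`. -/
def readScope (i : Fin Γ.length) : RProg (Pos Γ) :=
  .forEach (fun j => readArg ⟨i, j⟩) (List.finRange (Γ.get i).arity)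

/-- Erase the scope of a constraint with relation name `i`. -/
def clearScope (i : Fin Γ.length) : RProg (Pos Γ) :=
  .forEach (fun j => clearArg ⟨i, j⟩) (List.finRange (Γ.get i).arity)

/-- The contents of the stacks of the argument positions when a scope has been read. -/
def scopeArgs (i : Fin Γ.length) (v : Fin (Γ.get i).arity → ℕ)
    (l : List (Fin (Γ.get i).arity)) : Pos Γ → List Cell :=
  l.foldl (fun a j => Function.update a ⟨i, j⟩ (List.replicate (v j) (Cell.const false)))
    fun _ => []

theorem unary_append (l l' : List ℕ) : unary (l ++ l') = unary l ++ unary l' := by simp [unary]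

theorem exec_readScope (i : Fin Γ.length) (v : Fin (Γ.get i).arity → ℕ) (n : ℕ)
    (hv : ∀ j, v j ≤ n) (s : List Bool)
    (c : Conf (Pos Γ)) (hl : c.last = some false) (ha : c.arg = fun _ => [])
    (h : c.input = unary (List.ofFn v) ++ s) :
    Exec (readScope i) c ((Γ.get i).arity * (n + 1))
      { c with
        input := s
        copy := ((unary (List.ofFn v)).map Cell.const).reverse ++ c.copy
        arg := scopeArgs i v (List.finRange _) } := by
  have := exec_forEach (fun j => readArg (⟨i, j⟩ : Pos Γ)) (n + 1)
    (fun l => { c with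
      input := unary (((List.finRange _).drop l.length).map v) ++ s
      copy := ((unary (l.map v)).map Cell.const).reverse ++ c.copy
      arg := scopeArgs i v l }) (List.finRange (Γ.get i).arity) (by
    intro l x l' hl'
    -- Positions are not repeated, so the stack of position `x` is still empty when its argument is
    -- read.
    have hx : x ∉ l := by
      have := List.nodup_finRange (Γ.get i).arity
      rw [hl', List.nodup_append] at this
      intro hx
      exact this.2.2 x hx x List.mem_cons_self rfl
    have h1 : List.drop (l ++ [x]).length (List.finRange (Γ.get i).arity) = l' := by
      rw [hl', show l ++ x :: l' = (l ++ [x]) ++ l' by simp, List.drop_left]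
    have h2 : scopeArgs i v l ⟨i, x⟩ = [] := foldl_update_of_forall_ne _ _ _ _ _ (by
      intro j hj h
      exact hx (by rwa [sigma_mk_injective' i h]))
    refine ((exec_readArg _ (v x) (unary (l'.map v) ++ s) _ ?_).congr ?_).mono
      (Nat.add_le_add_right (hv x) 1)
    · rw [hl', List.drop_left, List.map_cons, unary_cons]
      simp
    · congr 1
      · exact hl.symm
      · rw [h1]
      · dsimp only
        rw [List.map_append (f := v), unary_append]
        simp [unary]
      · dsimp only
        rw [h2, List.append_nil, scopeArgs, scopeArgs, List.foldl_append]
        rfl)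
  refine ((this.congr_left ?_).congr ?_).mono (by rw [List.length_finRange])
  · obtain ⟨⟩ := c
    simp only at ha h
    subst ha h
    congr 1
    rw [List.ofFn_eq_map]
    rfl
  · congr 1
    · rw [List.drop_length]
      rfl
    · rw [List.ofFn_eq_map]

theorem exec_clearScope (i : Fin Γ.length) (v : Fin (Γ.get i).arity → ℕ) (n : ℕ)
    (hv : ∀ j, v j ≤ n) (c : Conf (Pos Γ)) (hc : c.cell = none)
    (ha : c.arg = scopeArgs i v (List.finRange _)) :
    Exec (clearScope i) c ((Γ.get i).arity * (n + 1)) { c with arg := fun _ => [] } := by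
  have := exec_forEach (fun j => clearArg (⟨i, j⟩ : Pos Γ)) (n + 1)
    (fun l => { c with arg := l.foldl (fun a j => Function.update a ⟨i, j⟩ []) c.arg })
    (List.finRange (Γ.get i).arity) (by
    intro l x l' hl'
    have hx : x ∉ l := by
      have := List.nodup_finRange (Γ.get i).arity
      rw [hl', List.nodup_append] at this
      intro hx
      exact this.2.2 x hx x List.mem_cons_self rfl
    have h2 : l.foldl (fun a j => Function.update a (⟨i, j⟩ : Pos Γ) ([] : List Cell)) c.arg
        ⟨i, x⟩ = c.arg ⟨i, x⟩ := foldl_update_of_forall_ne _ _ _ _ _ (by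
      intro j hj h
      exact hx (by rwa [sigma_mk_injective' i h]))
    have h3 : c.arg ⟨i, x⟩ = List.replicate (v x) (Cell.const false) := by
      rw [ha]
      exact foldl_update_of_mem _ (sigma_mk_injective' i) _ _ _ _ (List.mem_finRange x)
    refine ((exec_clearArg _ _).congr ?_).mono ?_
    · congr 1
      · exact hc.symm
      · rw [List.foldl_append]
        rfl
    · refine Nat.add_le_add_right ((le_of_eq ?_).trans (hv x)) 1
      exact (congrArg List.length (h2.trans h3)).trans List.length_replicate)
  refine (this.mono (by rw [List.length_finRange])).congr ?_
  congr 1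
  -- Positions of relation `i` are cleared by the loop; those of the other relations were never
  -- filled.
  funext ⟨i', j⟩
  by_cases hi : i' = i
  · subst hi
    exact foldl_update_of_mem _ (sigma_mk_injective' i') (fun _ => []) _ _ _ (List.mem_finRange j)
  · have hne : ∀ j' ∈ List.finRange (Γ.get i).arity, (⟨i', j⟩ : Pos Γ) ≠ ⟨i, j'⟩ :=
      fun j' _ h => hi (Sigma.mk.inj h).1
    refine (foldl_update_of_forall_ne _ _ _ _ _ hne).trans ?_
    rw [ha]
    exact foldl_update_of_forall_ne _ _ _ _ _ hne

/-- Process a constraint with relation name `i`, when its name has been read. -/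
def processConstraint (act : Fin Γ.length → RProg (Pos Γ)) (i : Fin Γ.length) : RProg (Pos Γ) :=
  .seq (readScope i) (.seq (act i) (clearScope i))

/-- Process all constraints on the input, and restore the input. -/
def pass (act : Fin Γ.length → RProg (Pos Γ)) : RProg (Pos Γ) :=
  .seq (.drain readBit gotBit (dispatch (List.ofFn (processConstraint act)))) restore

variable {n K : ℕ} {act : Fin Γ.length → RProg (Pos Γ)}
  {G : Constraint Γ (Fin n) → Core (Pos Γ) → Core (Pos Γ)} {Good : Core (Pos Γ) → Prop}

theorem exec_processConstraint
    (hact : ∀ (x : Constraint Γ (Fin n)) (k : Core (Pos Γ)) (c : Conf (Pos Γ)), Good k →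
      c.cell = none → c.tmp = [] →
      (∀ j, c.arg ⟨x.1, j⟩ = List.replicate (x.2 j) (Cell.const false)) →
      Exec (act x.1) (c.withCore k) (K * (n + 1)) (c.withCore (G x k)))
    (hK : ∀ i, (Γ.get i).arity ≤ K)
    (x : Constraint Γ (Fin n)) (s : List Bool) (k : Core (Pos Γ)) (hk : Good k)
    (c : Conf (Pos Γ)) (hl : c.last = some false) (hc : c.cell = none) (ht : c.tmp = [])
    (ha : c.arg = fun _ => [])
    (h : c.input = unary (List.ofFn fun j => (x.2 j : ℕ)) ++ s) :
    Exec (processConstraint act x.1) (c.withCore k) (3 * K * (n + 1))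
      (Conf.withCore { c with
        input := s
        copy := ((unary (List.ofFn fun j => (x.2 j : ℕ))).map Cell.const).reverse ++ c.copy }
        (G x k)) := by
  have h1 := exec_readScope x.1 (fun j => (x.2 j : ℕ)) n (fun j => (x.2 j).2.le) s
    (c.withCore k) hl ha h
  have h2 := hact x k { c with
        input := s
        copy := ((unary (List.ofFn fun j => (x.2 j : ℕ))).map Cell.const).reverse ++ c.copy
        arg := scopeArgs x.1 (fun j => (x.2 j : ℕ)) (List.finRange _) } hk hc ht
    (fun j => foldl_update_of_mem _ (sigma_mk_injective' x.1) _ _ _ _ (List.mem_finRange j))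
  have h3 := exec_clearScope x.1 (fun j => (x.2 j : ℕ)) n (fun j => (x.2 j).2.le)
    (Conf.withCore { c with
        input := s
        copy := ((unary (List.ofFn fun j => (x.2 j : ℕ))).map Cell.const).reverse ++ c.copy
        arg := scopeArgs x.1 (fun j => (x.2 j : ℕ)) (List.finRange _) } (G x k)) hc rfl
  refine ((h1.seq (h2.seq h3)).congr ?_).mono ?_
  · simp [Conf.withCore, ha]
  -- Reading the scope, acting on it and clearing it cost at most K(n + 1) steps each.
  · have := Nat.mul_le_mul_right (n + 1) (hK x.1)
    rw [Nat.mul_assoc 3]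
    omega

/-- The only assumption on the action is that it transforms the core of the memory by `G` when the
scope is available in unary and the invariant `Good` holds. Every bit read is remembered on the copy
stack, so the input can be rebuilt for another pass. Processed constraints are listed latest first,
so the loop invariant is a right fold, which at the end becomes a left fold over `cs`. -/
theorem exec_pass
    (hact : ∀ (x : Constraint Γ (Fin n)) (k : Core (Pos Γ)) (c : Conf (Pos Γ)), Good k →
      c.cell = none → c.tmp = [] →
      (∀ j, c.arg ⟨x.1, j⟩ = List.replicate (x.2 j) (Cell.const false)) →
      Exec (act x.1) (c.withCore k) (K * (n + 1)) (c.withCore (G x k)))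
    (hK : ∀ i, (Γ.get i).arity ≤ K)
    (hG : ∀ x k, Good k → Good (G x k))
    (cs : List (Constraint Γ (Fin n))) (k : Core (Pos Γ)) (hk : Good k)
    (c : Conf (Pos Γ)) (hc : c.cell = none) (ht : c.tmp = [])
    (ha : c.arg = fun _ => []) (hcopy : c.copy = [])
    (h : c.input = unary (cs.flatMap CSPCode.constraintNumbers)) :
    Exec (pass act) (c.withCore k)
      (cs.length * (3 * K * (n + 1) + 1) + 1 + (c.input.length + 1))
      (Conf.withCore { c with last := none } (cs.foldl (fun k x => G x k) k)) := by
  have hgood : ∀ l : List (Constraint Γ (Fin n)), Good (l.foldr G k) := by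
    intro l
    induction l with
    | nil => exact hk
    | cons x l ih => exact hG x _ ih
  have hnum : ∀ (x : Constraint Γ (Fin n)) (l : List (Constraint Γ (Fin n))),
      unary ((x :: l).flatMap CSPCode.constraintNumbers) =
      List.replicate (x.1 : ℕ) true ++ false :: (unary (List.ofFn fun j => (x.2 j : ℕ)) ++
        unary (l.flatMap CSPCode.constraintNumbers)) := by
    intro x l
    rw [List.flatMap_cons, unary_append, CSPCode.constraintNumbers, unary_cons]
    simp
  have h1 := exec_drain (c := c.withCore k) (p := readBit) (b := gotBit)
    (q := dispatch (List.ofFn (processConstraint act))) (3 * K * (n + 1)) cs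
    (fun l l' => Conf.withCore { c with
      last := if l = [] then c.last else some false
      input := unary (l'.flatMap CSPCode.constraintNumbers)
      copy := ((unary (l.reverse.flatMap CSPCode.constraintNumbers)).map Cell.const).reverse }
      (l.foldr G k))
    (fun l x l' => Conf.withCore { c with
      last := (unary ((x :: l').flatMap CSPCode.constraintNumbers)).head?
      input := (unary ((x :: l').flatMap CSPCode.constraintNumbers)).tail
      copy := Cell.const ((unary ((x :: l').flatMap CSPCode.constraintNumbers)).headD false) ::
        ((unary (l.reverse.flatMap CSPCode.constraintNumbers)).map Cell.const).reverse }
      (l.foldr G k))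
    (Conf.withCore { c with
      last := none
      input := []
      copy := ((unary (cs.flatMap CSPCode.constraintNumbers)).map Cell.const).reverse }
      (cs.reverse.foldr G k))
    (by
      obtain ⟨⟩ := c
      simp only at h hcopy
      subst h hcopy
      rfl)
    (by
      intro l x l' _
      cases hs : unary ((x :: l').flatMap CSPCode.constraintNumbers) with
      | nil => rw [hnum] at hs; simp at hs
      | cons b s => exact exec_readBit_cons rfl)
    (by
      intro l x l' _
      rw [hnum]
      cases hx : (x.1 : ℕ) <;> rfl)
    (by
      intro l x l' _
      rw [hnum]
      refine exec_dispatch _ x.1 (by simp) _ _ (Conf.withCore { c with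
        copy := ((unary (l.reverse.flatMap CSPCode.constraintNumbers)).map Cell.const).reverse }
        (l.foldr G k)) _ ?_
      rw [List.getElem_ofFn]
      refine (exec_processConstraint hact hK x (unary (l'.flatMap CSPCode.constraintNumbers))
        (l.foldr G k) (hgood l) { c with
        last := some false
        input := unary (List.ofFn fun j => (x.2 j : ℕ)) ++
          unary (l'.flatMap CSPCode.constraintNumbers)
        copy := ((List.replicate (x.1 : ℕ) true ++ [false]).map Cell.const).reverse ++
          ((unary (l.reverse.flatMap CSPCode.constraintNumbers)).map Cell.const).reverse }
        rfl hc ht ha rfl).congr ?_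
      simp [Conf.withCore, unary_append, CSPCode.constraintNumbers, unary_cons])
    ((exec_readBit_nil rfl).congr (by simp [Conf.withCore, unary])) rfl
  have h2 := exec_restore (unary (cs.flatMap CSPCode.constraintNumbers)).reverse
    (Conf.withCore { c with
      last := none
      input := []
      copy := ((unary (cs.flatMap CSPCode.constraintNumbers)).map Cell.const).reverse }
      (cs.reverse.foldr G k)) (by simp [Conf.withCore])
  refine ((h1.seq h2).congr ?_).mono ?_
  · simp [Conf.withCore, h, hc, hcopy]
  · simp [h]

end

/-! ## The reduction on numbers -/

/-- A hyper-edge, given by a list of numbers, is written as the length of its list followed by the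
list. -/
def edgeText (e : List ℕ) : List ℕ := e.length :: e

/-- Add the pins of the formula on the variable `j` to a cell. -/
def ConjFormula.addPins {r : ℕ} (φ : ConjFormula r) (j : Fin r) (x : Cell) : Cell :=
  fun b => x b || decide ((j, b) ∈ φ.pins)

/-- The hyper-edges for a constraint with scope `v`, when the cells of the variables in the scope
are `e`. Clauses are satisfied by variables of value `β`. -/
noncomputable def ConjFormula.edgesOf {r : ℕ} (φ : ConjFormula r) (β : Bool) (w : ℕ)
    (v : Fin r → ℕ) (e : Fin r → Cell) : List (List ℕ) :=
  (if w = 0 then [] else φ.pins.toList.map fun p => [v p.1 + w]) ++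
    φ.clauses.toList.map fun l => (l.filter fun j => !e j (!β)).map fun j => v j + w

/-- Some pinned variable is pinned to both values, or all arguments of some clause are pinned to
the value that does not satisfy the clause. -/
noncomputable def ConjFormula.fails {r : ℕ} (φ : ConjFormula r) (β : Bool)
    (e : Fin r → Cell) : Bool :=
  (φ.pins.toList.any fun p => e p.1 true && e p.1 false) ||
    φ.clauses.toList.any fun l => l.all fun j => e j (!β)

/-- Hyper-edges of width up to `w` that force all of the first `w` vertices out of independent
sets. -/
def gadgetEdges (w : ℕ) : List (List ℕ) :=
  if w = 0 then [] else (List.range w).map (fun i => [i]) ++ [List.range w]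

section

variable {Γ : ConstraintLanguage} (φ : ∀ i : Fin Γ.length, ConjFormula (Γ.get i).arity)
  (β : Bool) (w : ℕ)

/-- The effect of a constraint on the array of pins. -/
def pinStep {n : ℕ} (x : Constraint Γ (Fin n)) (k : Core (Pos Γ)) : Core (Pos Γ) :=
  { k with arr := (List.finRange _).foldl (fun a j => a.modify (x.2 j) ((φ x.1).addPins j)) k.arr }

/-- The cell with the given index. -/
def cellAt (a : List Cell) (v : ℕ) : Cell := a.getD v (Cell.const false)

/-- The effect of a constraint on the hypergraph under construction. -/
noncomputable def emitStep {n : ℕ} (x : Constraint Γ (Fin n)) (k : Core (Pos Γ)) : Core (Pos Γ) where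
  stat := (List.finRange _).foldl
    (fun a j => Function.update a ⟨x.1, j⟩ (cellAt k.arr (x.2 j))) k.stat
  fail := k.fail || (φ x.1).fails β fun j => cellAt k.arr (x.2 j)
  query := unary (((φ x.1).edgesOf β w (fun j => (x.2 j : ℕ))
    fun j => cellAt k.arr (x.2 j)).flatMap edgeText) ++ k.query
  arr := k.arr

/-- The program for `pinStep`. -/
def pinAct (i : Fin Γ.length) : RProg (Pos Γ) :=
  .forEach (fun j => modifyCell ⟨i, j⟩ ((φ i).addPins j)) (List.finRange (Γ.get i).arity)

/-- Raise the flag if a condition holds. -/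
def failIf {P : Type} (f : Reg P → Bool) : RProg P := .load fun v => { v with fail := v.fail || f v }

/-- Emit the hyper-edge for a pin. -/
def emitPin (i : Fin Γ.length) (p : Fin (Γ.get i).arity × Bool) : RProg (Pos Γ) :=
  .seq (failIf fun v => v.stat ⟨i, p.1⟩ true && v.stat ⟨i, p.1⟩ false)
    (if w = 0 then .skip else .seq (emitArg w ⟨i, p.1⟩) (pushString (unary [1])))

/-- Emit the hyper-edge for a clause. -/
def emitClause (i : Fin Γ.length) (l : List (Fin (Γ.get i).arity)) : RProg (Pos Γ) :=
  .seq (failIf fun v => l.all fun j => v.stat ⟨i, j⟩ (!β))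
    (.seq (.forEachRev (fun j => .ite (fun v => v.stat ⟨i, j⟩ (!β)) .skip (emitArg w ⟨i, j⟩)) l)
      (.seq (pushPort .query fun _ => false)
        (.forEachRev (fun j => .ite (fun v => v.stat ⟨i, j⟩ (!β)) .skip
          (pushPort .query fun _ => true)) l)))

/-- The program for `emitStep`. -/
noncomputable def emitAct (i : Fin Γ.length) : RProg (Pos Γ) :=
  .seq (.forEach (fun j => lookup ⟨i, j⟩) (List.finRange (Γ.get i).arity))
    (.seq (.forEachRev (emitClause β w i) (φ i).clauses.toList)
      (.forEachRev (emitPin w i) (φ i).pins.toList))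

/-- A constant for the running time. -/
noncomputable def stepCost (i : Fin Γ.length) : ℕ :=
  2 * ((Γ.get i).arity + (φ i).clauses.card * (φ i).width + (φ i).pins.card)

variable {φ β w} {n : ℕ}

theorem exec_failIf {P : Type} [DecidableEq P] (f : Reg P → Bool) (c : Conf P) :
    Exec (failIf f) c 0 { c with fail := c.fail || f c.reg } :=
  exec_load _ _ _ rfl rfl

theorem length_pinStep_fold (x : Constraint Γ (Fin n)) (l : List (Fin (Γ.get x.1).arity))
    (a : List Cell) :
    (l.foldl (fun a j => a.modify (x.2 j) ((φ x.1).addPins j)) a).length = a.length := by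
  induction l generalizing a with
  | nil => rfl
  | cons j l ih => rw [List.foldl_cons, ih, List.length_modify]

theorem exec_pinAct (x : Constraint Γ (Fin n)) (k : Core (Pos Γ)) (c : Conf (Pos Γ))
    (hk : k.arr.length = n) (hc : c.cell = none) (ht : c.tmp = [])
    (ha : ∀ j, c.arg ⟨x.1, j⟩ = List.replicate (x.2 j) (Cell.const false)) :
    Exec (pinAct φ x.1) (c.withCore k) (stepCost φ x.1 * (n + 1)) (c.withCore (pinStep φ x k)) := by
  have := exec_forEach (fun j => modifyCell (⟨x.1, j⟩ : Pos Γ) ((φ x.1).addPins j)) (2 * (n + 1))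
    (fun l => c.withCore { k with
      arr := l.foldl (fun a j => a.modify (x.2 j) ((φ x.1).addPins j)) k.arr })
    (List.finRange (Γ.get x.1).arity) (by
    intro l j l' _
    refine ((exec_modifyCell _ _ (x.2 j) _ (by exact ha j) ?_ (by exact ht)).congr ?_).mono
      (Nat.mul_le_mul_left 2 (Nat.add_le_add_right (x.2 j).2.le 1))
    · exact (x.2 j).2.trans_eq (hk.symm.trans (length_pinStep_fold x l k.arr).symm)
    · rw [List.foldl_append]
      obtain ⟨⟩ := c
      simp only at hc
      subst hc
      rfl)
  refine this.mono ?_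
  rw [List.length_finRange, ← Nat.mul_assoc]
  refine Nat.mul_le_mul_right _ ?_
  simp only [stepCost]
  omega

theorem exec_lookups (x : Constraint Γ (Fin n)) (k : Core (Pos Γ)) (c : Conf (Pos Γ))
    (hk : k.arr.length = n) (hc : c.cell = none) (ht : c.tmp = [])
    (ha : ∀ j, c.arg ⟨x.1, j⟩ = List.replicate (x.2 j) (Cell.const false)) :
    Exec (.forEach (fun j => lookup ⟨x.1, j⟩) (List.finRange (Γ.get x.1).arity)) (c.withCore k)
      ((Γ.get x.1).arity * (2 * (n + 1)))
      (c.withCore { k with stat := (emitStep φ β w x k).stat }) := by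
  have := exec_forEach (fun j => lookup (⟨x.1, j⟩ : Pos Γ)) (2 * (n + 1))
    (fun l => c.withCore { k with
      stat := l.foldl (fun a j => Function.update a ⟨x.1, j⟩ (cellAt k.arr (x.2 j))) k.stat })
    (List.finRange (Γ.get x.1).arity) (by
    intro l j l' _
    have hj : (x.2 j : ℕ) < k.arr.length := hk ▸ (x.2 j).2
    refine ((exec_lookup _ (x.2 j) _ (by exact ha j) (by exact hj) (by exact ht)).congr ?_).mono
      (Nat.mul_le_mul_left 2 (Nat.add_le_add_right (x.2 j).2.le 1))
    rw [List.foldl_append]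
    have : cellAt k.arr (x.2 j) = k.arr[x.2 j] := List.getD_eq_getElem _ _ hj
    obtain ⟨⟩ := c
    simp only at hc
    subst hc
    simp only [List.foldl_cons, List.foldl_nil, this]
    rfl)
  exact this.mono (by rw [List.length_finRange])

theorem exec_emitPin (i : Fin Γ.length) (p : Fin (Γ.get i).arity × Bool)
    (v : Fin (Γ.get i).arity → ℕ) (hv : ∀ j, v j ≤ n) (e : Fin (Γ.get i).arity → Cell)
    (c : Conf (Pos Γ)) (hc : c.cell = none) (ht : c.tmp = [])
    (ha : ∀ j, c.arg ⟨i, j⟩ = List.replicate (v j) (Cell.const false))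
    (hs : ∀ j, c.stat ⟨i, j⟩ = e j) :
    Exec (emitPin w i p) c (2 * (n + 1)) { c with
      fail := c.fail || (e p.1 true && e p.1 false)
      query := unary ((if w = 0 then [] else [[v p.1 + w]]).flatMap edgeText) ++ c.query } := by
  refine (exec_failIf _ _).seq' ?_
  simp only [Conf.reg, hs]
  by_cases hw : w = 0
  · simp only [hw, if_true]
    exact exec_skip.mono (by omega)
  · simp only [hw, if_false]
    refine (((exec_emitArg w _ _ _ (by exact ha p.1) (by exact ht)).seq (exec_pushString _ _)).congr ?_).mono
      (Nat.mul_le_mul_left 2 (Nat.add_le_add_right (hv p.1) 1))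
    congr 1
    exact hc.symm

theorem exec_emitClause (i : Fin Γ.length) (l : List (Fin (Γ.get i).arity))
    (v : Fin (Γ.get i).arity → ℕ) (hv : ∀ j, v j ≤ n) (e : Fin (Γ.get i).arity → Cell)
    (c : Conf (Pos Γ)) (hc : c.cell = none) (ht : c.tmp = [])
    (ha : ∀ j, c.arg ⟨i, j⟩ = List.replicate (v j) (Cell.const false))
    (hs : ∀ j, c.stat ⟨i, j⟩ = e j) :
    Exec (emitClause β w i l) c (l.length * (2 * (n + 1))) { c with
      fail := c.fail || l.all fun j => e j (!β)
      query := unary (edgeText ((l.filter fun j => !e j (!β)).map fun j => v j + w)) ++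
        c.query } := by
  have h1 := exec_forEachRev (fun j => .ite (fun v => v.stat ⟨i, j⟩ (!β)) .skip
      (emitArg w (⟨i, j⟩ : Pos Γ))) (2 * (n + 1))
    (fun l' => { c with
      fail := c.fail || l.all fun j => e j (!β)
      query := unary ((l'.filter fun j => !e j (!β)).map fun j => v j + w) ++ c.query }) l (by
    intro j _ l'
    by_cases hj : e j (!β) = true
    · refine ((exec_ite_true (by exact (congrFun (hs j) _).trans hj) exec_skip).mono (by omega)).congr ?_
      simp [hj]
    · simp only [Bool.not_eq_true] at hj
      refine ((exec_ite_false (by exact (congrFun (hs j) _).trans hj)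
        (exec_emitArg w _ _ _ (by exact ha j) (by exact ht))).mono
        (Nat.mul_le_mul_left 2 (Nat.add_le_add_right (hv j) 1))).congr ?_
      congr 1
      · exact hc.symm
      · simp [hj, unary])
  have h2 := exec_forEachRev (fun j => .ite (fun v : Reg (Pos Γ) => v.stat ⟨i, j⟩ (!β)) .skip
      (pushPort .query fun _ => true)) 0
    (fun l' => { c with
      fail := c.fail || l.all fun j => e j (!β)
      query := List.replicate (l'.filter fun j => !e j (!β)).length true ++ false ::
        (unary ((l.filter fun j => !e j (!β)).map fun j => v j + w) ++ c.query) }) l (by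
    intro j _ l'
    by_cases hj : e j (!β) = true
    · refine (exec_ite_true (by exact (congrFun (hs j) _).trans hj) exec_skip).congr ?_
      simp [hj]
    · simp only [Bool.not_eq_true] at hj
      refine (exec_ite_false (by exact (congrFun (hs j) _).trans hj) (exec_pushQuery _)).congr ?_
      simp [hj, List.replicate_succ])
  refine (exec_failIf _ _).seq' ?_
  have h3 : (c.fail || l.all fun j => c.reg.stat ⟨i, j⟩ (!β)) =
      (c.fail || l.all fun j => e j (!β)) := by simp only [Conf.reg, hs]
  rw [h3]
  refine ((h1.seq ((exec_pushQuery _).seq h2)).congr ?_).mono (by simp)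
  congr 1
  rw [edgeText, unary_cons]
  simp

/-- A scope has bounded length, so the pins of all its variables fit into the finite control; after
the lookups, deciding which arguments to drop is free. Clauses are emitted before pins, and each
from its end, because the query stack is written backwards. -/
theorem exec_emitAct (x : Constraint Γ (Fin n)) (k : Core (Pos Γ)) (c : Conf (Pos Γ))
    (hk : k.arr.length = n) (hc : c.cell = none) (ht : c.tmp = [])
    (ha : ∀ j, c.arg ⟨x.1, j⟩ = List.replicate (x.2 j) (Cell.const false)) :
    Exec (emitAct φ β w x.1) (c.withCore k) (stepCost φ x.1 * (n + 1))
      (c.withCore (emitStep φ β w x k)) := by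
  have hs : ∀ j, (emitStep φ β w x k).stat ⟨x.1, j⟩ = cellAt k.arr (x.2 j) := fun j =>
    foldl_update_of_mem _ (sigma_mk_injective' x.1) (fun j => cellAt k.arr (x.2 j)) _ _ _
      (List.mem_finRange j)
  have h1 := exec_lookups (φ := φ) (β := β) (w := w) x k c hk hc ht ha
  have h2 := exec_forEachRev (emitClause β w x.1) ((φ x.1).width * (2 * (n + 1)))
    (fun ls => c.withCore { k with
      stat := (emitStep φ β w x k).stat
      fail := k.fail || ls.any fun l => l.all fun j => cellAt k.arr (x.2 j) (!β)
      query := unary ((ls.map fun l => (l.filter fun j => !cellAt k.arr (x.2 j) (!β)).map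
        fun j => (x.2 j : ℕ) + w).flatMap edgeText) ++ k.query }) (φ x.1).clauses.toList (by
    intro l hl ls
    refine ((exec_emitClause x.1 l (fun j => (x.2 j : ℕ)) (fun j => (x.2 j).2.le)
      (fun j => cellAt k.arr (x.2 j)) _ (by exact hc) (by exact ht)
      (by exact ha) (by exact hs)).congr ?_).mono ?_
    · rw [List.map_cons, List.flatMap_cons, unary_append, List.any_cons, Conf.withCore,
        Conf.withCore]
      congr 1
      · rw [Bool.or_assoc, Bool.or_comm (ls.any _)]
      · rw [List.append_assoc]
    · exact Nat.mul_le_mul_right _ (Finset.le_sup (f := List.length) (Finset.mem_toList.1 hl)))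
  have h3 := exec_forEachRev (emitPin w x.1) (2 * (n + 1))
    (fun ps => c.withCore { k with
      stat := (emitStep φ β w x k).stat
      fail := k.fail || ((ps.any fun p => cellAt k.arr (x.2 p.1) true &&
        cellAt k.arr (x.2 p.1) false) || (φ x.1).clauses.toList.any fun l =>
        l.all fun j => cellAt k.arr (x.2 j) (!β))
      query := unary (((if w = 0 then [] else ps.map fun p => [(x.2 p.1 : ℕ) + w]) ++
        (φ x.1).clauses.toList.map fun l => (l.filter fun j => !cellAt k.arr (x.2 j) (!β)).map
        fun j => (x.2 j : ℕ) + w).flatMap edgeText) ++ k.query }) (φ x.1).pins.toList (by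
    intro p hp ps
    refine (exec_emitPin x.1 p (fun j => (x.2 j : ℕ)) (fun j => (x.2 j).2.le)
      (fun j => cellAt k.arr (x.2 j)) _ (by exact hc) (by exact ht)
      (by exact ha) (by exact hs)).congr ?_
    rw [List.any_cons, Conf.withCore, Conf.withCore]
    congr 1
    · dsimp only
      ac_rfl
    · by_cases hw : w = 0
      · simp [hw, unary]
      · simp [hw, unary])
  refine ((h1.seq ((h2.congr_left ?_).seq (h3.congr_left ?_))).congr ?_).mono ?_
  · simp [unary]
  · simp [unary]
  · rfl
  -- The three summands of `stepCost` pay for the lookups, the clauses and the pins.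
  · simp only [stepCost, Finset.length_toList]
    apply le_of_eq
    ring

end

/-! ## Runs of machines with one oracle call -/

namespace ProbOracleTM

section

variable {M : ProbOracleTM} {c c' : M.Cfg} {t : ℕ}

theorem iterate_detStep_of_none (hc : c.l = none) (s : ℕ) : M.detStep^[s] c = c :=
  Function.iterate_fixed (detStep_of_none c hc) s

theorem iterate_detStep_of_le (h : M.detStep^[t] c = c') (hc : c'.l = none) {s : ℕ} (hs : t ≤ s) :
    M.detStep^[s] c = c' := by
  obtain ⟨s, rfl⟩ := Nat.exists_eq_add_of_le' hs
  rw [Function.iterate_add_apply, h, iterate_detStep_of_none hc]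

/-- Without an oracle the label `ask` is a trap: a deterministic run that reaches it stays there, so
a run that halts has never been there. -/
theorem label_ne_ask_of_halts (hask : ∀ c : M.Cfg, c.l = some M.ask → M.detStep c = c)
    (h : M.detStep^[t] c = c') (hc : c'.l = none) (s : ℕ) :
    (M.detStep^[s] c).l ≠ some M.ask := by
  intro hs
  rcases le_total t s with hts | hts
  · rw [iterate_detStep_of_le h hc hts, hc] at hs
    simp at hs
  · obtain ⟨r, rfl⟩ := Nat.exists_eq_add_of_le' hts
    rw [Function.iterate_add_apply, Function.iterate_fixed (hask _ hs)] at h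
    rw [h, hc] at hs
    simp at hs

variable {x : List Bool} {m : ℕ}

theorem run_eq_pure (hM : ∀ b l, M.prog b l = M.prog true l) (O : Approximator)
    (s : ℕ) (hs : ∀ s' < s, (M.detStep^[s'] (M.initial x m)).l ≠ some M.ask) :
    M.run O x m s = PMF.pure (M.detStep^[s] (M.initial x m)) := by
  have h0 : M.run O x m 0 = PMF.pure (M.initial x m) := rfl
  have := run_add hM O x m 0 s (by
    intro c hc t' ht'
    rw [h0, PMF.support_pure, Set.mem_singleton_iff] at hc
    subst hc
    exact hs t' ht')
  rw [Nat.zero_add] at this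
  rw [this, h0, PMF.pure_map]

theorem run_of_halts (hM : ∀ b l, M.prog b l = M.prog true l)
    (hask : ∀ c : M.Cfg, c.l = some M.ask → M.detStep c = c) (O : Approximator)
    (h : M.detStep^[t] (M.initial x m) = c') (hc : c'.l = none) (s : ℕ) :
    M.run O x m s = PMF.pure (M.detStep^[s] (M.initial x m)) :=
  run_eq_pure hM O s fun s' _ => label_ne_ask_of_halts hask h hc s'

/-- The run is deterministic up to the call, which contributes the oracle's distribution, and
deterministic again afterwards. The second phase halts for every answer, so there is no second call.
-/
theorem exists_run_of_asks (hM : ∀ b l, M.prog b l = M.prog true l)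
    (hask : ∀ c : M.Cfg, c.l = some M.ask → M.detStep c = c) (O : Approximator)
    (h : M.detStep^[t] (M.initial x m) = c') (hc : c'.l = some M.ask)
    (F : ℕ → M.Cfg) (B : ℕ)
    (hF : ∀ y, ∃ s ≤ B, M.detStep^[s] (M.answered c' y) = F y ∧ (F y).l = none) :
    ∃ T ≤ t, (∀ s < T, ∀ c ∈ (M.run O x m s).support, c.l ≠ some M.ask) ∧
      M.run O x m T = PMF.pure c' ∧
      (∀ s, T < s → ∀ c ∈ (M.run O x m s).support, c.l ≠ some M.ask) ∧
      ∀ s, t + 1 + B ≤ s → M.run O x m s =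
        (O (M.port c' .query) (M.port c' .queryError).length).map F := by
  classical
  -- `t` is only an upper bound for the time of the call. The first visit `T` to `ask` is the actual
  -- one, and it has the same configuration because `ask` is a trap.
  have hex : ∃ s, (M.detStep^[s] (M.initial x m)).l = some M.ask := ⟨t, by rw [h, hc]⟩
  have hT := Nat.find_spec hex
  have hlt : ∀ s < Nat.find hex, (M.detStep^[s] (M.initial x m)).l ≠ some M.ask :=
    fun s hs => Nat.find_min hex hs
  have hle : Nat.find hex ≤ t := Nat.find_le (by rw [h, hc])
  generalize Nat.find hex = T at hT hlt hle
  have hTc : M.detStep^[T] (M.initial x m) = c' := by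
    obtain ⟨r, rfl⟩ := Nat.exists_eq_add_of_le' hle
    rw [Function.iterate_add_apply, Function.iterate_fixed (hask _ hT)] at h
    exact h
  have hrun : M.run O x m T = PMF.pure c' := by rw [run_eq_pure hM O T hlt, hTc]
  have hrun1 : M.run O x m (T + 1) =
      (O (M.port c' .query) (M.port c' .queryError).length).map (M.answered c') := by
    change (M.run O x m T).bind (M.step O) = _
    rw [hrun, PMF.pure_bind]
    obtain ⟨l, v, S⟩ := c'
    cases hc
    simp [step]
  have hne : ∀ y s, (M.detStep^[s] (M.answered c' y)).l ≠ some M.ask := fun y s => by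
    obtain ⟨r, _, hr, hr'⟩ := hF y
    exact label_ne_ask_of_halts hask hr hr' s
  have hrun2 : ∀ s, M.run O x m (T + 1 + s) =
      (O (M.port c' .query) (M.port c' .queryError).length).map
        fun y => M.detStep^[s] (M.answered c' y) := by
    intro s
    rw [run_add hM O x m (T + 1) s, hrun1, PMF.map_comp]
    · rfl
    · intro c hc s' _
      rw [hrun1, PMF.support_map] at hc
      obtain ⟨y, _, rfl⟩ := hc
      exact hne y s'
  refine ⟨T, hle, ?_, hrun, ?_, ?_⟩
  · intro s hs c hc
    rw [run_eq_pure hM O s fun s' hs' => hlt s' (hs'.trans hs), PMF.support_pure,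
      Set.mem_singleton_iff] at hc
    subst hc
    exact hlt s hs
  · intro s hs c hc
    obtain ⟨r, rfl⟩ := Nat.exists_eq_add_of_lt hs
    rw [show T + r + 1 = T + 1 + r by omega, hrun2, PMF.support_map] at hc
    obtain ⟨y, _, rfl⟩ := hc
    exact hne y r
  · intro s hs
    obtain ⟨r, rfl⟩ := Nat.exists_eq_add_of_le (show T + 1 ≤ s by omega)
    rw [hrun2]
    congr 1
    funext y
    obtain ⟨r', hr', h1, h2⟩ := hF y
    exact iterate_detStep_of_le h1 h2 (by omega)

end

end ProbOracleTM

/-! ## The reduction machine -/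

section

variable {Γ : ConstraintLanguage} (φ : ∀ i : Fin Γ.length, ConjFormula (Γ.get i).arity)
  (β : Bool) (w : ℕ)

/-- Whether a variable with the given pins becomes a vertex. -/
def becomesVertex (x : Cell) : Bool := !(decide (w = 0) && (x true || x false))

/-- The array of pins. -/
def pinArray {n : ℕ} (cs : List (Constraint Γ (Fin n))) : List Cell :=
  cs.foldl (fun a x => (List.finRange _).foldl
    (fun a j => a.modify (x.2 j) ((φ x.1).addPins j)) a) (List.replicate n (Cell.const false))

/-- The hyper-edges of the reduction. -/
noncomputable def reductionEdges {n : ℕ} (cs : List (Constraint Γ (Fin n))) : List (List ℕ) :=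
  (cs.reverse.flatMap fun x => (φ x.1).edgesOf β w (fun j => (x.2 j : ℕ))
    fun j => cellAt (pinArray φ cs) (x.2 j)) ++ gadgetEdges w

/-- Whether the reduction finds that the instance is not satisfiable. -/
noncomputable def reductionFails {n : ℕ} (cs : List (Constraint Γ (Fin n))) : Bool :=
  cs.any fun x => (φ x.1).fails β fun j => cellAt (pinArray φ cs) (x.2 j)

/-- The number of vertices in the reduction. -/
def reductionVertices {n : ℕ} (cs : List (Constraint Γ (Fin n))) : ℕ :=
  (pinArray φ cs).countP (becomesVertex w) + w

/-- The part of the reduction before the oracle call. -/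
noncomputable def prepare : RProg (Pos Γ) :=
  .seq readCount (.seq (pushString (unary ((gadgetEdges w).flatMap edgeText)))
    (.seq (pass (pinAct φ)) (.seq (pass (emitAct φ β w))
      (.seq (emitCount w (becomesVertex w)) (.seq passError
        (.forEachRev (fun _ => pushWork .tmp fun _ => Cell.const false) (List.range (w + 2))))))))

/-- The part of the reduction after the oracle call. -/
def finish : RProg (Pos Γ) := .seq takeAnswer copyToOutput

/-- The initial memory. -/
def initialConf (s : List Bool) (m : ℕ) : Conf (Pos Γ) where
  last := none
  cell := none
  stat := fun _ => Cell.const false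
  fail := false
  input := s
  error := List.replicate m true
  query := []
  queryError := []
  answer := []
  output := []
  arr := []
  tmp := []
  copy := []
  arg := fun _ => []

variable {φ β w} {n : ℕ}

theorem length_pinArray (cs : List (Constraint Γ (Fin n))) : (pinArray φ cs).length = n := by
  have : ∀ (cs : List (Constraint Γ (Fin n))) (a : List Cell),
      (cs.foldl (fun a x => (List.finRange _).foldl
        (fun a j => a.modify (x.2 j) ((φ x.1).addPins j)) a) a).length = a.length := by
    intro cs
    induction cs with
    | nil => exact fun _ => rfl
    | cons x cs ih => exact fun a => (ih _).trans (length_pinStep_fold x _ a)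
  exact (this cs _).trans List.length_replicate

theorem foldl_pinStep (cs : List (Constraint Γ (Fin n))) (k : Core (Pos Γ)) :
    cs.foldl (fun k x => pinStep φ x k) k = { k with
      arr := cs.foldl (fun a x => (List.finRange _).foldl
        (fun a j => a.modify (x.2 j) ((φ x.1).addPins j)) a) k.arr } := by
  induction cs generalizing k with
  | nil => rfl
  | cons x cs ih => exact ih _

/-- The pass does not change the array, so every constraint sees the same complete pins. Text is
pushed in front, which reverses the order of the constraints. The final `stat` plays no role later
and is left unspecified. -/
theorem exists_foldl_emitStep (cs : List (Constraint Γ (Fin n))) (k : Core (Pos Γ)) :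
    ∃ stat, cs.foldl (fun k x => emitStep φ β w x k) k = {
      stat := stat
      fail := k.fail || cs.any fun x => (φ x.1).fails β fun j => cellAt k.arr (x.2 j)
      query := unary ((cs.reverse.flatMap fun x => (φ x.1).edgesOf β w (fun j => (x.2 j : ℕ))
        fun j => cellAt k.arr (x.2 j)).flatMap edgeText) ++ k.query
      arr := k.arr } := by
  induction cs generalizing k with
  | nil => exact ⟨k.stat, by simp [unary]⟩
  | cons x cs ih =>
    obtain ⟨stat, h⟩ := ih (emitStep φ β w x k)
    refine ⟨stat, h.trans ?_⟩
    simp only [emitStep, List.any_cons, List.reverse_cons, List.flatMap_append, unary_append,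
      Bool.or_assoc, List.append_assoc]
    simp

theorem length_flatMap_constraintNumbers (cs : List (Constraint Γ (Fin n))) :
    cs.length ≤ (unary (cs.flatMap CSPCode.constraintNumbers)).length := by
  induction cs with
  | nil => simp
  | cons x cs ih =>
    rw [List.flatMap_cons, unary_append, List.length_append, CSPCode.constraintNumbers,
      unary_cons]
    simp only [List.length_cons, List.length_append]
    omega

/-- The query is written backwards: gadget, constraints, number of vertices. Counting moves the n
array cells to the auxiliary stack, and w + 2 more are added; this height is the number of bits that
will be accepted from the answer. -/
theorem exists_exec_prepare (cs : List (Constraint Γ (Fin n))) (m K : ℕ)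
    (hK : ∀ i, stepCost φ i ≤ K) :
    ∃ c : Conf (Pos Γ), Exec (prepare φ β w)
      (initialConf (unary (n :: cs.flatMap CSPCode.constraintNumbers)) m)
      ((6 * K + 10) * ((unary (n :: cs.flatMap CSPCode.constraintNumbers)).length + m + 1) ^ 2) c ∧
      c.fail = reductionFails φ β cs ∧
      c.query = unary (reductionVertices φ w cs :: (reductionEdges φ β w cs).flatMap edgeText) ∧
      c.queryError = List.replicate m true ∧ c.output = [] ∧ c.copy = [] ∧
      c.tmp.length = n + w + 2 := by
  have hK' : ∀ i, (Γ.get i).arity ≤ K := fun i => (by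
    have := hK i
    simp only [stepCost] at this
    omega)
  set s := unary (cs.flatMap CSPCode.constraintNumbers) with hs
  have hi : unary (n :: cs.flatMap CSPCode.constraintNumbers) =
      List.replicate n true ++ false :: s := unary_cons _ _
  let c₀ : Conf (Pos Γ) := { initialConf s m with last := some false }
  let k₀ : Core (Pos Γ) :=
    { stat := fun _ => Cell.const false
      fail := false
      query := unary ((gadgetEdges w).flatMap edgeText)
      arr := List.replicate n (Cell.const false) }
  have h1 : Exec readCount (initialConf (unary (n :: cs.flatMap CSPCode.constraintNumbers)) m)
      (n + 1) (c₀.withCore { k₀ with query := [] }) :=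
    (exec_readCount n s _ hi).congr (by simp [c₀, k₀, Conf.withCore, initialConf])
  have h2 : Exec (pushString (unary ((gadgetEdges w).flatMap edgeText)))
      (c₀.withCore { k₀ with query := [] }) 0 (c₀.withCore k₀) :=
    (exec_pushString _ _).congr (by simp [c₀, k₀, Conf.withCore])
  have h3 := exec_pass (G := pinStep φ) (Good := fun k => k.arr.length = n) (act := pinAct φ)
    (fun x k c hk hc ht ha => (exec_pinAct x k c hk hc ht ha).mono
      (Nat.mul_le_mul_right _ (hK x.1))) hK'
    (fun x k hk => (length_pinStep_fold x _ _).trans hk) cs k₀ (by simp [k₀]) c₀ rfl rfl rfl rfl rfl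
  rw [foldl_pinStep] at h3
  have h4 := exec_pass (G := emitStep φ β w) (Good := fun k => k.arr.length = n)
    (act := emitAct φ β w) (fun x k c hk hc ht ha => (exec_emitAct x k c hk hc ht ha).mono
      (Nat.mul_le_mul_right _ (hK x.1))) hK' (fun x k hk => hk) cs
    { k₀ with arr := pinArray φ cs } (length_pinArray cs) { c₀ with last := none } rfl rfl rfl rfl
    rfl
  obtain ⟨stat, hstat⟩ := exists_foldl_emitStep (φ := φ) (β := β) (w := w) cs
    { k₀ with arr := pinArray φ cs }
  rw [hstat] at h4
  have h5 := exec_emitCount w (becomesVertex w) (Conf.withCore { c₀ with last := none }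
    { stat := stat
      fail := reductionFails φ β cs
      query := unary ((reductionEdges φ β w cs).flatMap edgeText)
      arr := pinArray φ cs })
  have h7 : ∀ c : Conf (Pos Γ), Exec
      (.forEachRev (fun _ => pushWork .tmp fun _ => Cell.const false) (List.range (w + 2))) c
      ((List.range (w + 2)).length * 0)
      { c with tmp := (List.range (w + 2)).map (fun _ => Cell.const false) ++ c.tmp } :=
    fun c => exec_forEachRev (fun _ => pushWork .tmp fun _ => Cell.const false) 0
      (fun l => { c with tmp := l.map (fun _ => Cell.const false) ++ c.tmp }) (List.range (w + 2))
      fun x _ l => exec_pushTmp _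
  refine ⟨_, (h1.seq (h2.seq (h3.seq (h4.seq ((h5.congr_left ?_).seq
    ((exec_passError _).seq (h7 _))))))).mono ?_, ?_, ?_, ?_, ?_, ?_, ?_⟩
  · congr 1
    simp [reductionFails, reductionEdges, k₀, unary_append]
  · have hlen := length_flatMap_constraintNumbers cs
    rw [← hs] at hlen
    rw [hi]
    have e1 : c₀.input.length = s.length := rfl
    have e2 : c₀.error.length = m := List.length_replicate
    have e3 : (pinArray φ cs).length = n := length_pinArray cs
    simp only [Conf.withCore, e1, e2, e3, List.length_append, List.length_replicate,
      List.length_cons, Nat.mul_zero]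
    generalize s.length = a at *
    generalize cs.length = b at *
    have h8 : b * (3 * K * (n + 1) + 1) ≤ a * (3 * K * (n + 1) + 1) := Nat.mul_le_mul_right _ hlen
    set N := n + (a + 1) + m + 1
    have h9 : a * (3 * K * (n + 1) + 1) ≤ (3 * K + 1) * N ^ 2 := by
      have ha : a ≤ N := by omega
      have hn : n + 1 ≤ N := by omega
      calc a * (3 * K * (n + 1) + 1) ≤ N * (3 * K * N + N) := by gcongr; omega
        _ = (3 * K + 1) * N ^ 2 := by ring
    have h10 : N ≤ N ^ 2 := Nat.le_self_pow (by norm_num) N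
    -- The first summand pays for the loops of the two passes over the constraints, the second for
    -- everything that is linear in N.
    have h11 : (6 * K + 10) * N ^ 2 = 2 * ((3 * K + 1) * N ^ 2) + 8 * N ^ 2 := by ring
    omega
  · rfl
  · simp [Conf.withCore, reductionVertices, ← unary_append]
  · simp [Conf.withCore, c₀, initialConf]
  · rfl
  · rfl
  · simp [Conf.withCore, length_pinArray, c₀, initialConf]
    omega

/-- The answer is reversed twice, so its least significant bit is on top again. -/
theorem exists_exec_finish (c : Conf (Pos Γ)) (hc : c.copy = []) (ho : c.output = []) :
    ∃ c', Exec finish c (2 * (c.tmp.length + 1)) c' ∧ c'.output = c.answer.take c.tmp.length := by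
  refine ⟨_, ((exec_takeAnswer c hc).seq (exec_copyToOutput
    (c.answer.take c.tmp.length).reverse _ ?_)).mono ?_, ?_⟩
  · simp
  · simp
    omega
  · simp [ho]

end

/-! ### The length of a good answer -/

theorem decodeBits_bits (y : ℕ) : decodeBits y.bits = y := by
  induction y using Nat.binaryRec' with
  | zero => simp [decodeBits]
  | bit b n h ih =>
    rw [Nat.bits_append_bit n b h]
    exact congrArg (Nat.bit b) ih

/-- For m ≥ 2 the relative error is at most √e < 2, so a good approximation has at most one bit more
than the bound on `z` suggests. -/
theorem Approximates.length_bits_le {m z Y b : ℕ} (hm : 2 ≤ m) (hz : z ≤ 2 ^ b)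
    (h : Approximates m z Y) : Y.bits.length ≤ b + 1 := by
  rw [Nat.size_eq_bits_len, Nat.size_le]
  have h1 : Real.exp (1 / (m : ℝ)) < 2 := by
    have hm' : (2 : ℝ) ≤ m := by exact_mod_cast hm
    calc Real.exp (1 / (m : ℝ)) ≤ Real.exp (1 / 2) :=
          Real.exp_le_exp.2 (one_div_le_one_div_of_le (by norm_num) hm')
      _ < 2 := by
        rw [← Real.lt_log_iff_exp_lt (by norm_num)]
        linarith [Real.log_two_gt_d9]
  have hz' : (z : ℝ) ≤ 2 ^ b := by exact_mod_cast hz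
  rcases Nat.eq_zero_or_pos z with rfl | hz0
  · have : (Y : ℝ) ≤ 0 := by simpa using h.2
    have : Y = 0 := by exact_mod_cast le_antisymm this (Nat.cast_nonneg Y)
    rw [this]
    positivity
  · have hz0' : (0 : ℝ) < z := by exact_mod_cast hz0
    have : (Y : ℝ) < 2 ^ (b + 1) := by
      calc (Y : ℝ) ≤ Real.exp (1 / (m : ℝ)) * z := h.2
        _ < 2 * z := by gcongr
        _ ≤ 2 * 2 ^ b := by gcongr
        _ = 2 ^ (b + 1) := by ring
    exact_mod_cast this

theorem numIndependent_le {n : ℕ} (H : Hypergraph (Fin n)) : H.numIndependent ≤ 2 ^ n := by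
  refine (Set.ncard_le_card _).trans_eq ?_
  simp

/-! ### The runs of the reduction machine -/

section

open ProbOracleTM Turing

variable {Γ : ConstraintLanguage} (φ : ∀ i : Fin Γ.length, ConjFormula (Γ.get i).arity)
  (β : Bool) (w : ℕ)

/-- The machine that carries out the reduction. -/
noncomputable def reductionMachine : ProbOracleTM :=
  haveI := finite_workStack (P := Pos Γ)
  haveI := finite_reg (P := Pos Γ)
  oneCall (initialConf [] 0 : Conf (Pos Γ)).reg (prepare φ β w) finish fun v => v.fail

/-- A configuration of the machine with the given memory. -/
noncomputable def reductionCfg (l : Option (reductionMachine φ β w).Label) (c : Conf (Pos Γ)) :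
    (reductionMachine φ β w).Cfg := ⟨l, c.reg, c.stk⟩

variable {φ β w}

theorem detStep_of_ask (c : (reductionMachine φ β w).Cfg)
    (h : c.l = some (reductionMachine φ β w).ask) : (reductionMachine φ β w).detStep c = c := by
  obtain ⟨l, v, S⟩ := c
  cases h
  rfl

theorem initial_eq (s : List Bool) (m : ℕ) : (reductionMachine φ β w).initial s m =
    reductionCfg φ β w (some (reductionMachine φ β w).main) (initialConf s m) := by
  unfold reductionCfg ProbOracleTM.initial
  congr 1
  funext k
  rcases k with k | k <;> cases k <;> rfl

theorem answered_eq (l : Option (reductionMachine φ β w).Label) (c : Conf (Pos Γ)) (y : ℕ) :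
    (reductionMachine φ β w).answered (reductionCfg φ β w l c) y =
    reductionCfg φ β w (some (reductionMachine φ β w).resume)
      { c with query := [], queryError := [], answer := y.bits } := by
  unfold reductionCfg ProbOracleTM.answered
  congr 1
  funext k
  rcases k with k | k <;> cases k <;> rfl

theorem iterate_detStep_main {c c' : Conf (Pos Γ)} {B : ℕ} (h : Exec (prepare φ β w) c B c') :
    ∃ t ≤ B + 1, (reductionMachine φ β w).detStep^[t]
      (reductionCfg φ β w (some (reductionMachine φ β w).main) c) =
      reductionCfg φ β w (if c'.fail then none else some (reductionMachine φ β w).ask) c' := by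
  obtain ⟨t, ht, h⟩ := h _ (oneCallCode (prepare φ β w) finish fun v => v.fail)
    OneCallLabel.before (.branch (fun v => v.fail) .halt (.goto fun _ => .ask)) (fun _ => rfl)
  refine ⟨t + 1, by omega, ?_⟩
  rw [Function.iterate_succ_apply]
  refine Eq.trans h ?_
  have hb : (cond c'.reg.fail ⟨none, c'.reg, c'.stk⟩ ⟨some OneCallLabel.ask, c'.reg, c'.stk⟩ :
      (reductionMachine φ β w).Cfg) =
      reductionCfg φ β w (if c'.fail then none else some (reductionMachine φ β w).ask) c' := by
    have : c'.reg.fail = c'.fail := rfl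
    rw [this]
    cases c'.fail <;> rfl
  exact hb

theorem iterate_detStep_resume {c c' : Conf (Pos Γ)} {B : ℕ} (h : Exec finish c B c') :
    ∃ t ≤ B + 1, (reductionMachine φ β w).detStep^[t]
      (reductionCfg φ β w (some (reductionMachine φ β w).resume) c) =
      reductionCfg φ β w none c' := by
  obtain ⟨t, ht, h⟩ := h _ (oneCallCode (prepare φ β w) finish fun v => v.fail)
    OneCallLabel.after .halt (fun _ => rfl)
  refine ⟨t + 1, by omega, ?_⟩
  rw [Function.iterate_succ_apply]
  exact h

/-- Separates the machine from the combinatorics: it remains to show that the numbers computed by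
the machine describe a hypergraph with the right count, or that the flag is raised only when there
are no solutions. Because the count is preserved exactly, the oracle is called with the same error,
and its success probability carries over. -/
theorem apReducible_of_reduction {d D : ℕ}
    (h : ∀ x : (sharpCSP Γ d).Inst,
      (reductionFails φ β x.1.constraints = true ∧ x.1.toInstance.Z = 0) ∨
      (reductionFails φ β x.1.constraints = false ∧ ∃ y : (sharpHIS w D).Inst,
        y.1.n ≤ x.1.n + w ∧
        y.1.enc = unary (reductionVertices φ w x.1.constraints ::
          (reductionEdges φ β w x.1.constraints).flatMap edgeText) ∧
        y.1.toHypergraph.numIndependent = x.1.toInstance.Z)) :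
    APReducible (sharpCSP Γ d) (sharpHIS w D) := by
  classical
  obtain ⟨K, hK⟩ : ∃ K, ∀ i, stepCost φ i ≤ K :=
    ⟨Finset.univ.sup (stepCost φ), fun i => Finset.le_sup (Finset.mem_univ i)⟩
  -- The quadratic term bounds the part before the call; the linear one covers the call, the copying
  -- of n + w + 2 bits, and also the error parameter m.
  let p : Polynomial ℕ := Polynomial.C (6 * K + 10) * (Polynomial.X + 1) ^ 2 +
    (Polynomial.C 2 * Polynomial.X + Polynomial.C (2 * w + 20))
  have hp : ∀ N, p.eval N = (6 * K + 10) * (N + 1) ^ 2 + (2 * N + (2 * w + 20)) := by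
    intro N
    simp [p]
  have hcoin : ∀ b l, (reductionMachine φ β w).prog b l = (reductionMachine φ β w).prog true l :=
    fun _ _ => rfl
  -- the run when the instance is found not to be satisfiable
  have key1 : ∀ (O : Approximator) (x : (sharpCSP Γ d).Inst) (m : ℕ),
      reductionFails φ β x.1.constraints = true →
      (∀ t, ∀ c ∈ ((reductionMachine φ β w).run O ((sharpCSP Γ d).enc x) m t).support,
        c.l ≠ some (reductionMachine φ β w).ask) ∧
      ∃ c : (reductionMachine φ β w).Cfg, c.l = none ∧
        (reductionMachine φ β w).port c .output = [] ∧
        (reductionMachine φ β w).run O ((sharpCSP Γ d).enc x) m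
          (p.eval (((sharpCSP Γ d).enc x).length + m)) = PMF.pure c := by
    intro O x m hf
    obtain ⟨c, hc, h1, -, -, h4, -, -⟩ := exists_exec_prepare (φ := φ) (β := β) (w := w)
      x.1.constraints m K hK
    obtain ⟨t, ht, hrun⟩ := iterate_detStep_main hc
    rw [← initial_eq] at hrun
    rw [h1, hf, if_pos rfl] at hrun
    have hrun' : (reductionMachine φ β w).detStep^[t]
      ((reductionMachine φ β w).initial ((sharpCSP Γ d).enc x) m) = reductionCfg φ β w none c := hrun
    refine ⟨?_, reductionCfg φ β w none c, rfl, h4, ?_⟩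
    · intro s c' hc'
      rw [run_of_halts hcoin detStep_of_ask O hrun' rfl s, PMF.support_pure,
        Set.mem_singleton_iff] at hc'
      subst hc'
      exact label_ne_ask_of_halts detStep_of_ask hrun' rfl s
    · rw [run_of_halts hcoin detStep_of_ask O hrun' rfl]
      congr 1
      refine iterate_detStep_of_le hrun' rfl (ht.trans ?_)
      rw [hp]
      exact Nat.add_le_add_left (by omega) _
  -- the run otherwise
  have key2 : ∀ (O : Approximator) (x : (sharpCSP Γ d).Inst) (m : ℕ),
      reductionFails φ β x.1.constraints = false → ∀ y : (sharpHIS w D).Inst,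
      y.1.enc = unary (reductionVertices φ w x.1.constraints ::
          (reductionEdges φ β w x.1.constraints).flatMap edgeText) →
      (∀ t, ∀ c ∈ ((reductionMachine φ β w).run O ((sharpCSP Γ d).enc x) m t).support,
        c.l = some (reductionMachine φ β w).ask →
        (reductionMachine φ β w).port c .query = y.1.enc ∧
        ((reductionMachine φ β w).port c .queryError).length = m) ∧
      ∃ F : ℕ → (reductionMachine φ β w).Cfg, (∀ Y, (F Y).l = none) ∧
        (∀ Y, (reductionMachine φ β w).port (F Y) .output = Y.bits.take (x.1.n + w + 2)) ∧
        (reductionMachine φ β w).run O ((sharpCSP Γ d).enc x) m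
          (p.eval (((sharpCSP Γ d).enc x).length + m)) = (O y.1.enc m).map F := by
    intro O x m hf y hy
    obtain ⟨c, hc, h1, h2, h3, h4, h5, h6⟩ := exists_exec_prepare (φ := φ) (β := β) (w := w)
      x.1.constraints m K hK
    obtain ⟨t, ht, hrun⟩ := iterate_detStep_main hc
    rw [← initial_eq, h1, hf] at hrun
    have hrun' : (reductionMachine φ β w).detStep^[t]
      ((reductionMachine φ β w).initial ((sharpCSP Γ d).enc x) m) =
      reductionCfg φ β w (some (reductionMachine φ β w).ask) c := hrun
    have hq : (reductionMachine φ β w).port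
      (reductionCfg φ β w (some (reductionMachine φ β w).ask) c) .query = y.1.enc := h2.trans hy.symm
    have hqe : ((reductionMachine φ β w).port
      (reductionCfg φ β w (some (reductionMachine φ β w).ask) c) .queryError).length = m :=
      (congrArg List.length h3).trans List.length_replicate
    have hfin : ∀ Y : ℕ, ∃ c' : Conf (Pos Γ), Exec finish
        { c with query := [], queryError := [], answer := Y.bits } (2 * (x.1.n + w + 3)) c' ∧
        c'.output = Y.bits.take (x.1.n + w + 2) := by
      intro Y
      have := exists_exec_finish { c with query := [], queryError := [], answer := Y.bits } h5 h4
      simpa only [h6] using this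
    choose f hf1 hf2 using hfin
    obtain ⟨T, hT, g1, g2, g3, g4⟩ := exists_run_of_asks hcoin detStep_of_ask O hrun' rfl
      (fun Y => reductionCfg φ β w none (f Y)) (2 * (x.1.n + w + 3) + 1) (by
        intro Y
        obtain ⟨s, hs, hs'⟩ := iterate_detStep_resume (φ := φ) (β := β) (w := w) (hf1 Y)
        rw [answered_eq]
        exact ⟨s, hs, hs', rfl⟩)
    refine ⟨?_, fun Y => reductionCfg φ β w none (f Y), fun _ => rfl, hf2, ?_⟩
    · intro s c' hc' hl
      rcases lt_trichotomy s T with hs | rfl | hs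
      · exact absurd hl (g1 s hs c' hc')
      · rw [g2, PMF.support_pure, Set.mem_singleton_iff] at hc'
        subst hc'
        exact ⟨hq, hqe⟩
      · exact absurd hl (g3 s hs c' hc')
    · rw [g4 _ ?_, hq, hqe]
      have hn : x.1.n ≤ ((sharpCSP Γ d).enc x).length := by
        change _ ≤ (unary (x.1.n :: _)).length
        rw [unary_cons]
        simp
      rw [hp]
      have ht' : t ≤ (6 * K + 10) * (((sharpCSP Γ d).enc x).length + m + 1) ^ 2 + 1 := ht
      generalize (6 * K + 10) * (((sharpCSP Γ d).enc x).length + m + 1) ^ 2 = Q at ht' ⊢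
      omega
  refine ⟨reductionMachine φ β w, p, ?_, ?_⟩
  · intro O x m hm
    rcases h x with ⟨hf, -⟩ | ⟨hf, y, -, hy, -⟩
    · obtain ⟨h1, c, h2, -, h4⟩ := key1 O x m hf
      refine ⟨?_, fun t c hc hl => absurd hl (h1 t c hc)⟩
      intro c' hc'
      rw [h4, PMF.support_pure, Set.mem_singleton_iff] at hc'
      rw [hc', h2]
    · obtain ⟨h1, F, h2, -, h4⟩ := key2 O x m hf y hy
      refine ⟨?_, fun t c hc hl => ?_⟩
      · intro c' hc'
        rw [h4, PMF.support_map] at hc'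
        obtain ⟨Y, -, rfl⟩ := hc'
        exact h2 Y
      · obtain ⟨h5, h6⟩ := h1 t c hc hl
        refine ⟨⟨y, h5⟩, hm.trans_eq h6.symm, h6.le.trans ?_⟩
        rw [hp]
        omega
  · intro O hO x m hm
    rcases h x with ⟨hf, hZ⟩ | ⟨hf, y, hn, hy, hZ⟩
    · obtain ⟨-, c, -, h3, h4⟩ := key1 O x m hf
      simp only [outputAfter]
      rw [h4, PMF.pure_map, h3]
      have : decodeBits [] ∈ {Y | Approximates m ((sharpCSP Γ d).count x) Y} := by
        change Approximates m x.1.toInstance.Z 0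
        simp [hZ, Approximates]
      rw [PMF.toOuterMeasure_pure_apply, if_pos this]
      exact ENNReal.div_le_of_le_mul (by norm_num)
    · obtain ⟨-, F, -, h3, h4⟩ := key2 O x m hf y hy
      simp only [outputAfter]
      rw [h4, PMF.map_comp, PMF.toOuterMeasure_map_apply]
      refine (hO y m hm).trans ((O y.1.enc m).toOuterMeasure.mono ?_)
      intro Y hY
      have hY' : Approximates m x.1.toInstance.Z Y := hZ ▸ hY
      -- The count is at most 2 to the number of vertices, which is at most n + w; hence the
      -- truncation does not affect a good answer.
      have hb : Y.bits.length ≤ x.1.n + w + 1 := hY.length_bits_le hm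
        ((numIndependent_le _).trans (Nat.pow_le_pow_right (by norm_num) hn))
      simp only [Set.mem_preimage, Function.comp_apply, h3]
      rw [List.take_of_length_le (by omega), decodeBits_bits]
      exact hY'

end

/-! ## Correctness of the reduction -/

/-- The value that satisfies a clause. -/
def Connective.bit : Connective → Bool
  | .or => true
  | .nand => false

theorem Connective.holds_iff (κ : Connective) {r : ℕ} (a : Fin r → Bool) (l : List (Fin r)) :
    κ.Holds a l ↔ ∃ i ∈ l, a i = κ.bit := by
  cases κ <;> rfl

section

theorem cellAt_modify {a : List Cell} {i : ℕ} (hi : i < a.length) (f : Cell → Cell) (u : ℕ) :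
    cellAt (a.modify i f) u = if i = u then f (cellAt a u) else cellAt a u := by
  unfold cellAt
  rw [List.getD_eq_getElem?_getD, List.getD_eq_getElem?_getD, List.getElem?_modify]
  by_cases h : i = u
  · subst h
    simp [hi]
  · simp [h]

variable {Γ : ConstraintLanguage} {φ : ∀ i : Fin Γ.length, ConjFormula (Γ.get i).arity} {n : ℕ}

/-- Pins are accumulated by disjunction, so neither their order nor repeated variables in a scope
matter. -/
theorem cellAt_foldl_modify (x : Constraint Γ (Fin n)) (l : List (Fin (Γ.get x.1).arity))
    (a : List Cell) (ha : a.length = n) (u : ℕ) (b : Bool) :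
    cellAt (l.foldl (fun a j => a.modify (x.2 j) ((φ x.1).addPins j)) a) u b = true ↔
      cellAt a u b = true ∨ ∃ j ∈ l, (x.2 j : ℕ) = u ∧ (j, b) ∈ (φ x.1).pins := by
  induction l generalizing a with
  | nil => simp
  | cons j l ih =>
    rw [List.foldl_cons, ih _ (by simpa using ha), cellAt_modify (by rw [ha]; exact (x.2 j).2)]
    by_cases h : (x.2 j : ℕ) = u
    · simp [h, ConjFormula.addPins, or_assoc]
    · simp [h]

theorem cellAt_pinArray (cs : List (Constraint Γ (Fin n))) (u : ℕ) (b : Bool) :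
    cellAt (pinArray φ cs) u b = true ↔
      ∃ x ∈ cs, ∃ j, (x.2 j : ℕ) = u ∧ (j, b) ∈ (φ x.1).pins := by
  have key : ∀ (cs : List (Constraint Γ (Fin n))) (a : List Cell), a.length = n →
      (cellAt (cs.foldl (fun a x => (List.finRange _).foldl
        (fun a j => a.modify (x.2 j) ((φ x.1).addPins j)) a) a) u b = true ↔
      cellAt a u b = true ∨ ∃ x ∈ cs, ∃ j, (x.2 j : ℕ) = u ∧ (j, b) ∈ (φ x.1).pins) := by
    intro cs
    induction cs with
    | nil => simp
    | cons x cs ih =>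
      intro a ha
      rw [List.foldl_cons, ih _ ((length_pinStep_fold x _ a).trans ha),
        cellAt_foldl_modify x _ a ha]
      simp only [List.mem_finRange, true_and, List.exists_mem_cons_iff, or_assoc]
  rw [pinArray, key cs _ (by simp)]
  have : cellAt (List.replicate n (Cell.const false)) u b = false := by
    unfold cellAt
    rw [List.getD_eq_getElem?_getD, List.getElem?_replicate]
    split_ifs <;> rfl
  simp [this]

/-- The pins on the variable `v`. -/
def pinCell (φ : ∀ i : Fin Γ.length, ConjFormula (Γ.get i).arity)
    (cs : List (Constraint Γ (Fin n))) (v : Fin n) : Cell := cellAt (pinArray φ cs) v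

theorem pinCell_iff {cs : List (Constraint Γ (Fin n))} {v : Fin n} {b : Bool} :
    pinCell φ cs v b = true ↔ ∃ x ∈ cs, ∃ j, x.2 j = v ∧ (j, b) ∈ (φ x.1).pins := by
  simp only [pinCell, cellAt_pinArray, Fin.ext_iff]

theorem pinArray_eq_ofFn (cs : List (Constraint Γ (Fin n))) :
    pinArray φ cs = List.ofFn (pinCell φ cs) := by
  refine List.ext_getElem (by simp [length_pinArray]) fun i h1 h2 => ?_
  rw [List.getElem_ofFn]
  exact (List.getD_eq_getElem _ _ h1).symm

/-- Each constraint is checked only at the positions it pins itself. This finds every conflict,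
since a variable with contradictory pins is pinned by some constraint, and that constraint consults
the complete array. -/
theorem reductionFails_eq_false_iff {β : Bool} {cs : List (Constraint Γ (Fin n))} :
    reductionFails φ β cs = false ↔
      (∀ v, ¬ (pinCell φ cs v true = true ∧ pinCell φ cs v false = true)) ∧
      ∀ x ∈ cs, ∀ l ∈ (φ x.1).clauses, ∃ j ∈ l, pinCell φ cs (x.2 j) (!β) = false := by
  rw [reductionFails, List.any_eq_false]
  simp only [ConjFormula.fails, Bool.or_eq_true, List.any_eq_true, List.all_eq_true,
    Finset.mem_toList, Bool.and_eq_true, not_or, not_exists, not_and, not_forall,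
    Bool.not_eq_true, exists_prop]
  constructor
  · refine fun h => ⟨fun v h1 => ?_, fun x hx => (h x hx).2⟩
    obtain ⟨x, hx, j, rfl, hj⟩ := pinCell_iff.1 h1
    exact (h x hx).1 _ hj h1
  · exact fun h x hx => ⟨fun p _ => h.1 _, h.2 x hx⟩

variable {κ : Connective}

theorem satisfies_iff (hφ : ∀ i, (φ i).rel κ = (Γ.get i).rel) (C : CSPCode Γ)
    (a : Fin C.n → Bool) : C.toInstance.Satisfies a ↔
      (∀ v b, pinCell φ C.constraints v b = true → a v = b) ∧
      ∀ x ∈ C.constraints, ∀ l ∈ (φ x.1).clauses, ∃ j ∈ l, a (x.2 j) = κ.bit := by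
  simp only [CSPInstance.Satisfies, CSPCode.toInstance, List.mem_toFinset, ← hφ,
    ConjFormula.rel, Set.mem_ofPred_eq, Connective.holds_iff]
  constructor
  · refine fun h => ⟨fun v b hv => ?_, fun x hx => (h x hx).2⟩
    obtain ⟨x, hx, j, rfl, hj⟩ := pinCell_iff.1 hv
    exact (h x hx).1 _ hj
  · exact fun h x hx => ⟨fun p hp => h.1 _ _ (pinCell_iff.2 ⟨x, hx, p.1, rfl, hp⟩), h.2 x hx⟩

theorem Z_eq_zero_of_reductionFails (hφ : ∀ i, (φ i).rel κ = (Γ.get i).rel) (C : CSPCode Γ)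
    (h : reductionFails φ κ.bit C.constraints = true) : C.toInstance.Z = 0 := by
  have : {a | C.toInstance.Satisfies a} = ∅ := by
    rw [Set.eq_empty_iff_forall_notMem]
    intro a ha
    rw [Set.mem_ofPred_eq, satisfies_iff hφ] at ha
    have h' : reductionFails φ κ.bit C.constraints = false := by
      rw [reductionFails_eq_false_iff]
      constructor
      · intro v hv
        have := (ha.1 v _ hv.1).symm.trans (ha.1 v _ hv.2)
        simp at this
      · intro x hx l hl
        obtain ⟨j, hj, hj'⟩ := ha.2 x hx l hl
        refine ⟨j, hj, ?_⟩
        by_contra hne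
        rw [Bool.not_eq_false] at hne
        have := ha.1 _ _ hne
        rw [hj'] at this
        simp at this
    rw [h] at h'
    simp at h'
  rw [CSPInstance.Z, this, Set.ncard_empty]

/-! ### Languages of width zero -/

theorem clauses_eq_empty {r : ℕ} {ψ : ConjFormula r} (h : ψ.width ≤ 0) : ψ.clauses = ∅ := by
  rw [Finset.eq_empty_iff_forall_notMem]
  intro l hl
  have := (Finset.le_sup (f := List.length) hl).trans h
  exact ψ.ne_nil_of_mem l hl (List.length_eq_zero_iff.1 (Nat.le_zero.1 this))

theorem reductionEdges_zero (hw : ∀ i, (φ i).width ≤ 0) (β : Bool)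
    (cs : List (Constraint Γ (Fin n))) : reductionEdges φ β 0 cs = [] := by
  have : ∀ x : Constraint Γ (Fin n), (φ x.1).clauses = ∅ := fun x => clauses_eq_empty (hw x.1)
  simp [reductionEdges, ConjFormula.edgesOf, gadgetEdges, this]

theorem countP_ofFn {α : Type} (f : α → Bool) (g : Fin n → α) :
    (List.ofFn g).countP f = Fintype.card {v // f (g v) = true} := by
  rw [List.ofFn_eq_map, List.countP_map, List.countP_eq_length_filter, Fintype.card_subtype,
    ← List.toFinset_card_of_nodup ((List.nodup_finRange n).filter _)]
  congr 1
  ext v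
  simp

/-- Width zero leaves only pins, so solutions are arbitrary on unpinned variables and determined
elsewhere. -/
theorem Z_eq_two_pow (hφ : ∀ i, (φ i).rel κ = (Γ.get i).rel) (hw : ∀ i, (φ i).width ≤ 0)
    (C : CSPCode Γ) (h : reductionFails φ κ.bit C.constraints = false) :
    C.toInstance.Z = 2 ^ reductionVertices φ 0 C.constraints := by
  have hcl : ∀ x : Constraint Γ (Fin C.n), (φ x.1).clauses = ∅ := fun x => clauses_eq_empty (hw x.1)
  have hconf := (reductionFails_eq_false_iff.1 h).1
  set E := pinCell φ C.constraints
  let e : {a | C.toInstance.Satisfies a} ≃ ({v // becomesVertex 0 (E v) = true} → Bool) :=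
    { toFun := fun a v => a.1 v
      -- For a pinned variable without conflict, `E v true` is the value it is pinned to.
      invFun := fun g => ⟨fun v => if hv : becomesVertex 0 (E v) = true then g ⟨v, hv⟩ else E v true,
        by
          rw [Set.mem_ofPred_eq, satisfies_iff hφ]
          refine ⟨fun v b hv => ?_, fun x _ => by simp [hcl]⟩
          have := hconf v
          cases b <;> simp_all [becomesVertex, E]⟩
      left_inv := by
        rintro ⟨a, ha⟩
        rw [Set.mem_ofPred_eq, satisfies_iff hφ] at ha
        ext v
        have h1 : E v true = true → a v = true := ha.1 v true
        have h2 : E v false = true → a v = false := ha.1 v false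
        change (if _ : becomesVertex 0 (E v) = true then a v else E v true) = a v
        cases h3 : E v true with
        | true => simp [h1 h3]
        | false =>
          cases h4 : E v false with
          | true => simp [h2 h4]
          | false => simp [becomesVertex, h3, h4]
      right_inv := by
        intro g
        ext v
        simp [v.2] }
  unfold CSPInstance.Z
  rw [← Nat.card_coe_set_eq, Nat.card_congr e, Nat.card_eq_fintype_card,
    Fintype.card_fun, Fintype.card_bool, reductionVertices, pinArray_eq_ofFn, countP_ofFn]
  rfl

theorem exists_hypergraph_of_width_zero (hφ : ∀ i, (φ i).rel κ = (Γ.get i).rel)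
    (hw : ∀ i, (φ i).width ≤ 0) (C : CSPCode Γ)
    (h : reductionFails φ κ.bit C.constraints = false) (D : ℕ) :
    ∃ y : (sharpHIS 0 D).Inst, y.1.n ≤ C.n + 0 ∧
      y.1.enc = unary (reductionVertices φ 0 C.constraints ::
        (reductionEdges φ κ.bit 0 C.constraints).flatMap edgeText) ∧
      y.1.toHypergraph.numIndependent = C.toInstance.Z := by
  have hE : (⟨reductionVertices φ 0 C.constraints, [], by simp⟩ :
      HypergraphCode).toHypergraph.edges = ∅ := by simp [HypergraphCode.toHypergraph]
  refine ⟨⟨⟨reductionVertices φ 0 C.constraints, [], by simp⟩, ?_, ?_⟩, ?_, ?_, ?_⟩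
  · simp only [Hypergraph.width, hE, Finset.sup_empty]
    rfl
  · simp [Hypergraph.degree, Hypergraph.vertexDegree, hE]
  · exact Nat.add_le_add_right (List.countP_le_length.trans_eq (length_pinArray _)) 0
  · rw [reductionEdges_zero hw]
    rfl
  · rw [Z_eq_two_pow hφ hw C h]
    simp only [Hypergraph.numIndependent, Hypergraph.IsIndependent, hE]
    simp [Set.ncard_univ]

end

/-! ### Languages of positive width -/

section

variable {Γ : ConstraintLanguage} (φ : ∀ i : Fin Γ.length, ConjFormula (Γ.get i).arity) {n : ℕ}
  (w : ℕ)

/-- The hyper-edges of the reduction for one constraint. -/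
noncomputable def constraintEdges (β : Bool) (E : Fin n → Cell) (x : Constraint Γ (Fin n)) :
    List (List (Fin (n + w))) :=
  ((φ x.1).pins.toList.map fun p => [(x.2 p.1).addNat w]) ++
    (φ x.1).clauses.toList.map fun l =>
      (l.filter fun j => !E (x.2 j) (!β)).map fun j => (x.2 j).addNat w

/-- A vertex of the gadget. -/
def gadgetVertex (n : ℕ) {w : ℕ} (i : Fin w) : Fin (n + w) := Fin.castLE (Nat.le_add_left w n) i

/-- The hyper-edges of the reduction. -/
noncomputable def hyperedges (β : Bool) (cs : List (Constraint Γ (Fin n))) :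
    List (List (Fin (n + w))) :=
  (cs.reverse.flatMap (constraintEdges φ w β (pinCell φ cs))) ++
    ((List.finRange w).map (fun i => [gadgetVertex n i]) ++
      [(List.finRange w).map (gadgetVertex n)])

variable {φ w} {β : Bool} {cs : List (Constraint Γ (Fin n))}

/-- Links the lists of numbers that the machine writes with lists of genuine vertices: the gadget
occupies the first w vertices and variables are shifted by w. -/
theorem map_hyperedges (hw : w ≠ 0) :
    (hyperedges φ w β cs).map (List.map Fin.val) = reductionEdges φ β w cs := by
  simp only [hyperedges, reductionEdges, List.map_append, List.map_flatMap, gadgetEdges, hw,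
    if_false]
  congr 1
  · congr 1
    funext x
    simp only [constraintEdges, ConjFormula.edgesOf, hw, if_false, List.map_append, List.map_map]
    congr 1
    refine List.map_congr_left fun l _ => ?_
    rw [Function.comp_apply, List.map_map]
    rfl
  · congr 1
    · rw [List.map_map, ← List.map_coe_finRange_eq_range, List.map_map]
      rfl
    · rw [List.map_singleton, List.map_map, ← List.map_coe_finRange_eq_range]
      rfl

theorem mem_hyperedges {l : List (Fin (n + w))} : l ∈ hyperedges φ w β cs ↔
    (∃ x ∈ cs, ∃ p ∈ (φ x.1).pins, [(x.2 p.1).addNat w] = l) ∨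
    (∃ x ∈ cs, ∃ c ∈ (φ x.1).clauses,
      ((c.filter fun j => !pinCell φ cs (x.2 j) (!β)).map fun j => (x.2 j).addNat w) = l) ∨
    (∃ i : Fin w, [gadgetVertex n i] = l) ∨ (List.finRange w).map (gadgetVertex n) = l := by
  simp only [hyperedges, constraintEdges, List.mem_append, List.mem_flatMap, List.mem_reverse,
    List.mem_map, Finset.mem_toList, List.mem_finRange, true_and, List.mem_singleton,
    eq_comm (a := l), and_or_left, exists_or, or_assoc]

/-- If the flag is not raised, every clause keeps an argument that is not pinned to the value ¬β. -/
theorem hyperedges_ne_nil (hw : w ≠ 0) (h : reductionFails φ β cs = false) :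
    ∀ l ∈ hyperedges φ w β cs, l ≠ [] := by
  intro l hl
  rcases mem_hyperedges.1 hl with ⟨x, _, p, _, rfl⟩ | ⟨x, hx, c, hc, rfl⟩ | ⟨i, rfl⟩ | rfl
  · simp
  · obtain ⟨j, hj, hj'⟩ := (reductionFails_eq_false_iff.1 h).2 x hx c hc
    exact List.ne_nil_of_mem (List.mem_map_of_mem (List.mem_filter.2 ⟨hj, by simp [hj']⟩))
  · simp
  · simpa [List.finRange_eq_nil_iff] using hw

/-- The hypergraph of the reduction. -/
noncomputable def reductionHypergraph (φ : ∀ i : Fin Γ.length, ConjFormula (Γ.get i).arity)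
    (hw : w ≠ 0) (h : reductionFails φ β cs = false) : Hypergraph (Fin (n + w)) where
  edges := ((hyperedges φ w β cs).map List.toFinset).toFinset
  nonempty_of_mem := by
    intro e he
    simp only [List.mem_toFinset, List.mem_map] at he
    obtain ⟨l, hl, rfl⟩ := he
    exact List.toFinset_nonempty_iff l |>.2 (hyperedges_ne_nil hw h l hl)

/-- A presentation of the hypergraph of the reduction. -/
noncomputable def hypergraphCode (φ : ∀ i : Fin Γ.length, ConjFormula (Γ.get i).arity)
    (hw : w ≠ 0) (h : reductionFails φ β cs = false) : HypergraphCode where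
  n := n + w
  edges := hyperedges φ w β cs
  ne_nil_of_mem := hyperedges_ne_nil hw h

theorem enc_hypergraphCode (hw : w ≠ 0) (h : reductionFails φ β cs = false) :
    (hypergraphCode φ hw h).enc =
      unary (reductionVertices φ w cs :: (reductionEdges φ β w cs).flatMap edgeText) := by
  have h1 : reductionVertices φ w cs = n + w := by
    have : becomesVertex w = fun _ => true := by
      funext x
      simp [becomesVertex, hw]
    rw [reductionVertices, this, List.countP_true, length_pinArray]
  rw [HypergraphCode.enc, h1, ← map_hyperedges hw, List.flatMap_map]
  change unary ((n + w) :: (hyperedges φ w β cs).flatMap HypergraphCode.edgeNumbers) = _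
  congr 1
  congr 1
  congr 1
  funext e
  simp [HypergraphCode.edgeNumbers, edgeText]

theorem mem_edges_reductionHypergraph (hw : w ≠ 0) (h : reductionFails φ β cs = false)
    (e : Finset (Fin (n + w))) : e ∈ (reductionHypergraph φ hw h).edges ↔
    (∃ x ∈ cs, ∃ p ∈ (φ x.1).pins, {(x.2 p.1).addNat w} = e) ∨
    (∃ x ∈ cs, ∃ c ∈ (φ x.1).clauses,
      ((c.filter fun j => !pinCell φ cs (x.2 j) (!β)).map fun j =>
        (x.2 j).addNat w).toFinset = e) ∨
    (∃ i : Fin w, {gadgetVertex n i} = e) ∨ Finset.univ.image (gadgetVertex n) = e := by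
  change e ∈ ((hyperedges φ w β cs).map List.toFinset).toFinset ↔ _
  rw [List.mem_toFinset, List.mem_map]
  have hg : ((List.finRange w).map (gadgetVertex n)).toFinset =
      Finset.univ.image (gadgetVertex n) := by
    ext u
    simp
  constructor
  · rintro ⟨l, hl, rfl⟩
    rcases mem_hyperedges.1 hl with ⟨x, hx, p, hp, rfl⟩ | ⟨x, hx, c, hc, rfl⟩ | ⟨i, rfl⟩ | rfl
    · exact .inl ⟨x, hx, p, hp, by simp⟩
    · exact .inr (.inl ⟨x, hx, c, hc, rfl⟩)
    · exact .inr (.inr (.inl ⟨i, by simp⟩))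
    · exact .inr (.inr (.inr hg.symm))
  · rintro (⟨x, hx, p, hp, rfl⟩ | ⟨x, hx, c, hc, rfl⟩ | ⟨i, rfl⟩ | rfl)
    · exact ⟨_, mem_hyperedges.2 (.inl ⟨x, hx, p, hp, rfl⟩), by simp⟩
    · exact ⟨_, mem_hyperedges.2 (.inr (.inl ⟨x, hx, c, hc, rfl⟩)), rfl⟩
    · exact ⟨_, mem_hyperedges.2 (.inr (.inr (.inl ⟨i, rfl⟩))), by simp⟩
    · exact ⟨_, mem_hyperedges.2 (.inr (.inr (.inr rfl))), hg⟩

theorem gadgetVertex_injective : Function.Injective (gadgetVertex n (w := w)) :=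
  Fin.castLE_injective (Nat.le_add_left w n)

theorem gadgetVertex_ne_addNat (i : Fin w) (v : Fin n) : gadgetVertex n i ≠ v.addNat w := by
  intro h
  have := congrArg Fin.val h
  simp [gadgetVertex] at this
  omega

theorem eq_addNat_or_eq_gadgetVertex (u : Fin (n + w)) :
    (∃ v : Fin n, v.addNat w = u) ∨ ∃ i : Fin w, gadgetVertex n i = u := by
  by_cases hu : (u : ℕ) < w
  · exact .inr ⟨⟨u, hu⟩, rfl⟩
  · refine .inl ⟨⟨u - w, by omega⟩, Fin.ext ?_⟩
    simp
    omega

/-- Vertices of pinned variables are excluded whichever value the pin has. The large gadget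
hyper-edge imposes nothing beyond the exclusion of the single gadget vertices. -/
theorem isIndependent_reductionHypergraph (hw : w ≠ 0) (h : reductionFails φ β cs = false)
    (T : Finset (Fin (n + w))) : (reductionHypergraph φ hw h).IsIndependent T ↔
    (∀ v b, pinCell φ cs v b = true → v.addNat w ∉ T) ∧
    (∀ x ∈ cs, ∀ c ∈ (φ x.1).clauses,
      ∃ j ∈ c, pinCell φ cs (x.2 j) (!β) = false ∧ (x.2 j).addNat w ∉ T) ∧
    ∀ i : Fin w, gadgetVertex n i ∉ T := by
  have : (reductionHypergraph φ hw h).IsIndependent T ↔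
    ∀ e ∈ (reductionHypergraph φ hw h).edges, ¬ e ⊆ T := Iff.rfl
  rw [this]
  constructor
  · intro hT
    refine ⟨fun v b hv hvT => ?_, fun x hx c hc => ?_, fun i hi => ?_⟩
    · obtain ⟨x, hx, j, rfl, hj⟩ := pinCell_iff.1 hv
      exact hT _ ((mem_edges_reductionHypergraph hw h _).2 (.inl ⟨x, hx, _, hj, rfl⟩)) (by simpa using hvT)
    · have := hT _ ((mem_edges_reductionHypergraph hw h _).2 (.inr (.inl ⟨x, hx, c, hc, rfl⟩)))
      rw [Finset.not_subset] at this
      obtain ⟨u, hu, huT⟩ := this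
      rw [List.mem_toFinset, List.mem_map] at hu
      obtain ⟨j, hj, rfl⟩ := hu
      rw [List.mem_filter] at hj
      exact ⟨j, hj.1, by simpa using hj.2, huT⟩
    · exact hT _ ((mem_edges_reductionHypergraph hw h _).2 (.inr (.inr (.inl ⟨i, rfl⟩))))
        (by simpa using hi)
  · rintro ⟨h1, h2, h3⟩ e he heT
    rcases (mem_edges_reductionHypergraph hw h _).1 he with
      ⟨x, hx, p, hp, rfl⟩ | ⟨x, hx, c, hc, rfl⟩ | ⟨i, rfl⟩ | rfl
    · exact h1 _ _ (pinCell_iff.2 ⟨x, hx, p.1, rfl, hp⟩) (by simpa using heT)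
    · obtain ⟨j, hj, hj', hjT⟩ := h2 x hx c hc
      exact hjT (heT (List.mem_toFinset.2 (List.mem_map_of_mem
        (List.mem_filter.2 ⟨hj, by simp [hj']⟩))))
    · exact h3 i (by simpa using heT)
    · exact h3 ⟨0, Nat.pos_of_ne_zero hw⟩ (heT (Finset.mem_image_of_mem _ (Finset.mem_univ _)))

/-- Deleting or identifying arguments only shrinks clauses, so they stay within w; the large gadget
hyper-edge attains w. -/
theorem width_reductionHypergraph (hw : w ≠ 0) (h : reductionFails φ β cs = false)
    (hφ : ∀ i, (φ i).width ≤ w) : (reductionHypergraph φ hw h).width = w := by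
  refine le_antisymm (Finset.sup_le fun e he => ?_) ?_
  · rcases (mem_edges_reductionHypergraph hw h _).1 he with
      ⟨x, hx, p, hp, rfl⟩ | ⟨x, hx, c, hc, rfl⟩ | ⟨i, rfl⟩ | rfl
    · rw [Finset.card_singleton]
      omega
    · refine (List.toFinset_card_le _).trans ?_
      rw [List.length_map]
      exact (List.length_filter_le _ _).trans
        ((Finset.le_sup (f := List.length) hc).trans (hφ x.1))
    · rw [Finset.card_singleton]
      omega
    · exact Finset.card_image_le.trans_eq (Finset.card_fin w)
  · have := Finset.le_sup (f := Finset.card)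
      ((mem_edges_reductionHypergraph hw h _).2 (.inr (.inr (.inr rfl))))
    rwa [Finset.card_image_of_injective _ gadgetVertex_injective, Finset.card_fin] at this

/-- The left side bounds the hyper-edges at `u` that come from one constraint with scope `v`. A pin
is counted at its own position, and a clause that meets the fibre over `u` is counted at least once
there. -/
theorem card_filter_le_sum_occurrences {r : ℕ} (ψ : ConjFormula r) (v : Fin r → Fin n)
    (u : Fin n) :
    (ψ.pins.filter fun p => v p.1 = u).card + (ψ.clauses.filter fun l => ∃ j ∈ l, v j = u).card ≤
      ∑ j with v j = u, ψ.occurrences j := by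
  have h1 : (ψ.pins.filter fun p => v p.1 = u).card =
      ∑ j with v j = u, (ψ.pins.filter fun p => p.1 = j).card := by
    rw [Finset.card_eq_sum_card_fiberwise (f := Prod.fst) (t := Finset.univ.filter fun j => v j = u)]
    · refine Finset.sum_congr rfl fun j hj => ?_
      rw [Finset.filter_filter]
      congr 1
      refine Finset.filter_congr fun p _ => ?_
      simp only [Finset.mem_filter, Finset.mem_univ, true_and] at hj
      constructor
      · exact fun hp => hp.2
      · rintro rfl
        exact ⟨hj, rfl⟩
    · intro p hp
      simpa using (Finset.mem_filter.1 hp).2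
  have h2 : (ψ.clauses.filter fun l => ∃ j ∈ l, v j = u).card ≤
      ∑ j with v j = u, ∑ l ∈ ψ.clauses, l.count j := by
    rw [Finset.sum_comm, Finset.card_filter]
    refine Finset.sum_le_sum fun l _ => ?_
    split_ifs with hl
    · obtain ⟨j, hj, hju⟩ := hl
      refine (List.one_le_count_iff.2 hj).trans
        (Finset.single_le_sum (f := fun j => l.count j) (fun _ _ => Nat.zero_le _) ?_)
      simpa using hju
    · exact Nat.zero_le _
  rw [h1]
  refine (Nat.add_le_add_left h2 _).trans_eq ?_
  rw [← Finset.sum_add_distrib]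
  rfl

/-- Every hyper-edge at a variable comes from a pin or clause at one of the positions the variable
fills, each of which meets at most k of them. Coinciding hyper-edges and dropped arguments only
lower the degree. -/
theorem degree_reductionHypergraph {C : CSPCode Γ} (hw : w ≠ 0)
    (h : reductionFails φ β C.constraints = false) {k d : ℕ}
    (hk : ∀ i, (φ i).maxOccurrences ≤ k) (hk1 : 1 ≤ k) (hd : 2 ≤ d)
    (hC : C.toInstance.degree ≤ d) : (reductionHypergraph φ hw h).degree ≤ k * d := by
  classical
  refine Finset.sup_le fun u _ => ?_
  change ((reductionHypergraph φ hw h).edges.filter fun e => u ∈ e).card ≤ _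
  rcases eq_addNat_or_eq_gadgetVertex u with ⟨v, rfl⟩ | ⟨i, rfl⟩
  · have hsub : ((reductionHypergraph φ hw h).edges.filter fun e => v.addNat w ∈ e) ⊆
        C.toInstance.constraints.biUnion fun x =>
          (((φ x.1).pins.filter fun p => x.2 p.1 = v).image fun p => {(x.2 p.1).addNat w}) ∪
          (((φ x.1).clauses.filter fun l => ∃ j ∈ l, x.2 j = v).image fun c =>
            ((c.filter fun j => !pinCell φ C.constraints (x.2 j) (!β)).map fun j =>
              (x.2 j).addNat w).toFinset) := by
      intro e he
      rw [Finset.mem_filter] at he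
      obtain ⟨he, hv⟩ := he
      rw [Finset.mem_biUnion]
      rcases (mem_edges_reductionHypergraph hw h _).1 he with
        ⟨x, hx, p, hp, rfl⟩ | ⟨x, hx, c, hc, rfl⟩ | ⟨i, rfl⟩ | rfl
      · refine ⟨x, List.mem_toFinset.2 hx, Finset.mem_union_left _
          (Finset.mem_image.2 ⟨p, Finset.mem_filter.2 ⟨hp, ?_⟩, rfl⟩)⟩
        rw [Finset.mem_singleton] at hv
        exact ((Fin.addNat_inj w).1 hv).symm
      · refine ⟨x, List.mem_toFinset.2 hx, Finset.mem_union_right _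
          (Finset.mem_image.2 ⟨c, Finset.mem_filter.2 ⟨hc, ?_⟩, rfl⟩)⟩
        rw [List.mem_toFinset, List.mem_map] at hv
        obtain ⟨j, hj, hjv⟩ := hv
        exact ⟨j, (List.mem_filter.1 hj).1, (Fin.addNat_inj w).1 hjv⟩
      · rw [Finset.mem_singleton] at hv
        exact absurd hv.symm (gadgetVertex_ne_addNat i v)
      · rw [Finset.mem_image] at hv
        obtain ⟨i, -, hi⟩ := hv
        exact absurd hi (gadgetVertex_ne_addNat i v)
    calc _ ≤ _ := Finset.card_le_card hsub
      _ ≤ ∑ x ∈ C.toInstance.constraints, ((((φ x.1).pins.filter fun p => x.2 p.1 = v).card) +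
          ((φ x.1).clauses.filter fun l => ∃ j ∈ l, x.2 j = v).card) := by
        refine Finset.card_biUnion_le.trans (Finset.sum_le_sum fun x _ => ?_)
        exact (Finset.card_union_le _ _).trans
          (Nat.add_le_add Finset.card_image_le Finset.card_image_le)
      _ ≤ ∑ x ∈ C.toInstance.constraints, k * (Finset.univ.filter fun j => x.2 j = v).card := by
        refine Finset.sum_le_sum fun x _ => (card_filter_le_sum_occurrences _ _ _).trans ?_
        refine (Finset.sum_le_card_nsmul _ _ k fun j _ =>
          (Finset.le_sup (f := (φ x.1).occurrences) (Finset.mem_univ j)).trans (hk x.1)).trans_eq ?_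
        rw [smul_eq_mul, Nat.mul_comm]
      _ = k * C.toInstance.varDegree v := by
        rw [← Finset.mul_sum, CSPInstance.varDegree]
      _ ≤ k * d := Nat.mul_le_mul_left k
        ((Finset.le_sup (f := C.toInstance.varDegree) (Finset.mem_univ v)).trans hC)
  -- A gadget vertex lies only in its one-element hyper-edge and in the large one; 2 ≤ kd because k
  -- ≥ 1 and d ≥ 2.
  · have hsub : ((reductionHypergraph φ hw h).edges.filter
        fun e => gadgetVertex C.n i ∈ e) ⊆
        {{gadgetVertex C.n i}, Finset.univ.image (gadgetVertex C.n)} := by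
      intro e he
      rw [Finset.mem_filter] at he
      obtain ⟨he, hv⟩ := he
      rw [Finset.mem_insert, Finset.mem_singleton]
      rcases (mem_edges_reductionHypergraph hw h _).1 he with
        ⟨x, hx, p, hp, rfl⟩ | ⟨x, hx, c, hc, rfl⟩ | ⟨i', rfl⟩ | rfl
      · rw [Finset.mem_singleton] at hv
        exact absurd hv (gadgetVertex_ne_addNat _ _)
      · rw [List.mem_toFinset, List.mem_map] at hv
        obtain ⟨j, -, hj⟩ := hv
        exact absurd hj.symm (gadgetVertex_ne_addNat _ _)
      · rw [Finset.mem_singleton] at hv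
        rw [hv]
        exact .inl rfl
      · exact .inr rfl
    calc _ ≤ _ := Finset.card_le_card hsub
      _ ≤ 2 := Finset.card_le_two
      _ ≤ 1 * d := by omega
      _ ≤ k * d := Nat.mul_le_mul_right d hk1

/-- A solution is sent to the set of variables that have the value ¬β without being pinned to it.
Nothing is lost, as the value of a variable pinned to ¬β is known; the inverse restores these
variables. -/
theorem numIndependent_reductionHypergraph {κ : Connective} (hφ : ∀ i, (φ i).rel κ = (Γ.get i).rel)
    {C : CSPCode Γ} (hw : w ≠ 0) (h : reductionFails φ κ.bit C.constraints = false) :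
    (reductionHypergraph φ hw h).numIndependent = C.toInstance.Z := by
  classical
  have hconf := (reductionFails_eq_false_iff.1 h).1
  set E := pinCell φ C.constraints with hE
  symm
  rw [CSPInstance.Z, Hypergraph.numIndependent]
  refine Set.ncard_congr (fun a _ => (Finset.univ.filter fun v => a v = !κ.bit ∧
    E v (!κ.bit) = false).image fun v => v.addNat w) ?_ ?_ ?_
  · intro a ha
    rw [Set.mem_ofPred_eq, satisfies_iff hφ] at ha
    refine (isIndependent_reductionHypergraph hw h _).2 ⟨fun v b hv hvT => ?_, fun x hx c hc => ?_,
      fun i hi => ?_⟩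
    · rw [Finset.mem_image] at hvT
      obtain ⟨v', hv', hvv⟩ := hvT
      rw [(Fin.addNat_inj w).1 hvv, Finset.mem_filter] at hv'
      obtain ⟨-, h1, h2⟩ := hv'
      rw [ha.1 v b hv] at h1
      rw [← h1, hE, hv] at h2
      simp at h2
    · obtain ⟨j, hj, haj⟩ := ha.2 x hx c hc
      refine ⟨j, hj, ?_, ?_⟩
      · by_contra hne
        rw [Bool.not_eq_false] at hne
        have := ha.1 _ _ hne
        rw [haj] at this
        simp at this
      · intro hT
        rw [Finset.mem_image] at hT
        obtain ⟨v', hv', hvv⟩ := hT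
        rw [(Fin.addNat_inj w).1 hvv, Finset.mem_filter, haj] at hv'
        simp at hv'
    · rw [Finset.mem_image] at hi
      obtain ⟨v, -, hv⟩ := hi
      exact gadgetVertex_ne_addNat i v hv.symm
  · intro a a' ha ha' haa
    rw [Set.mem_ofPred_eq, satisfies_iff hφ] at ha ha'
    funext v
    cases hv : E v (!κ.bit) with
    | true => rw [ha.1 v _ hv, ha'.1 v _ hv]
    | false =>
      have := Finset.ext_iff.1 haa (v.addNat w)
      simp only [Finset.mem_image, Finset.mem_filter, Finset.mem_univ, true_and, Fin.addNat_inj,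
        exists_eq_right, hv, and_true] at this
      -- Two bits that agree on being ¬β are equal.
      exact (by decide : ∀ p q c : Bool, (p = !c ↔ q = !c) → p = q) _ _ _ this
  · intro T hT
    obtain ⟨h1, h2, h3⟩ := (isIndependent_reductionHypergraph hw h T).1 hT
    refine ⟨fun v => if E v (!κ.bit) = true ∨ v.addNat w ∈ T then !κ.bit else κ.bit, ?_, ?_⟩
    · rw [Set.mem_ofPred_eq, satisfies_iff hφ]
      refine ⟨fun v b hv => ?_, fun x hx c hc => ?_⟩
      · by_cases hb : b = κ.bit
        · subst hb
          -- A variable pinned to β is not pinned to ¬β, as there are no conflicts, and it is not in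
          -- `T`, as it carries a one-element hyper-edge.
          rw [if_neg]
          rintro (hv' | hvT)
          · refine hconf v ?_
            generalize κ.bit = b at hv hv'
            cases b
            · exact ⟨hv', hv⟩
            · exact ⟨hv, hv'⟩
          · exact h1 v _ hv hvT
        · obtain rfl : b = !κ.bit := Bool.eq_not.2 hb
          exact if_pos (.inl hv)
      · obtain ⟨j, hj, hj1, hj2⟩ := h2 x hx c hc
        exact ⟨j, hj, by simp [hE, hj1, hj2]⟩
    · ext u
      rcases eq_addNat_or_eq_gadgetVertex u with ⟨v, rfl⟩ | ⟨i, rfl⟩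
      · simp only [Finset.mem_image, Finset.mem_filter, Finset.mem_univ, true_and, Fin.addNat_inj,
          exists_eq_right]
        cases hv : E v (!κ.bit) with
        | true => simpa using h1 v _ hv
        | false => by_cases hvT : v.addNat w ∈ T <;> simp [hvT]
      · simp only [h3 i, iff_false, Finset.mem_image, not_exists, not_and]
        exact fun v _ hv => gadgetVertex_ne_addNat i v hv.symm

end

/-- CSPs of bounded degree over a language of conjunctive relations reduce to counting
independent sets in hypergraphs. -/
theorem apReducible_sharpHIS {Γ : ConstraintLanguage}
    (φ : ∀ i : Fin Γ.length, ConjFormula (Γ.get i).arity) (κ : Connective)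
    (hφ : ∀ i, (φ i).rel κ = (Γ.get i).rel) (w k d : ℕ) (hw : ∀ i, (φ i).width ≤ w)
    (hk : w ≠ 0 → 1 ≤ k ∧ ∀ i, (φ i).maxOccurrences ≤ k) (hd : 2 ≤ d) :
    APReducible (sharpCSP Γ d) (sharpHIS w (k * d)) := by
  refine apReducible_of_reduction (φ := φ) (β := κ.bit) fun x => ?_
  cases h : reductionFails φ κ.bit x.1.constraints with
  | true => exact .inl ⟨rfl, Z_eq_zero_of_reductionFails hφ x.1 h⟩
  | false =>
    refine .inr ⟨rfl, ?_⟩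
    by_cases hw0 : w = 0
    · subst hw0
      exact exists_hypergraph_of_width_zero hφ hw x.1 h _
    · exact ⟨⟨hypergraphCode φ hw0 h, width_reductionHypergraph hw0 h hw,
        degree_reductionHypergraph hw0 h (hk hw0).2 (hk hw0).1 hd x.2⟩, le_rfl,
        enc_hypergraphCode hw0 h, numIndependent_reductionHypergraph hφ hw0 h⟩

/-! ## Normal forms -/

section

variable {r : ℕ}

/-- The set `S` of arguments is a clause that is implied by the relation `R` and that involves
none of the variables that are constant on `R`. -/
def IsImplied (κ : Connective) (R : Set (Fin r → Bool)) (S : Finset (Fin r)) : Prop :=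
  (∀ i ∈ S, ∀ b, ¬ ∀ a ∈ R, a i = b) ∧ ∀ a ∈ R, ∃ i ∈ S, a i = κ.bit

open Classical in
/-- The formula that consists of all implied pins and of all minimal implied clauses. -/
noncomputable def normalForm (κ : Connective) (R : Set (Fin r → Bool)) (hR : R.Nonempty) :
    ConjFormula r where
  pins := Finset.univ.filter fun p => ∀ a ∈ R, a p.1 = p.2
  clauses := (Finset.univ.filter (Minimal (IsImplied κ R))).image Finset.toList
  ne_nil_of_mem := by
    simp only [Finset.mem_image, Finset.mem_filter, Finset.mem_univ, true_and]
    rintro _ ⟨S, hS, rfl⟩ h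
    obtain ⟨a, ha⟩ := hR
    obtain ⟨i, hi, -⟩ := hS.prop.2 a ha
    rw [← Finset.mem_toList, h] at hi
    simp at hi

theorem mem_pins_normalForm {κ : Connective} {R : Set (Fin r → Bool)} {hR : R.Nonempty}
    {p : Fin r × Bool} : p ∈ (normalForm κ R hR).pins ↔ ∀ a ∈ R, a p.1 = p.2 := by
  simp [normalForm]

theorem mem_clauses_normalForm {κ : Connective} {R : Set (Fin r → Bool)} {hR : R.Nonempty}
    {l : List (Fin r)} : l ∈ (normalForm κ R hR).clauses ↔
      ∃ S, Minimal (IsImplied κ R) S ∧ S.toList = l := by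
  simp [normalForm]

/-- Pinned variables are constant on `R`, hence absent from clauses. An implied clause with a single
argument would make that variable constant, which is excluded, and minimal sets form an antichain.
-/
theorem isNormalized_normalForm (κ : Connective) (R : Set (Fin r → Bool)) (hR : R.Nonempty) :
    (normalForm κ R hR).IsNormalized where
  pinned_not_mem p hp l hl := by
    obtain ⟨S, hS, rfl⟩ := mem_clauses_normalForm.1 hl
    rw [Finset.mem_toList]
    exact fun h => hS.prop.1 _ h _ (mem_pins_normalForm.1 hp)
  nodup l hl := by
    obtain ⟨S, -, rfl⟩ := mem_clauses_normalForm.1 hl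
    exact S.nodup_toList
  two_le_length l hl := by
    obtain ⟨S, hS, rfl⟩ := mem_clauses_normalForm.1 hl
    rw [Finset.length_toList]
    by_contra h
    obtain ⟨a, ha⟩ := hR
    obtain ⟨i, hi, -⟩ := hS.prop.2 a ha
    refine hS.prop.1 i hi κ.bit fun a' ha' => ?_
    obtain ⟨j, hj, hj'⟩ := hS.prop.2 a' ha'
    rwa [Finset.card_le_one.1 (by omega) i hi j hj]
  not_subset l hl l' hl' hne h := by
    obtain ⟨S, hS, rfl⟩ := mem_clauses_normalForm.1 hl
    obtain ⟨S', hS', rfl⟩ := mem_clauses_normalForm.1 hl'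
    have hSS : S ⊆ S' := fun i hi => Finset.mem_toList.1 (h (Finset.mem_toList.2 hi))
    exact hne (by rw [hSS.antisymm (hS'.le_of_le hS.prop hSS)])

/-- The point is that every clause of `φ` follows from the normal form: it contains either an
argument that is pinned to the satisfying value or a minimal implied clause. -/
theorem rel_normalForm {κ : Connective} (φ : ConjFormula r) (hR : (φ.rel κ).Nonempty) :
    (normalForm κ (φ.rel κ) hR).rel κ = φ.rel κ := by
  classical
  refine Set.Subset.antisymm (fun a ha => ⟨fun p hp => ?_, fun l hl => ?_⟩)
    fun a ha => ⟨fun p hp => mem_pins_normalForm.1 hp a ha, fun l hl => ?_⟩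
  · exact ha.1 p (mem_pins_normalForm.2 fun a' ha' => ha'.1 p hp)
  · have hl' : ∀ a' ∈ φ.rel κ, ∃ i ∈ l, a' i = κ.bit := fun a' ha' =>
      (κ.holds_iff _ _).1 (ha'.2 l hl)
    rw [κ.holds_iff]
    by_cases hpin : ∃ i ∈ l, ∀ a' ∈ φ.rel κ, a' i = κ.bit
    · obtain ⟨i, hi, h⟩ := hpin
      exact ⟨i, hi, ha.1 (i, κ.bit) (mem_pins_normalForm.2 h)⟩
    · push Not at hpin
      -- Arguments that never take the satisfying value are dropped. The others take it somewhere
      -- but not everywhere, so they are not constant, and the reduced clause is still implied.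
      have himp : IsImplied κ (φ.rel κ)
          (l.toFinset.filter fun i => ∃ a' ∈ φ.rel κ, a' i = κ.bit) := by
        constructor
        · intro i hi b hb
          rw [Finset.mem_filter, List.mem_toFinset] at hi
          obtain ⟨hil, a1, ha1, h1⟩ := hi
          obtain ⟨a2, ha2, h2⟩ := hpin i hil
          exact h2 ((hb a2 ha2).trans ((hb a1 ha1).symm.trans h1))
        · intro a' ha'
          obtain ⟨i, hi, h⟩ := hl' a' ha'
          exact ⟨i, Finset.mem_filter.2 ⟨List.mem_toFinset.2 hi, a', ha', h⟩, h⟩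
      obtain ⟨S, hS, hmin⟩ := exists_minimal_le_of_wellFoundedLT _ _ himp
      obtain ⟨i, hi, h⟩ := (κ.holds_iff _ _).1
        (ha.2 _ (mem_clauses_normalForm.2 ⟨S, hmin, rfl⟩))
      exact ⟨i, List.mem_toFinset.1 (Finset.mem_filter.1 (hS (Finset.mem_toList.1 hi))).1, h⟩
  · obtain ⟨S, hS, rfl⟩ := mem_clauses_normalForm.1 hl
    rw [κ.holds_iff]
    simpa using hS.prop.2 a ha

/-- The formula that consists of pins only. -/
def ofPins (P : Finset (Fin r × Bool)) : ConjFormula r := ⟨P, ∅, by simp⟩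

theorem isNormalized_ofPins (P : Finset (Fin r × Bool)) : (ofPins P).IsNormalized := by
  constructor <;> simp [ofPins]

theorem exists_isNormalized (κ : Connective) (φ : ConjFormula r) :
    ∃ ψ : ConjFormula r, ψ.IsNormalized ∧ ψ.rel κ = φ.rel κ := by
  rcases (φ.rel κ).eq_empty_or_nonempty with h | h
  -- Without variables there can be no clauses, as these are non-empty, and then the relation is not
  -- empty. Otherwise the variable 0 is available for contradictory pins.
  · rcases r with _ | r
    · have : (fun i => i.elim0 : Fin 0 → Bool) ∈ φ.rel κ := by
        refine ⟨fun p _ => p.1.elim0, fun l hl => ?_⟩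
        cases l with
        | nil => exact absurd rfl (φ.ne_nil_of_mem _ hl)
        | cons i l => exact i.elim0
      rw [h] at this
      exact this.elim
    · refine ⟨ofPins {(0, false), (0, true)}, isNormalized_ofPins _, ?_⟩
      rw [h, Set.eq_empty_iff_forall_notMem]
      intro a ha
      have h0 : a 0 = false := ha.1 (0, false) (by simp [ofPins])
      have h1 : a 0 = true := ha.1 (0, true) (by simp [ofPins])
      simp [h0] at h1
  · exact ⟨_, isNormalized_normalForm κ _ h, rel_normalForm φ h⟩

theorem one_le_maxOccurrences {φ : ConjFormula r} (h : φ.width ≠ 0) : 1 ≤ φ.maxOccurrences := by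
  obtain ⟨l, hl⟩ : φ.clauses.Nonempty := by
    rw [Finset.nonempty_iff_ne_empty]
    intro h0
    simp [ConjFormula.width, h0] at h
  obtain ⟨i, hi⟩ := List.exists_mem_of_ne_nil l (φ.ne_nil_of_mem l hl)
  calc 1 ≤ l.count i := List.one_le_count_iff.2 hi
    _ ≤ ∑ l ∈ φ.clauses, l.count i :=
      Finset.single_le_sum (f := fun l => l.count i) (fun _ _ => Nat.zero_le _) hl
    _ ≤ φ.occurrences i := Nat.le_add_left _ _
    _ ≤ φ.maxOccurrences := Finset.le_sup (Finset.mem_univ i)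

theorem width_ofPins (P : Finset (Fin r × Bool)) : (ofPins P).width = 0 := by
  simp [ofPins, ConjFormula.width]

theorem maxOccurrences_ofPins_singleton (p : Fin r × Bool) :
    (ofPins {p}).maxOccurrences ≤ 1 := by
  refine Finset.sup_le fun i _ => ?_
  simpa [ofPins, ConjFormula.occurrences] using Finset.card_filter_le {p} fun p => p.1 = i

theorem rel_ofPins_singleton (κ : Connective) (b : Bool) :
    (ofPins {((0 : Fin 1), b)}).rel κ = {fun _ => b} := by
  ext a
  simp [ofPins, ConjFormula.rel, funext_iff, Fin.forall_fin_one]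

end

end BoundedCSP

/-! ### The proposition -/

theorem proposition6p3 (κ : BoundedCSP.Connective) (R : BoundedCSP.BoolRel)
    (hR : BoundedCSP.IsConj κ R) :
    (∃ φ : BoundedCSP.ConjFormula R.arity, φ.IsNormalized ∧ φ.rel κ = R.rel) ∧
    ∀ φ : BoundedCSP.ConjFormula R.arity, φ.IsNormalized → φ.rel κ = R.rel →
      ∀ d : ℕ, 2 ≤ d →
        BoundedCSP.APReducible
          (BoundedCSP.sharpCSP (R :: BoundedCSP.pinLanguage) d)
          (BoundedCSP.sharpHIS φ.width (φ.maxOccurrences * d)) := by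
  constructor
  · obtain ⟨φ, hφ⟩ := hR
    rw [← hφ]
    exact BoundedCSP.exists_isNormalized κ φ
  · intro φ _ hφ d hd
    have key : ∀ i : Fin (R :: BoundedCSP.pinLanguage).length,
        ∃ ψ : BoundedCSP.ConjFormula ((R :: BoundedCSP.pinLanguage).get i).arity,
          ψ.rel κ = ((R :: BoundedCSP.pinLanguage).get i).rel ∧ ψ.width ≤ φ.width ∧
          (φ.width ≠ 0 → ψ.maxOccurrences ≤ φ.maxOccurrences) := by
      -- The formula of a pin has width 0 and one occurrence, so it respects both bounds whenever
      -- `φ` has positive width; for width 0 the bound on occurrences is not needed, as there are no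
      -- hyper-edges.
      have pin : ∀ b : Bool, ∃ ψ : BoundedCSP.ConjFormula 1,
          ψ.rel κ = {fun _ => b} ∧ ψ.width ≤ φ.width ∧
          (φ.width ≠ 0 → ψ.maxOccurrences ≤ φ.maxOccurrences) := fun b =>
        ⟨BoundedCSP.ofPins {(0, b)}, BoundedCSP.rel_ofPins_singleton κ b,
          (BoundedCSP.width_ofPins _).trans_le (Nat.zero_le _), fun h =>
          (BoundedCSP.maxOccurrences_ofPins_singleton _).trans
            (BoundedCSP.one_le_maxOccurrences h)⟩
      intro i
      match i with
      | ⟨0, _⟩ => exact ⟨φ, hφ, le_rfl, fun _ => le_rfl⟩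
      | ⟨1, _⟩ => exact pin false
      | ⟨2, _⟩ => exact pin true
    choose ψ h1 h2 h3 using key
    exact BoundedCSP.apReducible_sharpHIS ψ κ h1 _ _ d h2
      (fun h => ⟨BoundedCSP.one_le_maxOccurrences h, fun i => h3 i h⟩) hd
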